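/- **Problem.** Consider $\min_{x\in\mathbb R^n} f(x)+g(x)+h_1(p_1(x))+h_2(p_2(x))$, where $g:\mathbb R^n\to\mathbb R\cup\{+\infty\}$ is proper, closed and convex with strong convexity parameter $\mu_g\ge 0$; $f:\mathbb R^n\to\mathbb R\cup\{+\infty\}$ is convex, and finite and differentiable on an open set containing $\mathrm{dom}(g)$; $h_1:\mathbb R^{d_1}\to\mathbb R$ is convex and $L_{h_1}$-Lipschitz; $h_2$ is the indicator function of a closed convex set $\mathcal K\subset\mathbb R^{d_2}$; and $p_1:\mathbb R^n\to\mathbb R^{d_1}$, $p_2:\mathbb R^n\to\mathbb R^{d_2}$ are differentiable. Put $p=(p_1;p_2)$, $h(u_1;u_2)=h_1(u_1)+h_2(u_2)$, $F=f+g+h_1\circ p_1$, let $F^\star$ be the optimal value, $L(x;\lambda)=f(x)+g(x)+\langle\lambda,p(x)\rangle-h^*(\lambda)$ and $D(\lambda)=\inf_xL(x;\lambda)$. Assume that for all $x,y\in\mathbb R^n$, all $u_i,v_i\in\mathbb R^{d_i}$ and $\alpha\in(0,1)$: * $h_1(p_1(\alpha x+(1-\alpha)y)-\alpha u_1-(1-\alpha)v_1)\le\alpha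 h_1(p_1(x)-u_1)+(1-\alpha)h_1(p_1(y)-v_1)$; * if $p_2(x)-u_2\in\mathcal K$ and $p_2(y)-v_2\in\mathcal K$, then $p_2(\alpha x+(1-\alpha)y)-\alpha u_2-(1-\alpha)v_2\in\mathcal K$; and that there are $x^\star\in\mathrm{dom}(g)$ with $p_2(x^\star)\in\mathcal K$ and $\lambda^\star\in\mathrm{dom}(h^*)$ such that $F(x^\star)=L(x^\star;\lambda^\star)=D(\lambda^\star)$. Assume further that there are constants $L>0$ and $M_{p_2},M_{\nabla p},L_{\nabla p}\ge0$ such that for all $x,y\in\mathrm{dom}(g)$: $f(y)-f(x)-\langle\nabla f(x),y-x\rangle\le\frac L2\|x-y\|^2$, $\|p_2(x)\|\le M_{p_2}$, $\|\nabla p(x)\|\le M_{\nabla p}$ and $\|\nabla p(x)-\nabla p(y)\|\le L_{\nabla p}\|x-y\|$. **Outer method (IPALM).** Let $\beta_0,\epsilon_0>0$, $\rho\in(1/2,1)$, $0<\eta<\rho$, $m_0\ge1$, $x^{-1}\in\mathrm{dom}(g)$, $\lambda^0\in\mathrm{dom}(h^*)$, $\beta_s=\beta_0\rho^s$, $\epsilon_s=\epsilon_0\eta^s$.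 Let $$h(u;\lambda,\beta)=\max_v\Big\{\langle v,u\rangle-h^*(v)-\tfrac\beta2\|v-\lambda\|^2\Big\},$$ let $\Lambda(u;\lambda,\beta)$ be the maximizer, and let $$H_s(x)=f(x)+g(x)+h(p(x);\lambda^s,\beta_s)+\tfrac{\beta_s}2\|x-x^{s-1}\|^2,\qquad H_s^\star=\min_x H_s(x).$$ For $s\ge 0$, $x^s$ is the result of $m_s$ iterations of the inner solver on $H_s$ started from $x^{s-1}$, and $\lambda^{s+1}=\Lambda(p(x^s);\lambda^s,\beta_s)$. It is assumed that $\epsilon_0\ge H_0(x^0)-H_0^\star$. Further, $m_{s+1}$ is the smallest positive integer with $2\epsilon_s+M_s\le2^{\lfloor m_{s+1}/K_{s+1}\rfloor}\epsilon_{s+1}/2$, where $$M_s=\beta_s\|\lambda^{s+1}-\lambda^s\|^2+\tfrac{\beta_s-\beta_{s+1}}2\|\Lambda(p(x^s);\lambda^{s+1},\beta_{s+1})-\lambda^{s+1}\|^2+\tfrac{\beta_s^2}{2\beta_{s+1}-\beta_s}\|x^{s-1}-x^s\|^2$$ $$\qquad+\|\lambda^{s+1}-\lambda^s\|\sqrt{\big((\beta_s+\beta_{s+1})L_{h_1}+\|\beta_s\lambda_1^s-\beta_{s+1}\lambda_1^{s+1}\|\big)^2+\|\beta_s\lambda_2^s-\beta_{s+1}\lambda_2^{s+1}\|^2}.$$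 **Inner solver (APG).** Put $$d_s=\max\{\mathrm{dist}(y,\mathcal K):\|y\|\le M_{p_2}+\beta_s\|\lambda^s_2\|\},\qquad L_s=L+L_{\nabla p}(L_{h_1}+\beta_s^{-1}d_s)+M_{\nabla p}^2\beta_s^{-1},$$ $$K_s=\Big\lceil2\sqrt{2L_s/(\mu_g+\beta_s)}\Big\rceil,\qquad \phi_s(x)=f(x)+h(p(x);\lambda^s,\beta_s),\qquad P_s(x)=g(x)+\tfrac{\beta_s}2\|x-x^{s-1}\|^2.$$ The inner solver is the accelerated proximal gradient method for $\min\phi_s+P_s$, $$y_k=(1-\theta_k)x_k+\theta_kz_k,\quad z_{k+1}=\arg\min_z\Big\{\langle\nabla\phi_s(y_k),z\rangle+P_s(z)+\tfrac{\theta_kL_s}2\|z-z_k\|^2\Big\},\quad x_{k+1}=(1-\theta_k)x_k+\theta_kz_{k+1},$$ with $z_0=x_0$ and any weights with $\theta_0=1$, $0<\theta_k\le\frac2{k+2}$ and $\frac{1-\theta_{k+1}}{\theta_{k+1}^2}\le\frac1{\theta_k^2}$ (the same weights for all $s$), restarted from its current point $x_k$ after every $K_s$ iterations. **Constants.** Let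 $$c_0=2\Big(\|(x^{-1},\lambda^0)-(x^\star,\lambda^\star)\|+\tfrac{2\sqrt{\epsilon_0/\beta_0}}{1-\sqrt{\eta/\rho}}\Big)^2+2\|\lambda^\star\|^2+2\|x^\star\|^2,$$ $$c_1=\max\big(\epsilon_0+2L_{h_1}^2\beta_0+c_0\beta_0,\ \beta_0\|\lambda_2^\star\|\sqrt{c_0},\ \beta_0\sqrt{c_0}\big),$$ $$c_2=\log_2\Big(\tfrac4\eta+\tfrac{2\beta_0\left((11+2\rho^{-2})(L_{h_1}^2+4c_0)+4(2\rho-1)^{-1}c_0\right)}{\epsilon_0\eta}\Big)+1,$$ $$S_s=L\beta_0+L_{\nabla p}\Big(L_{h_1}\beta_0+\max_{1\le t\le s}d_t\Big)+M_{\nabla p}^2 .$$ **Corollary 4.4.** There is $C$ depending only on $c_1,c_2,\rho,\eta,\beta_0,\epsilon_0,m_0$ such that the following holds for every such problem and every such run. First, $d_t\le M_{p_2}+\beta_t\sqrt{c_0}+\mathrm{dist}(0,\mathcal K)$ for all $t\ge 0$. Second, for every $0<\epsilon\le\epsilon_0$ there is $s\ge1$ such that for all $r\ge s$ $$x^r\in\mathrm{dom}(g),\qquad|F(x^r)-F^\star|\le\epsilon,\qquad\mathrm{dist}(p_2(x^r),\mathcal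 K)\le\epsilon,$$ and the total number $\sum_{t=0}^sm_t$ of APG iterations used to compute $x^s$ satisfies: * if $\mu_g>0$: $$\sum_{t=0}^sm_t\le C\,\frac{\sqrt{S_s}+\sqrt{\mu_g}}{\sqrt{\mu_g\,\epsilon}}\,\ln\frac{c_1}{\rho\epsilon};$$ * if $\mu_g=0$: $$\sum_{t=0}^sm_t\le C\Big(\frac{\sqrt{S_s}}{\epsilon}\ln\frac{c_1}{\rho\epsilon}+\ln^2\frac{c_1}{\rho\epsilon}\Big),$$ and moreover $\sum_{t=0}^sm_t\le C\,\frac{\sqrt{S_s}}\epsilon\ln\frac{c_1}{\rho\epsilon}$ whenever $\epsilon\le\epsilon'$, where $\epsilon'>0$ may depend on the problem and the run. -/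

import Mathlib

noncomputable section

/-- `ℝⁿ` with the Euclidean norm. -/
abbrev Vec (n : ℕ) : Type := EuclideanSpace ℝ (Fin n)

/-- `ℝ^{d₁+d₂}` with the Euclidean norm, its elements written as pairs `(u₁; u₂)`. -/
abbrev PairVec (d₁ d₂ : ℕ) : Type := WithLp 2 (Vec d₁ × Vec d₂)

/-- Effective domain of an extended-valued function that never takes the value `-∞`. -/
def effDom {X : Type*} (F : X → EReal) : Set X := {x | F x ≠ ⊤}

/-- A minimizer of `G`. -/
def argmin {X : Type*} [Nonempty X] (G : X → EReal) : X :=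
  Classical.epsilon fun x => ∀ y, G x ≤ G y

/-- A maximizer of `G`. -/
def argmax {X : Type*} [Nonempty X] (G : X → EReal) : X :=
  Classical.epsilon fun x => ∀ y, G y ≤ G x

/-- Fenchel conjugate. -/
def fenchelConj {V : Type*} [NormedAddCommGroup V] [InnerProductSpace ℝ V]
    (F : V → EReal) (v : V) : EReal :=
  ⨆ u : V, ((inner ℝ v u : ℝ) : EReal) - F u

/-! ### Accelerated proximal gradient, with restart -/

/-- Admissible step weights of the accelerated proximal gradient method,
for instance `θ k = 2 / (k + 2)`, or `θ 0 = 1` and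
`θ (k + 1) ^ 2 = (1 - θ (k + 1)) * θ k ^ 2`. -/
structure IsAPGWeights (θ : ℕ → ℝ) : Prop where
  zero : θ 0 = 1
  pos : ∀ k, 0 < θ k
  le : ∀ k, θ k ≤ 2 / ((k : ℝ) + 2)
  step : ∀ k, (1 - θ (k + 1)) / θ (k + 1) ^ 2 ≤ 1 / θ k ^ 2

/-- One iteration of the accelerated proximal gradient method for `min φ + P`, with smoothness
constant `L` and weight `θ`, on a pair (main iterate `x`, auxiliary iterate `z`). -/
def apgStep {n : ℕ} (φ : Vec n → ℝ) (P : Vec n → EReal) (L θ : ℝ) (a : Vec n × Vec n) :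
    Vec n × Vec n :=
  let y := (1 - θ) • a.1 + θ • a.2
  let z := argmin fun u : Vec n =>
    P u + ((inner ℝ (gradient φ y) u + θ * L / 2 * ‖u - a.2‖ ^ 2 : ℝ) : EReal)
  ((1 - θ) • a.1 + θ • z, z)

/-- State after `k` iterations started from `x₀`; the method is restarted from its current main
iterate after every `K` iterations. -/
def apgState {n : ℕ} (φ : Vec n → ℝ) (P : Vec n → EReal) (L : ℝ) (θ : ℕ → ℝ) (K : ℕ)
    (x₀ : Vec n) : ℕ → Vec n × Vec n
  | 0 => (x₀, x₀)
  | k + 1 =>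
    let a := apgState φ P L θ K x₀ k
    apgStep φ P L (θ (k % K)) (if k % K = 0 then (a.1, a.1) else a)

/-- Output of `k` iterations of the restarted method. -/
def apg {n : ℕ} (φ : Vec n → ℝ) (P : Vec n → EReal) (L : ℝ) (θ : ℕ → ℝ) (K : ℕ)
    (x₀ : Vec n) (k : ℕ) : Vec n :=
  (apgState φ P L θ K x₀ k).1

/-! ### The composite problem `min f(x) + g(x) + h₁(p₁(x)) + h₂(p₂(x))` -/

/-- Data of the problem; `h₂` is the indicator function of `K`. -/
structure CompositeProblem (n d₁ d₂ : ℕ) where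
  f : Vec n → EReal
  g : Vec n → EReal
  h₁ : Vec d₁ → ℝ
  K : Set (Vec d₂)
  p₁ : Vec n → Vec d₁
  p₂ : Vec n → Vec d₂

/-- The constants of the assumptions: `L` bounds the curvature of `f`, `Lh₁` is a Lipschitz
constant of `h₁`, `μg` a strong convexity parameter of `g`, `Mp₂` and `MDp` are bounds on `p₂`
and on the derivative of `p`, and `LDp` is a Lipschitz constant of the derivative of `p`. -/
structure ProblemConstants where
  L : ℝ
  Lh₁ : ℝ
  μg : ℝ
  Mp₂ : ℝ
  MDp : ℝ
  LDp : ℝ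

namespace CompositeProblem

/-- `h(u₁; u₂) = h₁(u₁) + h₂(u₂)`. -/
def h {n d₁ d₂ : ℕ} (P : CompositeProblem n d₁ d₂) (u : PairVec d₁ d₂) : EReal :=
  open Classical in (P.h₁ u.fst : EReal) + if u.snd ∈ P.K then 0 else ⊤

/-- `p(x) = (p₁(x); p₂(x))`. -/
def p {n d₁ d₂ : ℕ} (P : CompositeProblem n d₁ d₂) (x : Vec n) : PairVec d₁ d₂ :=
  WithLp.toLp 2 (P.p₁ x, P.p₂ x)

/-- `F(x) = f(x) + g(x) + h₁(p₁(x))`. -/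
def F {n d₁ d₂ : ℕ} (P : CompositeProblem n d₁ d₂) (x : Vec n) : EReal :=
  P.f x + P.g x + (P.h₁ (P.p₁ x) : EReal)

/-- The optimal value of the problem. -/
def optVal {n d₁ d₂ : ℕ} (P : CompositeProblem n d₁ d₂) : EReal :=
  ⨅ x : Vec n, P.f x + P.g x + P.h (P.p x)

/-- The Lagrangian `L(x; λ)`. -/
def lagrangian {n d₁ d₂ : ℕ} (P : CompositeProblem n d₁ d₂) (x : Vec n) (lam : PairVec d₁ d₂) :
    EReal :=
  P.f x + P.g x + ((inner ℝ lam (P.p x) : ℝ) : EReal) - fenchelConj P.h lam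

/-- The Lagrange dual function `D(λ)`. -/
def dualFun {n d₁ d₂ : ℕ} (P : CompositeProblem n d₁ d₂) (lam : PairVec d₁ d₂) : EReal :=
  ⨅ x : Vec n, P.lagrangian x lam

/-- `⟨v, u⟩ - h*(v) - β/2 ‖v - λ‖²`. -/
def smoothObj {n d₁ d₂ : ℕ} (P : CompositeProblem n d₁ d₂) (u lam : PairVec d₁ d₂) (β : ℝ)
    (v : PairVec d₁ d₂) : EReal :=
  ((inner ℝ v u - β / 2 * ‖v - lam‖ ^ 2 : ℝ) : EReal) - fenchelConj P.h v

/-- The smooth approximation `h(u; λ, β)`. -/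
def hSmooth {n d₁ d₂ : ℕ} (P : CompositeProblem n d₁ d₂) (u lam : PairVec d₁ d₂) (β : ℝ) :
    EReal :=
  ⨆ v : PairVec d₁ d₂, P.smoothObj u lam β v

/-- The multiplier map `Λ(u; λ, β)`. -/
def multiplier {n d₁ d₂ : ℕ} (P : CompositeProblem n d₁ d₂) (u lam : PairVec d₁ d₂) (β : ℝ) :
    PairVec d₁ d₂ :=
  argmax (P.smoothObj u lam β)

/-- The proximal augmented Lagrangian `L(x; y, λ, β)`. -/
def proxAL {n d₁ d₂ : ℕ} (P : CompositeProblem n d₁ d₂) (y : Vec n) (lam : PairVec d₁ d₂)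
    (β : ℝ) (x : Vec n) : EReal :=
  P.f x + P.g x + P.hSmooth (P.p x) lam β + ((β / 2 * ‖x - y‖ ^ 2 : ℝ) : EReal)

/-- The smooth part `f(x) + h(p(x); λ, β)` of the proximal augmented Lagrangian
(it is finite on the domain of `f`). -/
def smoothPart {n d₁ d₂ : ℕ} (P : CompositeProblem n d₁ d₂) (lam : PairVec d₁ d₂) (β : ℝ)
    (x : Vec n) : ℝ :=
  (P.f x + P.hSmooth (P.p x) lam β).toReal

/-- The remaining part `g(x) + β/2 ‖x - y‖²` of the proximal augmented Lagrangian. -/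
def simplePart {n d₁ d₂ : ℕ} (P : CompositeProblem n d₁ d₂) (y : Vec n) (β : ℝ)
    (x : Vec n) : EReal :=
  P.g x + ((β / 2 * ‖x - y‖ ^ 2 : ℝ) : EReal)

/-- `x` is an `ε`-optimal solution. -/
def IsEpsOptimal {n d₁ d₂ : ℕ} (P : CompositeProblem n d₁ d₂) (ε : ℝ) (x : Vec n) : Prop :=
  x ∈ effDom P.g ∧ |(P.F x).toReal - P.optVal.toReal| ≤ ε ∧ Metric.infDist (P.p₂ x) P.K ≤ ε

/-- The structural assumptions on the data, and strong duality at the pair `(xs, ls)` of a primal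
and a dual solution. -/
structure Standing {n d₁ d₂ : ℕ} (P : CompositeProblem n d₁ d₂) (c : ProblemConstants)
    (xs : Vec n) (ls : PairVec d₁ d₂) : Prop where
  f_ne_bot : ∀ x, P.f x ≠ ⊥
  f_convex : ConvexOn ℝ (effDom P.f) fun x => (P.f x).toReal
  f_diff : ∃ U : Set (Vec n), IsOpen U ∧ effDom P.g ⊆ U ∧ U ⊆ effDom P.f ∧
    DifferentiableOn ℝ (fun x => (P.f x).toReal) U
  g_ne_bot : ∀ x, P.g x ≠ ⊥
  g_proper : (effDom P.g).Nonempty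
  g_closed : LowerSemicontinuous P.g
  μg_nonneg : 0 ≤ c.μg
  g_convex : StrongConvexOn (effDom P.g) c.μg fun x => (P.g x).toReal
  h₁_convex : ConvexOn ℝ Set.univ P.h₁
  Lh₁_nonneg : 0 ≤ c.Lh₁
  h₁_lipschitz : ∀ u v, |P.h₁ u - P.h₁ v| ≤ c.Lh₁ * ‖u - v‖
  K_closed : IsClosed P.K
  K_convex : Convex ℝ P.K
  p₁_diff : Differentiable ℝ P.p₁
  p₂_diff : Differentiable ℝ P.p₂
  h₁_comp : ∀ (x y : Vec n) (u v : Vec d₁) (α : ℝ), 0 < α → α < 1 →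
    P.h₁ (P.p₁ (α • x + (1 - α) • y) - α • u - (1 - α) • v) ≤
      α * P.h₁ (P.p₁ x - u) + (1 - α) * P.h₁ (P.p₁ y - v)
  K_comp : ∀ (x y : Vec n) (u v : Vec d₂) (α : ℝ), 0 < α → α < 1 →
    P.p₂ x - u ∈ P.K → P.p₂ y - v ∈ P.K →
      P.p₂ (α • x + (1 - α) • y) - α • u - (1 - α) • v ∈ P.K
  xs_dom : xs ∈ effDom P.g
  xs_feasible : P.p₂ xs ∈ P.K
  ls_dom : ls ∈ effDom (fenchelConj P.h)
  saddle : P.F xs = P.lagrangian xs ls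
  strong_duality : P.lagrangian xs ls = P.dualFun ls

/-- `D_f(y; x) ≤ L/2 ‖x - y‖²` on the domain of `g`. -/
structure SmoothTerm {n d₁ d₂ : ℕ} (P : CompositeProblem n d₁ d₂) (c : ProblemConstants) :
    Prop where
  L_pos : 0 < c.L
  bregman_le : ∀ x ∈ effDom P.g, ∀ y ∈ effDom P.g,
    (P.f y).toReal - (P.f x).toReal -
      inner ℝ (gradient (fun w => (P.f w).toReal) x) (y - x) ≤ c.L / 2 * ‖x - y‖ ^ 2

/-- Boundedness of `p₂`, and boundedness and Lipschitz continuity of the derivative of `p`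
(in the spectral norm), on the domain of `g`. -/
structure NonlinearBounds {n d₁ d₂ : ℕ} (P : CompositeProblem n d₁ d₂) (c : ProblemConstants) :
    Prop where
  Mp₂_nonneg : 0 ≤ c.Mp₂
  MDp_nonneg : 0 ≤ c.MDp
  LDp_nonneg : 0 ≤ c.LDp
  p₂_le : ∀ x ∈ effDom P.g, ‖P.p₂ x‖ ≤ c.Mp₂
  fderiv_le : ∀ x ∈ effDom P.g, ‖fderiv ℝ P.p x‖ ≤ c.MDp
  fderiv_lipschitz : ∀ x ∈ effDom P.g, ∀ y ∈ effDom P.g,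
    ‖fderiv ℝ P.p x - fderiv ℝ P.p y‖ ≤ c.LDp * ‖x - y‖

/-- `d = max {dist(y, K) : ‖y‖ ≤ M_{p₂} + β ‖λ₂‖}`. -/
def distConst {n d₁ d₂ : ℕ} (P : CompositeProblem n d₁ d₂) (c : ProblemConstants)
    (lam : PairVec d₁ d₂) (β : ℝ) : ℝ :=
  sSup ((fun y => Metric.infDist y P.K) '' {y : Vec d₂ | ‖y‖ ≤ c.Mp₂ + β * ‖lam.snd‖})

/-- The smoothness constant of `f + h(p(·); λ, β)` on the domain of `g`. -/
def innerSmoothness {n d₁ d₂ : ℕ} (P : CompositeProblem n d₁ d₂) (c : ProblemConstants)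
    (lam : PairVec d₁ d₂) (β : ℝ) : ℝ :=
  c.L + c.LDp * (c.Lh₁ + β⁻¹ * P.distConst c lam β) + c.MDp ^ 2 * β⁻¹

/-- The number of iterations after which the inner solver halves the inner optimality gap;
it is also its restart period. -/
def halvingPeriod {n d₁ d₂ : ℕ} (P : CompositeProblem n d₁ d₂) (c : ProblemConstants)
    (lam : PairVec d₁ d₂) (β : ℝ) : ℕ :=
  ⌈2 * √(2 * P.innerSmoothness c lam β / (c.μg + β))⌉₊

/-- The inner solver: `k` iterations of the accelerated proximal gradient method on
`min_x L(x; y, λ, β)`, started from `x₀`. -/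
def innerSolver {n d₁ d₂ : ℕ} (P : CompositeProblem n d₁ d₂) (c : ProblemConstants)
    (θ : ℕ → ℝ) (y : Vec n) (lam : PairVec d₁ d₂) (β : ℝ) (x₀ : Vec n) (k : ℕ) : Vec n :=
  apg (P.smoothPart lam β) (P.simplePart y β) (P.innerSmoothness c lam β) θ
    (P.halvingPeriod c lam β) x₀ k

end CompositeProblem

/-! ### The inexact proximal augmented Lagrangian method -/

/-- Input parameters of the method. -/
structure IPALMParams where
  β₀ : ℝ
  ρ : ℝ
  η : ℝ
  ε₀ : ℝ
  m₀ : ℕ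

namespace IPALMParams

/-- The admissible parameters. -/
structure Valid (a : IPALMParams) : Prop where
  β₀_pos : 0 < a.β₀
  ρ_gt : 1 / 2 < a.ρ
  ρ_lt : a.ρ < 1
  η_pos : 0 < a.η
  η_lt : a.η < a.ρ
  ε₀_pos : 0 < a.ε₀
  m₀_pos : 0 < a.m₀

/-- `β_s = β₀ ρ^s`. -/
def β (a : IPALMParams) (s : ℕ) : ℝ := a.β₀ * a.ρ ^ s

/-- `ε_s = ε₀ η^s`. -/
def ε (a : IPALMParams) (s : ℕ) : ℝ := a.ε₀ * a.η ^ s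

end IPALMParams

/-- The quantity `M_s`, computed from `y = x^{s-1}`, `x = x^s`, `lam = λ^s`, `lam' = λ^{s+1}`,
`β = β_s` and `β' = β_{s+1}`. -/
def errorTerm {n d₁ d₂ : ℕ} (P : CompositeProblem n d₁ d₂) (Lh₁ : ℝ) (y x : Vec n)
    (lam lam' : PairVec d₁ d₂) (β β' : ℝ) : ℝ :=
  β * ‖lam' - lam‖ ^ 2
    + (β - β') / 2 * ‖P.multiplier (P.p x) lam' β' - lam'‖ ^ 2
    + β ^ 2 / (2 * β' - β) * ‖y - x‖ ^ 2
    + ‖lam' - lam‖ * √(((β + β') * Lh₁ + ‖β • lam.fst - β' • lam'.fst‖) ^ 2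
        + ‖β • lam.snd - β' • lam'.snd‖ ^ 2)

/-- `(X, lam, m)` is produced by the method with the accelerated proximal gradient method as
inner solver. The primal iterates are shifted by one: `X 0 = x^{-1}` and `X (s + 1) = x^s`;
`lam s = λ^s`, and `m s` is the number of inner iterations spent at outer iteration `s`. -/
structure IsIPALMRun {n d₁ d₂ : ℕ} (P : CompositeProblem n d₁ d₂) (c : ProblemConstants)
    (θ : ℕ → ℝ) (a : IPALMParams) (X : ℕ → Vec n) (lam : ℕ → PairVec d₁ d₂) (m : ℕ → ℕ) :
    Prop where
  x_init : X 0 ∈ effDom P.g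
  lam_init : lam 0 ∈ effDom (fenchelConj P.h)
  m_init : m 0 = a.m₀
  /-- `ε₀ ≥ H₀(x⁰) - H₀*` -/
  ε_init : P.proxAL (X 0) (lam 0) (a.β 0) (X 1) ≤
    (⨅ x : Vec n, P.proxAL (X 0) (lam 0) (a.β 0) x) + (a.ε₀ : EReal)
  x_step : ∀ s, X (s + 1) = P.innerSolver c θ (X s) (lam s) (a.β s) (X s) (m s)
  lam_step : ∀ s, lam (s + 1) = P.multiplier (P.p (X (s + 1))) (lam s) (a.β s)
  m_step : ∀ s, IsLeast {k : ℕ | 0 < k ∧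
    2 * a.ε s + errorTerm P c.Lh₁ (X s) (X (s + 1)) (lam s) (lam (s + 1)) (a.β s) (a.β (s + 1)) ≤
      2 ^ (k / P.halvingPeriod c (lam (s + 1)) (a.β (s + 1))) * (a.ε (s + 1) / 2)} (m (s + 1))

/-! ### The constants of the complexity bound -/

/-- The constant `c₀`. -/
def boundC₀ {n d₁ d₂ : ℕ} (a : IPALMParams) (x₀ xs : Vec n) (lam₀ ls : PairVec d₁ d₂) : ℝ :=
  2 * (√(‖x₀ - xs‖ ^ 2 + ‖lam₀ - ls‖ ^ 2) + 2 * √(a.ε₀ / a.β₀) / (1 - √(a.η / a.ρ))) ^ 2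
    + 2 * ‖ls‖ ^ 2 + 2 * ‖xs‖ ^ 2

/-- The constant `c₁`. -/
def boundC₁ {d₁ d₂ : ℕ} (a : IPALMParams) (Lh₁ c₀ : ℝ) (ls : PairVec d₁ d₂) : ℝ :=
  max (a.ε₀ + 2 * Lh₁ ^ 2 * a.β₀ + c₀ * a.β₀)
    (max (a.β₀ * ‖ls.snd‖ * √c₀) (a.β₀ * √c₀))

/-- The constant `c₂`. -/
def boundC₂ (a : IPALMParams) (Lh₁ c₀ : ℝ) : ℝ :=
  Real.logb 2 (4 / a.η
    + 2 * a.β₀ * ((11 + 2 / a.ρ ^ 2) * (Lh₁ ^ 2 + 4 * c₀) + 4 * c₀ / (2 * a.ρ - 1))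
      / (a.ε₀ * a.η)) + 1

/-- `L β₀ + L_{∇p} (L_{h₁} β₀ + d) + M_{∇p}²`. -/
def complexityFactor (c : ProblemConstants) (β₀ d : ℝ) : ℝ :=
  c.L * β₀ + c.LDp * (c.Lh₁ * β₀ + d) + c.MDp ^ 2

end

/-! Each outer iteration is an inexact proximal step in the pair `(x, λ)`. Let `z` minimize `H_s`
and `v = Λ(p(z); λ^s, β_s)`. Then `(z, v)` is a saddle point of the Lagrangian with proximal terms
of weight `β_s` in both variables (`alReal_saddle`). The function `⟨λ, p(·)⟩` need not be convex for
every `λ`, but it is for subgradients of `h` (`IsSubgrad.inner_p_le`), and `v` is one. Hence `H_s`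
grows quadratically in `x` and in the multiplier (`alReal_growth`), and the exact step does not move
away from `(x*, λ*)` (`alReal_fejer`). An `ε_s`-minimizer is within `O(√(ε_s / β_s))` of the exact
step. These errors are summable because `η < ρ`, so the iterates stay bounded in terms of `c₀`
(`norm_sub_add_tail_le`, `bounds`).

With bounded multipliers the smoothing error is `O(β_s)`, and `p(x^s) - β_s (λ^{s+1} - λ^s)` has its
second component in `K`. So suboptimality and infeasibility are at most `c₁ ρ^s` (`isEpsOptimal`),
and about `log(c₁ / (ρ ε)) / log(1 / ρ)` outer iterations suffice.

The inner objective is `(μ_g + β_s)`-strongly convex with an `L_s`-smooth part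
(`isComposite_inner`), so every restart period halves the gap (`apg_gap`). The growth estimates
bound the gap of `x^s` in the next inner problem by `2 ε_s + M_s` (`alReal_warm_start`); thus the
stopping rule guarantees accuracy `ε_{s+1}` (`gap_le`). As `M_s = O(β_s)`, minimality of `m_{s+1}`
gives at most `c₂ + s log₂(ρ/η)` periods (`m_succ_le`).

A period has length of order `√S / β_t` if `μ_g = 0` and `√(S / (μ_g β_t))` if `μ_g > 0`, plus one
for rounding. The geometric sum is comparable to its last term, of order `1/ε` or `1/√ε`. The
roundings contribute a squared logarithm, which is absorbed by `log x ≤ 2 √x` when `μ_g > 0` or `ε`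
is small. -/

noncomputable section

open Set Filter Topology

/-! ### Strongly convex functions -/

section StrongConvexity

variable {E : Type*} [NormedAddCommGroup E] [InnerProductSpace ℝ E]

/-- The convexity inequality of a strongly convex function along a segment. -/
theorem StrongConvexOn.segment_le {D : Set E} {m : ℝ} {ψ : E → ℝ} (h : StrongConvexOn D m ψ)
    {x y : E} (hx : x ∈ D) (hy : y ∈ D) {t : ℝ} (ht0 : 0 ≤ t) (ht1 : t ≤ 1) :
    ψ ((1 - t) • x + t • y) ≤
      (1 - t) * ψ x + t * ψ y - (1 - t) * t * (m / 2 * ‖x - y‖ ^ 2) := by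
  have := h.2 hx hy (sub_nonneg.2 ht1) ht0 (by ring)
  simpa only [smul_eq_mul] using this

/-- Divide by `t` and let `t → 0⁺`. This replaces first-order optimality conditions: comparing a
minimizer with points of a segment leaves an error of order `t ^ 2`, so no subdifferential of `g` is
needed. -/
theorem nonneg_of_forall_linear_add_quadratic {A B : ℝ}
    (h : ∀ t : ℝ, 0 < t → t < 1 → 0 ≤ t * A + t ^ 2 * B) : 0 ≤ A := by
  have h1 : ∀ t : ℝ, t ∈ Ioo (0 : ℝ) 1 → 0 ≤ A + t * B := by
    intro t ht
    have := h t ht.1 ht.2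
    have h2 : 0 ≤ t * (A + t * B) := by linarith [this, show t * (A + t * B) = t * A + t ^ 2 * B by ring]
    exact nonneg_of_mul_nonneg_right h2 ht.1
  have hlim : Tendsto (fun t : ℝ => A + t * B) (𝓝[>] 0) (𝓝 A) := by
    have : ContinuousAt (fun t : ℝ => A + t * B) 0 := by fun_prop
    have := this.tendsto
    simp only [zero_mul, add_zero] at this
    exact this.mono_left nhdsWithin_le_nhds
  refine ge_of_tendsto hlim ?_
  filter_upwards [Ioo_mem_nhdsGT (zero_lt_one (α := ℝ))] with t ht using h1 t ht

/-- Quadratic growth at a minimizer. -/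
theorem StrongConvexOn.growth {D : Set E} {m : ℝ} {ψ : E → ℝ} (h : StrongConvexOn D m ψ)
    {z x : E} (hz : z ∈ D) (hmin : ∀ y ∈ D, ψ z ≤ ψ y) (hx : x ∈ D) :
    ψ z + m / 2 * ‖x - z‖ ^ 2 ≤ ψ x := by
  have : 0 ≤ ψ x - ψ z - m / 2 * ‖x - z‖ ^ 2 := by
    apply nonneg_of_forall_linear_add_quadratic (B := m / 2 * ‖x - z‖ ^ 2)
    intro t ht0 ht1
    have h1 := h.segment_le hz hx ht0.le ht1.le
    have h2 := hmin _ (h.1 hz hx (sub_nonneg.2 ht1.le) ht0.le (by ring))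
    rw [norm_sub_rev z x] at h1
    nlinarith
  linarith

theorem norm_sq_segment (x y c : E) (t : ℝ) :
    ‖(1 - t) • x + t • y - c‖ ^ 2 =
      (1 - t) * ‖x - c‖ ^ 2 + t * ‖y - c‖ ^ 2 - (1 - t) * t * ‖x - y‖ ^ 2 := by
  have h1 : (1 - t) • x + t • y - c = (1 - t) • (x - c) + t • (y - c) := by module
  have h2 : x - y = (x - c) - (y - c) := by abel
  rw [h1, h2, norm_add_sq_real, norm_sub_sq_real (x - c), norm_smul, norm_smul, inner_smul_left,
    inner_smul_right, mul_pow, mul_pow, Real.norm_eq_abs, Real.norm_eq_abs, sq_abs, sq_abs]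
  simp only [conj_trivial]
  ring

/-- Adding a linear term and a multiple of the squared distance to a point. -/
theorem StrongConvexOn.add_inner_add_sq {D : Set E} {m : ℝ} {ψ : E → ℝ}
    (h : StrongConvexOn D m ψ) (v c : E) (b : ℝ) :
    StrongConvexOn D (m + b) fun x => ψ x + (inner ℝ v x + b / 2 * ‖x - c‖ ^ 2) := by
  refine ⟨h.1, fun x hx y hy s t hs ht hst => ?_⟩
  obtain rfl : s = 1 - t := by linarith
  have h1 := h.segment_le hx hy ht (by linarith)
  have h2 := norm_sq_segment x y c t
  simp only [smul_eq_mul, inner_add_right, inner_smul_right]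
  rw [h2]
  nlinarith

theorem StrongConvexOn.add_sq {D : Set E} {m : ℝ} {ψ : E → ℝ}
    (h : StrongConvexOn D m ψ) (c : E) (b : ℝ) :
    StrongConvexOn D (m + b) fun x => ψ x + b / 2 * ‖x - c‖ ^ 2 := by
  simpa using h.add_inner_add_sq 0 c b

theorem StrongConvexOn.add_convexOn {D : Set E} {m : ℝ} {ψ φ : E → ℝ}
    (h : StrongConvexOn D m ψ) (hφ : ConvexOn ℝ D φ) :
    StrongConvexOn D m fun x => ψ x + φ x := by
  refine ⟨h.1, fun x hx y hy s t hs ht hst => ?_⟩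
  have h1 := h.2 hx hy hs ht hst
  have h2 := hφ.2 hx hy hs ht hst
  simp only [smul_eq_mul] at *
  linarith

/-- A minimizer of a strongly convex lower semicontinuous function exists. -/
theorem exists_minimizer_of_strongConvexOn [ProperSpace E] {ψ : E → EReal}
    (hbot : ∀ x, ψ x ≠ ⊥) (hlsc : LowerSemicontinuous ψ) (hne : (effDom ψ).Nonempty)
    {m : ℝ} (hm : 0 < m) (hc : StrongConvexOn (effDom ψ) m fun x => (ψ x).toReal) :
    ∃ x ∈ effDom ψ, ∀ y, ψ x ≤ ψ y := by
  obtain ⟨x₀, hx₀⟩ := hne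
  have hcoe : ∀ x ∈ effDom ψ, ((ψ x).toReal : EReal) = ψ x := fun x hx =>
    EReal.coe_toReal hx (hbot x)
  obtain ⟨x₁, hx₁, hmin₁⟩ := LowerSemicontinuousOn.exists_isMinOn
    ⟨x₀, Metric.mem_closedBall_self zero_le_one⟩ (isCompact_closedBall x₀ 1)
    (hlsc.lowerSemicontinuousOn _)
  have hle₁ : ∀ y ∈ Metric.closedBall x₀ (1 : ℝ), ψ x₁ ≤ ψ y := fun y hy => hmin₁ hy
  have hx₁D : x₁ ∈ effDom ψ := by
    have := hle₁ x₀ (Metric.mem_closedBall_self zero_le_one)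
    exact ne_top_of_le_ne_top hx₀ this
  set a := (ψ x₀).toReal with ha
  set b := (ψ x₁).toReal with hb
  -- Beyond this radius, strong convexity along the segment from `x₀`, with the lower bound `b` on
  -- the unit ball, forces values at least `ψ x₀`. The minimum over the ball is therefore global.
  obtain ⟨x₂, hx₂, hmin₂⟩ := LowerSemicontinuousOn.exists_isMinOn
    ⟨x₀, Metric.mem_closedBall_self (by positivity : 0 ≤ 1 + 2 * (|a - b| / m))⟩
    (isCompact_closedBall x₀ (1 + 2 * (|a - b| / m)))
    (hlsc.lowerSemicontinuousOn _)
  have hle₂ : ∀ y ∈ Metric.closedBall x₀ (1 + 2 * (|a - b| / m)), ψ x₂ ≤ ψ y :=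
    fun y hy => hmin₂ hy
  have h20 := hle₂ x₀ (Metric.mem_closedBall_self (by positivity))
  have hx₂D : x₂ ∈ effDom ψ := ne_top_of_le_ne_top hx₀ h20
  refine ⟨x₂, hx₂D, fun y => ?_⟩
  by_cases hy : y ∈ Metric.closedBall x₀ (1 + 2 * (|a - b| / m))
  · exact hle₂ y hy
  by_cases hyD : y ∈ effDom ψ
  swap
  · have : ψ y = ⊤ := not_not.1 hyD
    rw [this]; exact le_top
  refine h20.trans ?_
  rw [← hcoe x₀ hx₀, ← hcoe y hyD, EReal.coe_le_coe_iff, ← ha]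
  rw [Metric.mem_closedBall, dist_eq_norm, not_le] at hy
  set R := ‖y - x₀‖ with hR
  have hab : 0 ≤ |a - b| / m := by positivity
  have hR1 : 1 < R := by linarith
  have hR0 : 0 < R := by linarith
  have ht1 : R⁻¹ ≤ 1 := inv_le_one_of_one_le₀ hR1.le
  have hseg := hc.segment_le hx₀ hyD (inv_nonneg.2 hR0.le) ht1
  have hmem := hc.1 hx₀ hyD (sub_nonneg.2 ht1) (inv_nonneg.2 hR0.le) (by ring)
  have hball : (1 - R⁻¹) • x₀ + R⁻¹ • y ∈ Metric.closedBall x₀ (1 : ℝ) := by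
    rw [Metric.mem_closedBall, dist_eq_norm,
      show (1 - R⁻¹) • x₀ + R⁻¹ • y - x₀ = R⁻¹ • (y - x₀) by module, norm_smul, ← hR,
      Real.norm_of_nonneg (inv_nonneg.2 hR0.le), inv_mul_cancel₀ hR0.ne']
  have hb1 := hle₁ _ hball
  rw [← hcoe x₁ hx₁D, ← hcoe _ hmem, EReal.coe_le_coe_iff, ← hb] at hb1
  rw [norm_sub_rev, ← hR, ← ha] at hseg
  have h1 : b * R ≤ (R - 1) * a + (ψ y).toReal - (R - 1) * (m / 2 * R) := by
    have := mul_le_mul_of_nonneg_left (hb1.trans hseg) hR0.le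
    have e : R * ((1 - R⁻¹) * a + R⁻¹ * (ψ y).toReal - (1 - R⁻¹) * R⁻¹ * (m / 2 * R ^ 2))
        = (R - 1) * a + (ψ y).toReal - (R - 1) * (m / 2 * R) := by
      field_simp
    rw [e] at this; linarith
  have h2 : 2 * |a - b| < m * (R - 1) := by
    have h3 : 2 * (|a - b| / m) < R - 1 := by linarith
    have := mul_lt_mul_of_pos_left h3 hm
    calc 2 * |a - b| = m * (2 * (|a - b| / m)) := by field_simp
      _ < _ := this
  have h3 : a - b ≤ |a - b| := le_abs_self _
  nlinarith

theorem LowerSemicontinuous.add_coe_continuous {E : Type*} [TopologicalSpace E] {P : E → EReal} (hP : LowerSemicontinuous P)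
    {q : E → ℝ} (hq : Continuous q) :
    LowerSemicontinuous fun x => P x + (q x : EReal) := fun x =>
  LowerSemicontinuousAt.add' (hP x) (continuous_coe_real_ereal.comp hq).continuousAt.lowerSemicontinuousAt
    (EReal.continuousAt_add (Or.inr (EReal.coe_ne_bot _)) (Or.inr (EReal.coe_ne_top _)))

/-- Lower semicontinuity of a sum whose finite-valued term is controlled only on the domain of
the other one. -/
theorem LowerSemicontinuous.add_coe_of_minorant {E : Type*} [TopologicalSpace E] {P : E → EReal} (hP : LowerSemicontinuous P)
    {φ q : E → ℝ} (hφ : ∀ x ∈ effDom P, ContinuousAt φ x) (hq : Continuous q)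
    (hle : ∀ x ∈ effDom P, q x ≤ φ x) :
    LowerSemicontinuous fun x => P x + (φ x : EReal) := by
  intro x
  by_cases hx : x ∈ effDom P
  · exact LowerSemicontinuousAt.add' (hP x)
      (continuous_coe_real_ereal.continuousAt.comp (hφ x hx)).lowerSemicontinuousAt
      (EReal.continuousAt_add (Or.inr (EReal.coe_ne_bot _)) (Or.inr (EReal.coe_ne_top _)))
  -- Off the domain `φ` need not be continuous, but `P + q` is lower semicontinuous, equals `⊤` at
  -- `x` and lies below `P + φ`.
  · have hx' : P x = ⊤ := not_not.1 hx
    intro a ha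
    have h1 : a < P x + (q x : EReal) := by
      simpa [hx'] using ha
    filter_upwards [(hP.add_coe_continuous hq) x a h1] with y hy
    refine lt_of_lt_of_le hy ?_
    by_cases hyD : y ∈ effDom P
    · gcongr
      exact_mod_cast hle y hyD
    · have : P y = ⊤ := not_not.1 hyD
      simp [this]

/-- First-order characterization of convexity, one direction. -/
theorem ConvexOn.add_fderiv_le {D : Set E} {φ : E → ℝ} (h : ConvexOn ℝ D φ) {x y : E}
    (hy : y ∈ D) (hx : x ∈ D) {φ' : E →L[ℝ] ℝ} (hd : HasFDerivAt φ φ' y) :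
    φ y + φ' (x - y) ≤ φ x := by
  have h1 : HasDerivAt (fun t : ℝ => φ (y + t • (x - y))) (φ' (x - y)) 0 :=
    hd.hasLineDerivAt (x - y)
  have h2 := h1.tendsto_slope_zero_right
  simp only [zero_add, zero_smul, add_zero, smul_eq_mul] at h2
  have h3 : φ' (x - y) ≤ φ x - φ y := by
    refine le_of_tendsto h2 ?_
    filter_upwards [Ioc_mem_nhdsGT (zero_lt_one (α := ℝ))] with t ht
    have h4 := h.2 hy hx (sub_nonneg.2 ht.2) ht.1.le (by ring)
    rw [show (1 - t) • y + t • x = y + t • (x - y) by module] at h4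
    simp only [smul_eq_mul] at h4
    rw [inv_mul_le_iff₀ ht.1]
    linarith
  linarith

/-- Second-order Taylor bound for a map with Lipschitz derivative on a convex set. -/
theorem norm_image_sub_sub_fderiv_le {F : Type*} [NormedAddCommGroup F] [NormedSpace ℝ F]
    {D : Set E} (hD : Convex ℝ D) {p : E → F} (hp : Differentiable ℝ p) {Lip : ℝ}
    (hLip : ∀ x ∈ D, ∀ y ∈ D, ‖fderiv ℝ p x - fderiv ℝ p y‖ ≤ Lip * ‖x - y‖)
    {x y : E} (hx : x ∈ D) (hy : y ∈ D) :
    ‖p y - p x - fderiv ℝ p x (y - x)‖ ≤ Lip / 2 * ‖y - x‖ ^ 2 := by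
  set d := y - x with hd
  have hpath : ∀ t : ℝ, HasDerivAt (fun t : ℝ => p (x + t • d) - p x - t • fderiv ℝ p x d)
      (fderiv ℝ p (x + t • d) d - fderiv ℝ p x d) t := by
    intro t
    have h1 : HasDerivAt (fun t : ℝ => x + t • d) d t := by
      simpa using ((hasDerivAt_id t).smul_const d).const_add x
    have h2 := ((hp (x + t • d)).hasFDerivAt.comp_hasDerivAt t h1).sub_const (p x)
    have h3 : HasDerivAt (fun t : ℝ => t • fderiv ℝ p x d) (fderiv ℝ p x d) t := by
      simpa using (hasDerivAt_id t).smul_const (fderiv ℝ p x d)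
    exact h2.sub h3
  have key := image_norm_le_of_norm_deriv_right_le_deriv_boundary (a := 0) (b := 1)
    (f := fun t : ℝ => p (x + t • d) - p x - t • fderiv ℝ p x d)
    (f' := fun t => fderiv ℝ p (x + t • d) d - fderiv ℝ p x d)
    (fun t _ => (hpath t).continuousAt.continuousWithinAt)
    (fun t _ => (hpath t).hasDerivWithinAt)
    (B := fun t => Lip / 2 * ‖d‖ ^ 2 * t ^ 2) (B' := fun t => Lip * ‖d‖ ^ 2 * t)
    (by simp)
    (fun t => by
      refine ((hasDerivAt_pow 2 t).const_mul (Lip / 2 * ‖d‖ ^ 2)).congr_deriv ?_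
      norm_num
      ring)
    (fun t ht => by
      have hmem : x + t • d ∈ D := by
        have := hD hx hy (sub_nonneg.2 ht.2.le) ht.1 (by ring)
        rwa [show (1 - t) • x + t • y = x + t • d by rw [hd]; module] at this
      have h1 := (fderiv ℝ p (x + t • d) - fderiv ℝ p x).le_opNorm d
      have h2 := hLip _ hmem x hx
      rw [add_sub_cancel_left, norm_smul, Real.norm_of_nonneg ht.1] at h2
      calc ‖fderiv ℝ p (x + t • d) d - fderiv ℝ p x d‖
          ≤ ‖fderiv ℝ p (x + t • d) - fderiv ℝ p x‖ * ‖d‖ := h1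
        _ ≤ Lip * (t * ‖d‖) * ‖d‖ := by gcongr
        _ = _ := by ring)
    (right_mem_Icc.2 zero_le_one)
  simpa [hd] using key

end StrongConvexity

theorem argmin_le {X : Type*} [Nonempty X] {G : X → EReal} (h : ∃ x, ∀ y, G x ≤ G y) (y : X) :
    G (argmin G) ≤ G y :=
  Classical.epsilon_spec h y

theorem le_argmax {X : Type*} [Nonempty X] {G : X → EReal} (h : ∃ x, ∀ y, G y ≤ G x) (y : X) :
    G y ≤ G (argmax G) :=
  Classical.epsilon_spec h y

/-! ### Convergence of the restarted accelerated proximal gradient method -/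

/-- The composite objective `φ + P` is convex with `L`-smooth `φ` on the domain of the proper
closed convex function `P`, which has strong convexity parameter `m`. -/
structure IsComposite {n : ℕ} (φ : Vec n → ℝ) (P : Vec n → EReal) (L m : ℝ) : Prop where
  ne_bot : ∀ x, P x ≠ ⊥
  proper : (effDom P).Nonempty
  closed : LowerSemicontinuous P
  m_nonneg : 0 ≤ m
  convex : StrongConvexOn (effDom P) m fun x => (P x).toReal
  L_pos : 0 < L
  minorant : ∀ x ∈ effDom P, ∀ y ∈ effDom P, φ x + inner ℝ (gradient φ x) (y - x) ≤ φ y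
  majorant : ∀ x ∈ effDom P, ∀ y ∈ effDom P,
    φ y ≤ φ x + inner ℝ (gradient φ x) (y - x) + L / 2 * ‖y - x‖ ^ 2

theorem EReal.add_coe_ne_top_iff {a : EReal} {r : ℝ} : a + (r : EReal) ≠ ⊤ ↔ a ≠ ⊤ := by
  induction a <;> simp [← EReal.coe_add]

theorem effDom_add_coe {X : Type*} (P : X → EReal) (q : X → ℝ) :
    effDom (fun x => P x + (q x : EReal)) = effDom P := by
  ext x; exact EReal.add_coe_ne_top_iff

theorem EReal.toReal_add_coe' {a : EReal} (h1 : a ≠ ⊤) (h2 : a ≠ ⊥) (r : ℝ) :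
    (a + (r : EReal)).toReal = a.toReal + r := by
  rw [EReal.toReal_add h1 h2 (EReal.coe_ne_top _) (EReal.coe_ne_bot _), EReal.toReal_coe]

namespace IsComposite

variable {n : ℕ} {φ : Vec n → ℝ} {P : Vec n → EReal} {L m : ℝ}

/-- The proximal gradient subproblem is solved exactly. -/
theorem argmin_spec (h : IsComposite φ P L m) (v c : Vec n) {b : ℝ} (hb : 0 < b) :
    let z := argmin fun u : Vec n => P u + ((inner ℝ v u + b / 2 * ‖u - c‖ ^ 2 : ℝ) : EReal)
    z ∈ effDom P ∧ ∀ x ∈ effDom P,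
      (P z).toReal + (inner ℝ v z + b / 2 * ‖z - c‖ ^ 2) + b / 2 * ‖x - z‖ ^ 2 ≤
        (P x).toReal + (inner ℝ v x + b / 2 * ‖x - c‖ ^ 2) := by
  intro z
  set ψ : Vec n → EReal :=
    fun u => P u + ((inner ℝ v u + b / 2 * ‖u - c‖ ^ 2 : ℝ) : EReal) with hψ
  have hdom : effDom ψ = effDom P := effDom_add_coe P _
  have hbot : ∀ x, ψ x ≠ ⊥ := fun x => by
    simp only [hψ, ne_eq, EReal.add_eq_bot_iff, h.ne_bot x, EReal.coe_ne_bot, or_self,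
      not_false_eq_true]
  have hreal : ∀ x ∈ effDom P, (ψ x).toReal =
      (P x).toReal + (inner ℝ v x + b / 2 * ‖x - c‖ ^ 2) := fun x hx =>
    EReal.toReal_add_coe' hx (h.ne_bot x) _
  have hsc0 := h.convex.add_inner_add_sq v c b
  have hsc : StrongConvexOn (effDom ψ) (m + b) fun x => (ψ x).toReal := by
    rw [hdom]
    refine ⟨hsc0.1, fun x hx y hy s t hs ht hst => ?_⟩
    simp only
    rw [hreal x hx, hreal y hy, hreal _ (hsc0.1 hx hy hs ht hst)]
    exact hsc0.2 hx hy hs ht hst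
  have hex := exists_minimizer_of_strongConvexOn hbot
    (h.closed.add_coe_continuous (q := fun u => inner ℝ v u + b / 2 * ‖u - c‖ ^ 2) (by fun_prop))
    (hdom ▸ h.proper) (by linarith [h.m_nonneg]) hsc
  have hz : ∀ y, ψ z ≤ ψ y := argmin_le (hex.imp fun _ hx => hx.2)
  obtain ⟨x₀, hx₀⟩ := h.proper
  have hzD : z ∈ effDom P := by
    rw [← hdom] at hx₀ ⊢
    exact ne_top_of_le_ne_top hx₀ (hz x₀)
  refine ⟨hzD, fun x hx => ?_⟩
  have hmin : ∀ y ∈ effDom P, (P z).toReal + (inner ℝ v z + b / 2 * ‖z - c‖ ^ 2) ≤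
      (P y).toReal + (inner ℝ v y + b / 2 * ‖y - c‖ ^ 2) := fun y hy => by
    rw [← hreal z hzD, ← hreal y hy]
    exact EReal.toReal_le_toReal (hz y) (hbot z) (by rw [← hdom] at hy; exact hy)
  have h1 := hsc0.growth hzD hmin hx
  have h2 : b / 2 * ‖x - z‖ ^ 2 ≤ (m + b) / 2 * ‖x - z‖ ^ 2 := by
    gcongr
    linarith [h.m_nonneg]
  linarith

/-- One accelerated proximal gradient step. -/
theorem apgStep_spec (h : IsComposite φ P L m) {θ : ℝ} (hθ0 : 0 < θ) (hθ1 : θ ≤ 1)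
    {a : Vec n × Vec n} (ha1 : a.1 ∈ effDom P) (ha2 : a.2 ∈ effDom P) :
    (apgStep φ P L θ a).1 ∈ effDom P ∧ (apgStep φ P L θ a).2 ∈ effDom P ∧
      ∀ x ∈ effDom P,
        φ (apgStep φ P L θ a).1 + (P (apgStep φ P L θ a).1).toReal - (φ x + (P x).toReal) ≤
          (1 - θ) * (φ a.1 + (P a.1).toReal - (φ x + (P x).toReal)) +
            θ ^ 2 * (L / 2) * (‖x - a.2‖ ^ 2 - ‖x - (apgStep φ P L θ a).2‖ ^ 2) := by
  obtain ⟨x₀, z₀⟩ := a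
  simp only at ha1 ha2
  set y := (1 - θ) • x₀ + θ • z₀ with hy
  set z := argmin fun u : Vec n =>
    P u + ((inner ℝ (gradient φ y) u + θ * L / 2 * ‖u - z₀‖ ^ 2 : ℝ) : EReal) with hz
  have hstep : apgStep φ P L θ (x₀, z₀) = ((1 - θ) • x₀ + θ • z, z) := rfl
  rw [hstep]
  obtain ⟨hzD, hzmin⟩ := h.argmin_spec (gradient φ y) z₀ (mul_pos hθ0 h.L_pos)
  rw [← hz] at hzD hzmin
  have hD := h.convex.1
  have hyD : y ∈ effDom P := hD ha1 ha2 (sub_nonneg.2 hθ1) hθ0.le (by ring)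
  have hxD : (1 - θ) • x₀ + θ • z ∈ effDom P := hD ha1 hzD (sub_nonneg.2 hθ1) hθ0.le (by ring)
  refine ⟨hxD, hzD, fun x hx => ?_⟩
  simp only
  set v := gradient φ y with hv
  have e1 := h.majorant y hyD _ hxD
  have e2 := h.convex.segment_le ha1 hzD hθ0.le hθ1
  have e3 := h.minorant y hyD _ ha1
  have e4 := h.minorant y hyD _ hx
  have e5 := hzmin x hx
  -- The majorant's quadratic term thus becomes `L / 2 * θ ^ 2 * ‖z - z₀‖ ^ 2`, which `θ` times the
  -- proximal term of the subproblem cancels exactly.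
  have hn : (1 - θ) • x₀ + θ • z - y = θ • (z - z₀) := by rw [hy]; module
  have hi : inner ℝ v ((1 - θ) • x₀ + θ • z - y) =
      (1 - θ) * inner ℝ v (x₀ - y) + θ * (inner ℝ v z - inner ℝ v y) := by
    rw [← inner_sub_right, ← inner_smul_right, ← inner_smul_right, ← inner_add_right]
    congr 1
    module
  rw [← hv] at e1
  rw [hi, hn, norm_smul, mul_pow, Real.norm_eq_abs, sq_abs] at e1
  rw [inner_sub_right] at e4
  have e6 : 0 ≤ (1 - θ) * θ * (m / 2 * ‖x₀ - z‖ ^ 2) := by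
    have := h.m_nonneg
    have := sub_nonneg.2 hθ1
    positivity
  have e7 := mul_le_mul_of_nonneg_left e3 (sub_nonneg.2 hθ1)
  have e8 := mul_le_mul_of_nonneg_left e4 hθ0.le
  have e9 := mul_le_mul_of_nonneg_left e5 hθ0.le
  rw [← hv] at e7 e8
  linear_combination e1 + e2 + e6 + e7 + e8 + e9

variable {θ : ℕ → ℝ}

theorem apgWeights_le_one (hθ : IsAPGWeights θ) (k : ℕ) : θ k ≤ 1 :=
  (hθ.le k).trans (by rw [div_le_one (by positivity)]; linarith [(Nat.cast_nonneg k : (0 : ℝ) ≤ k)])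

theorem apgState_mem (h : IsComposite φ P L m) (hθ : IsAPGWeights θ) (K : ℕ) {x₀ : Vec n}
    (hx₀ : x₀ ∈ effDom P) (k : ℕ) :
    (apgState φ P L θ K x₀ k).1 ∈ effDom P ∧ (apgState φ P L θ K x₀ k).2 ∈ effDom P := by
  induction k with
  | zero => exact ⟨hx₀, hx₀⟩
  | succ k ih =>
    rw [apgState]
    have := h.apgStep_spec (hθ.pos (k % K)) (apgWeights_le_one hθ _)
      (a := if k % K = 0 then ((apgState φ P L θ K x₀ k).1, (apgState φ P L θ K x₀ k).1)
        else apgState φ P L θ K x₀ k) (by split_ifs <;> exact ih.1)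
        (by split_ifs; exacts [ih.1, ih.2])
    exact ⟨this.1, this.2.1⟩

theorem apg_mem (h : IsComposite φ P L m) (hθ : IsAPGWeights θ) (K : ℕ) {x₀ : Vec n}
    (hx₀ : x₀ ∈ effDom P) (k : ℕ) : apg φ P L θ K x₀ k ∈ effDom P :=
  (h.apgState_mem hθ K hx₀ k).1

/-- The accelerated rate within one period between restarts. -/
theorem apgState_rate (h : IsComposite φ P L m) (hθ : IsAPGWeights θ) {K : ℕ} {x₀ : Vec n}
    (hx₀ : x₀ ∈ effDom P) {x : Vec n} (hx : x ∈ effDom P)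
    (hmin : ∀ y ∈ effDom P, φ x + (P x).toReal ≤ φ y + (P y).toReal) (j : ℕ) {i : ℕ}
    (hi : i < K) :
    let s := apgState φ P L θ K x₀ (j * K + i + 1)
    (φ s.1 + (P s.1).toReal - (φ x + (P x).toReal)) / θ i ^ 2 + L / 2 * ‖x - s.2‖ ^ 2 ≤
      L / 2 * ‖x - (apgState φ P L θ K x₀ (j * K)).1‖ ^ 2 := by
  induction i with
  | zero =>
    have hmem := h.apgState_mem hθ K hx₀ (j * K)
    have := (h.apgStep_spec (hθ.pos 0) (apgWeights_le_one hθ _)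
      (a := ((apgState φ P L θ K x₀ (j * K)).1, (apgState φ P L θ K x₀ (j * K)).1))
      hmem.1 hmem.1).2.2 x hx
    -- At a restart the auxiliary iterate is reset to the main one, and `θ 0 = 1` removes the
    -- previous gap, so the period starts from the distance alone.
    have hs : apgState φ P L θ K x₀ (j * K + 0 + 1) = apgStep φ P L (θ 0)
        ((apgState φ P L θ K x₀ (j * K)).1, (apgState φ P L θ K x₀ (j * K)).1) := by
      rw [apgState]; simp
    simp only [hs]
    rw [hθ.zero] at this ⊢
    linarith
  | succ i ih =>
    have ih := ih (by omega)
    have hmem := h.apgState_mem hθ K hx₀ (j * K + i + 1)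
    have hs : apgState φ P L θ K x₀ (j * K + (i + 1) + 1) = apgStep φ P L (θ (i + 1))
        (apgState φ P L θ K x₀ (j * K + i + 1)) := by
      rw [← add_assoc, apgState]
      have : (j * K + i + 1) % K = i + 1 := by
        rw [add_assoc, mul_comm, Nat.mul_add_mod, Nat.mod_eq_of_lt hi]
      rw [this]; simp
    simp only [hs]
    have := (h.apgStep_spec (hθ.pos (i + 1)) (apgWeights_le_one hθ _) hmem.1 hmem.2).2.2 x hx
    simp only at ih
    set s := apgState φ P L θ K x₀ (j * K + i + 1)
    set s' := apgStep φ P L (θ (i + 1)) s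
    have hgap := sub_nonneg.2 (hmin s.1 hmem.1)
    set Δ := φ s.1 + (P s.1).toReal - (φ x + (P x).toReal)
    have hθ2 : 0 < θ (i + 1) ^ 2 := pow_pos (hθ.pos _) 2
    have h1 := div_le_div_of_nonneg_right this hθ2.le
    have h2 : ((1 - θ (i + 1)) * Δ + θ (i + 1) ^ 2 * (L / 2) * (‖x - s.2‖ ^ 2 - ‖x - s'.2‖ ^ 2))
        / θ (i + 1) ^ 2 = (1 - θ (i + 1)) / θ (i + 1) ^ 2 * Δ
          + L / 2 * (‖x - s.2‖ ^ 2 - ‖x - s'.2‖ ^ 2) := by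
      have hne := (hθ.pos (i + 1)).ne'
      field_simp
    -- The weight condition makes gap over `θ ^ 2` plus `L / 2` times squared distance
    -- nonincreasing; the sign of the gap matters here.
    have h3 := mul_le_mul_of_nonneg_right (hθ.step i) hgap
    have h4 : 1 / θ i ^ 2 * Δ = Δ / θ i ^ 2 := by ring
    linarith

/-- Each full period between restarts halves the optimality gap. -/
theorem apg_gap (h : IsComposite φ P L m) (hθ : IsAPGWeights θ) {K : ℕ} (hm : 0 < m)
    (hK : 2 * √(2 * L / m) ≤ K) {x₀ : Vec n}
    (hx₀ : x₀ ∈ effDom P) {x : Vec n} (hx : x ∈ effDom P)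
    (hmin : ∀ y ∈ effDom P, φ x + (P x).toReal ≤ φ y + (P y).toReal)
    (hgrow : ∀ y ∈ effDom P, φ x + (P x).toReal + m / 2 * ‖y - x‖ ^ 2 ≤ φ y + (P y).toReal)
    (j : ℕ) :
    2 ^ j * (φ (apg φ P L θ K x₀ (j * K)) + (P (apg φ P L θ K x₀ (j * K))).toReal
      - (φ x + (P x).toReal)) ≤ φ x₀ + (P x₀).toReal - (φ x + (P x).toReal) := by
  induction j with
  | zero => simp [apg, apgState]
  | succ j ih =>
    refine le_trans ?_ ih
    have hL := h.L_pos
    have hKpos : 0 < K := by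
      have : (0 : ℝ) < K := lt_of_lt_of_le (by positivity) hK
      exact_mod_cast this
    obtain ⟨i, rfl⟩ : ∃ i, K = i + 1 := ⟨K - 1, by omega⟩
    have hr := h.apgState_rate hθ hx₀ hx hmin j (Nat.lt_succ_self i)
    have hmem := h.apg_mem hθ (i + 1) hx₀ (j * (i + 1))
    have hg := hgrow _ hmem
    simp only at hr
    rw [show j * (i + 1) + i + 1 = (j + 1) * (i + 1) by ring] at hr
    change _ ≤ L / 2 * ‖x - apg φ P L θ (i + 1) x₀ (j * (i + 1))‖ ^ 2 at hr
    rw [norm_sub_rev x (apg _ _ _ _ _ _ _)] at hr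
    change (φ (apg φ P L θ (i + 1) x₀ ((j + 1) * (i + 1))) +
      (P (apg φ P L θ (i + 1) x₀ ((j + 1) * (i + 1)))).toReal - (φ x + (P x).toReal)) / θ i ^ 2
        + L / 2 * ‖x - (apgState φ P L θ (i + 1) x₀ ((j + 1) * (i + 1))).2‖ ^ 2 ≤ _ at hr
    set A := φ (apg φ P L θ (i + 1) x₀ ((j + 1) * (i + 1))) +
      (P (apg φ P L θ (i + 1) x₀ ((j + 1) * (i + 1)))).toReal - (φ x + (P x).toReal) with hA
    have hA0 : 0 ≤ A := sub_nonneg.2 (hmin _ (h.apg_mem hθ _ hx₀ _))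
    set B := φ (apg φ P L θ (i + 1) x₀ (j * (i + 1))) +
      (P (apg φ P L θ (i + 1) x₀ (j * (i + 1)))).toReal with hB
    set N := ‖apg φ P L θ (i + 1) x₀ (j * (i + 1)) - x‖ ^ 2
    have hN : 0 ≤ N := by positivity
    have hθ2 : 0 < θ i ^ 2 := pow_pos (hθ.pos _) 2
    -- With `K = i + 1`, the bounds `θ i ≤ 2 / K` and `K ^ 2 ≥ 8 * L / m` give `A ≤ m / 4 * N`.
    -- Quadratic growth bounds `m / 2 * N` by the previous gap, whence the factor one half.
    have h1 : A ≤ θ i ^ 2 * (L / 2 * N) := by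
      have : A / θ i ^ 2 ≤ L / 2 * N := by
        have : 0 ≤ L / 2 * ‖x - (apgState φ P L θ (i + 1) x₀ ((j + 1) * (i + 1))).2‖ ^ 2 := by
          positivity
        linarith
      rwa [div_le_iff₀' hθ2] at this
    have h2 : θ i ^ 2 ≤ 4 / ((i : ℝ) + 1) ^ 2 := by
      calc θ i ^ 2 ≤ (2 / ((i : ℝ) + 2)) ^ 2 := by
            have := (hθ.pos i).le
            gcongr
            exact hθ.le i
        _ ≤ (2 / ((i : ℝ) + 1)) ^ 2 := by gcongr; norm_num
        _ = _ := by rw [div_pow]; norm_num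
    have h3 : 8 * L / m ≤ ((i : ℝ) + 1) ^ 2 := by
      have h4 : (2 * √(2 * L / m)) ^ 2 ≤ ((i + 1 : ℕ) : ℝ) ^ 2 := by gcongr
      rw [mul_pow, Real.sq_sqrt (by positivity)] at h4
      push_cast at h4
      calc 8 * L / m = 2 ^ 2 * (2 * L / m) := by ring
        _ ≤ _ := h4
    have h5 : θ i ^ 2 * L ≤ m / 2 := by
      have hi0 : (0 : ℝ) < ((i : ℝ) + 1) ^ 2 := by positivity
      calc θ i ^ 2 * L ≤ 4 / ((i : ℝ) + 1) ^ 2 * L := by gcongr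
        _ ≤ m / 2 := by
          rw [div_mul_eq_mul_div, div_le_iff₀ hi0]
          rw [div_le_iff₀ hm] at h3
          linarith
    have h6 : θ i ^ 2 * L * N ≤ m / 2 * N := by gcongr
    have h7 : 2 * A ≤ B - (φ x + (P x).toReal) := by nlinarith
    calc 2 ^ (j + 1) * A = 2 ^ j * (2 * A) := by ring
      _ ≤ _ := by gcongr

end IsComposite

/-! ### The conjugate of `h` and its smooth approximation -/

namespace CompositeProblem

variable {n d₁ d₂ : ℕ} {P : CompositeProblem n d₁ d₂} {c : ProblemConstants} {xs : Vec n}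
  {ls : PairVec d₁ d₂}

/-- `v` is a subgradient of `h` at `z`. -/
def IsSubgrad (P : CompositeProblem n d₁ d₂) (v z : PairVec d₁ d₂) : Prop :=
  z.snd ∈ P.K ∧ ∀ w : PairVec d₁ d₂, w.snd ∈ P.K →
    P.h₁ z.fst + inner ℝ v (w - z) ≤ P.h₁ w.fst

/-- The real value of the conjugate of `h`. -/
def conj (P : CompositeProblem n d₁ d₂) (v : PairVec d₁ d₂) : ℝ := (fenchelConj P.h v).toReal

/-- The real value of the smooth approximation of `h`. -/
def hReal (P : CompositeProblem n d₁ d₂) (u lam : PairVec d₁ d₂) (β : ℝ) : ℝ :=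
  (P.hSmooth u lam β).toReal

theorem h_of_mem {u : PairVec d₁ d₂} (hu : u.snd ∈ P.K) : P.h u = (P.h₁ u.fst : EReal) := by
  simp [h, hu]

theorem h_of_notMem {u : PairVec d₁ d₂} (hu : u.snd ∉ P.K) : P.h u = ⊤ := by
  simp [h, hu]

theorem inner_sub_h_le {v u : PairVec d₁ d₂} {r : ℝ}
    (hr : u.snd ∈ P.K → inner ℝ v u - P.h₁ u.fst ≤ r) :
    ((inner ℝ v u : ℝ) : EReal) - P.h u ≤ (r : EReal) := by
  by_cases hu : u.snd ∈ P.K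
  · rw [h_of_mem hu, ← EReal.coe_sub, EReal.coe_le_coe_iff]
    exact hr hu
  · rw [h_of_notMem hu]; simp

theorem le_fenchelConj {v z : PairVec d₁ d₂} (hz : z.snd ∈ P.K) :
    ((inner ℝ v z - P.h₁ z.fst : ℝ) : EReal) ≤ fenchelConj P.h v := by
  have := le_iSup (fun u : PairVec d₁ d₂ => ((inner ℝ v u : ℝ) : EReal) - P.h u) z
  simp only [h_of_mem hz, ← EReal.coe_sub] at this
  exact this

/-- Equality case of Fenchel–Young: the supremum is attained at `z`. This evaluates `h*` at every
multiplier without biconjugation. -/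
theorem IsSubgrad.fenchelConj_eq {v z : PairVec d₁ d₂} (h : P.IsSubgrad v z) :
    fenchelConj P.h v = ((inner ℝ v z - P.h₁ z.fst : ℝ) : EReal) := by
  refine le_antisymm (iSup_le fun u => inner_sub_h_le fun hu => ?_) (le_fenchelConj h.1)
  have := h.2 u hu
  rw [inner_sub_right] at this
  linarith

theorem IsSubgrad.mem_effDom {v z : PairVec d₁ d₂} (h : P.IsSubgrad v z) :
    v ∈ effDom (fenchelConj P.h) := by
  change fenchelConj P.h v ≠ ⊤
  rw [h.fenchelConj_eq]; exact EReal.coe_ne_top _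

theorem IsSubgrad.conj_eq {v z : PairVec d₁ d₂} (h : P.IsSubgrad v z) :
    P.conj v = inner ℝ v z - P.h₁ z.fst := by
  rw [conj, h.fenchelConj_eq, EReal.toReal_coe]

theorem h₁_continuous (hS : P.Standing c xs ls) : Continuous P.h₁ := by
  refine (LipschitzWith.of_dist_le_mul (K := ⟨c.Lh₁, hS.Lh₁_nonneg⟩) fun u v => ?_).continuous
  rw [Real.dist_eq, dist_eq_norm]
  exact hS.h₁_lipschitz u v

theorem continuous_fst : Continuous fun u : PairVec d₁ d₂ => u.fst :=
  (WithLp.prod_continuous_ofLp 2 _ _).fst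

theorem continuous_snd : Continuous fun u : PairVec d₁ d₂ => u.snd :=
  (WithLp.prod_continuous_ofLp 2 _ _).snd

theorem h_lowerSemicontinuous (hS : P.Standing c xs ls) : LowerSemicontinuous P.h := by
  have hc : Continuous fun u : PairVec d₁ d₂ => (P.h₁ u.fst : EReal) :=
    continuous_coe_real_ereal.comp ((h₁_continuous hS).comp continuous_fst)
  intro u a ha
  by_cases hu : u.snd ∈ P.K
  · rw [h_of_mem hu] at ha
    filter_upwards [hc.continuousAt.eventually (lt_mem_nhds ha)] with y hy
    by_cases hyK : y.snd ∈ P.K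
    · rwa [h_of_mem hyK]
    · rw [h_of_notMem hyK]; exact hy.trans_le le_top
  · have : IsOpen {y : PairVec d₁ d₂ | y.snd ∉ P.K} :=
      (hS.K_closed.preimage continuous_snd).isOpen_compl
    filter_upwards [this.mem_nhds hu] with y hy
    rw [h_of_notMem hy]
    rwa [h_of_notMem hu] at ha

theorem effDom_h : effDom P.h = {u | u.snd ∈ P.K} := by
  ext u
  by_cases hu : u.snd ∈ P.K
  · simp [effDom, h_of_mem hu, hu]
  · simp [effDom, h_of_notMem hu, hu]

/-- Existence of the proximal point of `h`. -/
theorem exists_isSubgrad_prox (hS : P.Standing c xs ls) (w : PairVec d₁ d₂) {β : ℝ}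
    (hβ : 0 < β) : ∃ z : PairVec d₁ d₂, P.IsSubgrad (β⁻¹ • (w - z)) z := by
  have hdom : effDom (fun z => P.h z + ((0 + β⁻¹ / 2 * ‖z - w‖ ^ 2 : ℝ) : EReal)) =
      {u | u.snd ∈ P.K} := by rw [← effDom_h]; exact effDom_add_coe P.h _
  have hconv : Convex ℝ {u : PairVec d₁ d₂ | u.snd ∈ P.K} := fun x hx y hy s t hs ht hst =>
    hS.K_convex hx hy hs ht hst
  have h0 : StrongConvexOn {u : PairVec d₁ d₂ | u.snd ∈ P.K} 0 fun u => P.h₁ u.fst := by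
    refine ⟨hconv, fun x hx y hy s t hs ht hst => ?_⟩
    have := hS.h₁_convex.2 (mem_univ x.fst) (mem_univ y.fst) hs ht hst
    simpa using this
  have h1 := h0.add_sq w β⁻¹
  have hreal : ∀ z : PairVec d₁ d₂, z.snd ∈ P.K →
      (P.h z + ((0 + β⁻¹ / 2 * ‖z - w‖ ^ 2 : ℝ) : EReal)).toReal =
        P.h₁ z.fst + β⁻¹ / 2 * ‖z - w‖ ^ 2 := fun z hz => by
    rw [h_of_mem hz, ← EReal.coe_add, EReal.toReal_coe, zero_add]
  have hbot : ∀ z : PairVec d₁ d₂,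
      P.h z + ((0 + β⁻¹ / 2 * ‖z - w‖ ^ 2 : ℝ) : EReal) ≠ ⊥ := fun z => by
    by_cases hz : z.snd ∈ P.K
    · rw [h_of_mem hz, ← EReal.coe_add]; exact EReal.coe_ne_bot _
    · rw [h_of_notMem hz, EReal.top_add_coe]; exact top_ne_bot
  obtain ⟨z, hz, hmin⟩ := exists_minimizer_of_strongConvexOn (m := β⁻¹)
    (ψ := fun z => P.h z + ((0 + β⁻¹ / 2 * ‖z - w‖ ^ 2 : ℝ) : EReal))
    hbot
    ((h_lowerSemicontinuous hS).add_coe_continuous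
      (q := fun z => 0 + β⁻¹ / 2 * ‖z - w‖ ^ 2) (by fun_prop))
    (by rw [hdom]; exact ⟨P.p xs, hS.xs_feasible⟩) (inv_pos.2 hβ)
    (by
      rw [hdom]
      rw [zero_add] at h1
      refine ⟨hconv, fun x hx y hy s t hs ht hst => ?_⟩
      simp only
      rw [hreal x hx, hreal y hy, hreal _ (hconv hx hy hs ht hst)]
      exact h1.2 hx hy hs ht hst)
  rw [hdom] at hz
  refine ⟨z, hz, fun u hu => ?_⟩
  -- The growth modulus is exactly `β⁻¹`, so on expanding `‖u - w‖ ^ 2` about `z` the terms `‖u - z‖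
  -- ^ 2` cancel and the subgradient inequality remains, without a sum rule.
  have hg := h1.growth hz (fun y hy => by
    rw [← hreal z hz, ← hreal y hy]
    refine EReal.toReal_le_toReal (hmin y) (hbot z) ?_
    rw [h_of_mem hy, ← EReal.coe_add]; exact EReal.coe_ne_top _) hu
  simp only [zero_add] at hg
  have e : ‖u - w‖ ^ 2 = ‖u - z‖ ^ 2 - 2 * inner ℝ (w - z) (u - z) + ‖z - w‖ ^ 2 := by
    rw [show u - w = (u - z) - (w - z) by abel, norm_sub_sq_real, real_inner_comm,
      norm_sub_rev w z]
  rw [e] at hg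
  rw [inner_smul_left]
  simp only [conj_trivial]
  nlinarith

theorem fenchelConj_ne_bot (hS : P.Standing c xs ls) {v : PairVec d₁ d₂} : fenchelConj P.h v ≠ ⊥ := by
  have : ((inner ℝ v (P.p xs) - P.h₁ (P.p xs).fst : ℝ) : EReal) ≤ fenchelConj P.h v :=
    le_fenchelConj hS.xs_feasible
  exact ne_bot_of_le_ne_bot (EReal.coe_ne_bot _) this

theorem coe_conj (hS : P.Standing c xs ls) {v : PairVec d₁ d₂}
    (hv : v ∈ effDom (fenchelConj P.h)) : (P.conj v : EReal) = fenchelConj P.h v :=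
  EReal.coe_toReal hv (fenchelConj_ne_bot hS)

/-- The Fenchel–Young inequality. -/
theorem inner_sub_le_conj (hS : P.Standing c xs ls) {v z : PairVec d₁ d₂}
    (hv : v ∈ effDom (fenchelConj P.h)) (hz : z.snd ∈ P.K) :
    inner ℝ v z - P.h₁ z.fst ≤ P.conj v := by
  rw [← EReal.coe_le_coe_iff, coe_conj hS hv]
  exact le_fenchelConj hz

/-- Completing the square: the hypothesis is stationarity at `w` of `v ↦ ⟨v, u - z⟩ - β/2 ‖v -
lam‖²`, which therefore drops by exactly `β/2 ‖v - w‖²`. -/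
theorem quadratic_identity {V : Type*} [NormedAddCommGroup V] [InnerProductSpace ℝ V]
    (v w lam u z : V) {β : ℝ} (h : z = u - β • (w - lam)) :
    inner ℝ v u - inner ℝ v z - β / 2 * ‖v - lam‖ ^ 2 + β / 2 * ‖v - w‖ ^ 2 =
      inner ℝ w u - inner ℝ w z - β / 2 * ‖w - lam‖ ^ 2 := by
  rw [← inner_sub_right, ← inner_sub_right, show u - z = β • (w - lam) by rw [h]; abel,
    show v - w = (v - lam) - (w - lam) by abel, norm_sub_sq_real (v - lam), inner_smul_right,
    inner_smul_right]
  have e1 : inner ℝ (v - lam) (w - lam) = inner ℝ v (w - lam) - inner ℝ lam (w - lam) :=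
    inner_sub_left _ _ _
  have e2 : ‖w - lam‖ ^ 2 = inner ℝ w (w - lam) - inner ℝ lam (w - lam) := by
    rw [← inner_sub_left, real_inner_self_eq_norm_sq]
  rw [e1]
  linear_combination β * e2

/-- Fenchel–Young at the point where `w` is a subgradient, combined with `quadratic_identity`. For
`β > 0` it shows at once that `w` is the unique maximizer and that the gap is quadratic. -/
theorem smoothObj_le (hS : P.Standing c xs ls) {u lam w : PairVec d₁ d₂} {β : ℝ}
    (hw : P.IsSubgrad w (u - β • (w - lam))) (v : PairVec d₁ d₂) :
    P.smoothObj u lam β v ≤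
      ((inner ℝ w u - P.conj w - β / 2 * ‖w - lam‖ ^ 2 - β / 2 * ‖v - w‖ ^ 2 : ℝ) : EReal) := by
  rw [smoothObj]
  by_cases hv : v ∈ effDom (fenchelConj P.h)
  · rw [← coe_conj hS hv, ← EReal.coe_sub, EReal.coe_le_coe_iff]
    have h1 := inner_sub_le_conj hS hv hw.1
    have h2 := quadratic_identity v w lam u _ (β := β) rfl
    rw [hw.conj_eq]
    linarith
  · have : fenchelConj P.h v = ⊤ := not_not.1 hv
    rw [this]; simp

theorem smoothObj_eq (hS : P.Standing c xs ls) {u lam w : PairVec d₁ d₂} {β : ℝ}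
    (hw : w ∈ effDom (fenchelConj P.h)) :
    P.smoothObj u lam β w = ((inner ℝ w u - P.conj w - β / 2 * ‖w - lam‖ ^ 2 : ℝ) : EReal) := by
  rw [smoothObj, ← coe_conj hS hw, ← EReal.coe_sub, EReal.coe_eq_coe_iff]
  ring

/-- Optimality condition characterizing the multiplier map. -/
theorem multiplier_isSubgrad (hS : P.Standing c xs ls) (u lam : PairVec d₁ d₂) {β : ℝ}
    (hβ : 0 < β) :
    P.IsSubgrad (P.multiplier u lam β) (u - β • (P.multiplier u lam β - lam)) := by
  -- By Moreau's decomposition the maximizer is `β⁻¹ • (u + β • lam - z)` with `z` the proximal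
  -- point of `u + β • lam`. The chosen `argmax` must agree with it because the gap is quadratic.
  obtain ⟨z, hz⟩ := exists_isSubgrad_prox hS (u + β • lam) hβ
  set w := β⁻¹ • (u + β • lam - z) with hw
  have hz' : z = u - β • (w - lam) := by
    rw [hw, smul_sub, smul_smul, mul_inv_cancel₀ hβ.ne', one_smul]; abel
  rw [hz'] at hz
  have h1 := le_argmax (G := P.smoothObj u lam β) ⟨w, fun v => by
    rw [smoothObj_eq hS hz.mem_effDom]
    refine (smoothObj_le hS hz v).trans ?_
    rw [EReal.coe_le_coe_iff]
    have : 0 ≤ β / 2 * ‖v - w‖ ^ 2 := by positivity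
    linarith⟩ w
  have h2 := h1.trans (smoothObj_le hS hz (argmax (P.smoothObj u lam β)))
  rw [smoothObj_eq hS hz.mem_effDom, EReal.coe_le_coe_iff] at h2
  have h3 : ‖P.multiplier u lam β - w‖ ^ 2 ≤ 0 := by
    change _ ≤ _ - β / 2 * ‖P.multiplier u lam β - w‖ ^ 2 at h2
    have : 0 ≤ ‖P.multiplier u lam β - w‖ ^ 2 := by positivity
    nlinarith
  have h4 : P.multiplier u lam β = w := by
    rw [← sub_eq_zero, ← norm_eq_zero]
    exact pow_eq_zero_iff (two_ne_zero) |>.1 (le_antisymm h3 (by positivity))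
  rwa [h4]

theorem hSmooth_eq (hS : P.Standing c xs ls) (u lam : PairVec d₁ d₂) {β : ℝ} (hβ : 0 < β) :
    P.hSmooth u lam β = ((inner ℝ (P.multiplier u lam β) u - P.conj (P.multiplier u lam β)
      - β / 2 * ‖P.multiplier u lam β - lam‖ ^ 2 : ℝ) : EReal) := by
  have h := multiplier_isSubgrad hS u lam hβ
  refine le_antisymm (iSup_le fun v => (smoothObj_le hS h v).trans ?_) ?_
  · rw [EReal.coe_le_coe_iff]
    have : 0 ≤ β / 2 * ‖v - P.multiplier u lam β‖ ^ 2 := by positivity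
    linarith
  · rw [← smoothObj_eq hS h.mem_effDom]
    exact le_iSup (P.smoothObj u lam β) _

theorem hReal_eq (hS : P.Standing c xs ls) (u lam : PairVec d₁ d₂) {β : ℝ} (hβ : 0 < β) :
    P.hReal u lam β = inner ℝ (P.multiplier u lam β) u - P.conj (P.multiplier u lam β)
      - β / 2 * ‖P.multiplier u lam β - lam‖ ^ 2 := by
  rw [hReal, hSmooth_eq hS u lam hβ, EReal.toReal_coe]

theorem coe_hReal (hS : P.Standing c xs ls) (u lam : PairVec d₁ d₂) {β : ℝ} (hβ : 0 < β) :
    (P.hReal u lam β : EReal) = P.hSmooth u lam β := by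
  rw [hReal_eq hS u lam hβ, hSmooth_eq hS u lam hβ]

/-- Strong concavity of the dual objective defining the smooth approximation. -/
theorem le_hReal (hS : P.Standing c xs ls) (u lam : PairVec d₁ d₂) {β : ℝ} (hβ : 0 < β)
    {v : PairVec d₁ d₂} (hv : v ∈ effDom (fenchelConj P.h)) :
    inner ℝ v u - P.conj v - β / 2 * ‖v - lam‖ ^ 2 + β / 2 * ‖v - P.multiplier u lam β‖ ^ 2 ≤
      P.hReal u lam β := by
  have h := smoothObj_le hS (multiplier_isSubgrad hS u lam hβ) v
  rw [smoothObj_eq hS hv, EReal.coe_le_coe_iff] at h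
  rw [hReal_eq hS u lam hβ]
  linarith

/-- The smooth approximation as a Moreau envelope: upper bound. -/
theorem hReal_le (hS : P.Standing c xs ls) (u lam : PairVec d₁ d₂) {β : ℝ} (hβ : 0 < β)
    {z : PairVec d₁ d₂} (hz : z.snd ∈ P.K) :
    P.hReal u lam β ≤ P.h₁ z.fst + inner ℝ lam (u - z) + β⁻¹ / 2 * ‖u - z‖ ^ 2 := by
  have h := multiplier_isSubgrad hS u lam hβ
  rw [hReal_eq hS u lam hβ]
  set v := P.multiplier u lam β
  have h1 := inner_sub_le_conj hS h.mem_effDom hz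
  have h2 : 0 ≤ β⁻¹ / 2 * ‖(u - z) - β • (v - lam)‖ ^ 2 := by positivity
  rw [norm_sub_sq_real, norm_smul, mul_pow, Real.norm_eq_abs, sq_abs, inner_smul_right,
    inner_sub_right] at h2
  have e : β⁻¹ / 2 * (‖u - z‖ ^ 2 - 2 * (β * (inner ℝ (u - z) v - inner ℝ (u - z) lam)) +
      β ^ 2 * ‖v - lam‖ ^ 2) = β⁻¹ / 2 * ‖u - z‖ ^ 2 - (inner ℝ (u - z) v - inner ℝ (u - z) lam)
        + β / 2 * ‖v - lam‖ ^ 2 := by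
    field_simp
  rw [e, real_inner_comm, real_inner_comm lam, inner_sub_right v] at h2
  linarith

/-- The smooth approximation as a Moreau envelope: the value is attained. -/
theorem hReal_eq_prox (hS : P.Standing c xs ls) (u lam : PairVec d₁ d₂) {β : ℝ} (hβ : 0 < β) :
    let z := u - β • (P.multiplier u lam β - lam)
    P.hReal u lam β = P.h₁ z.fst + inner ℝ lam (u - z) + β⁻¹ / 2 * ‖u - z‖ ^ 2 := by
  intro z
  have h := multiplier_isSubgrad hS u lam hβ
  rw [hReal_eq hS u lam hβ, h.conj_eq]
  have e1 : u - z = β • (P.multiplier u lam β - lam) := by simp [z]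
  change inner ℝ _ u - (inner ℝ _ z - P.h₁ z.fst) - _ = _
  have e2 : inner ℝ (P.multiplier u lam β) u - inner ℝ (P.multiplier u lam β) z =
      inner ℝ (P.multiplier u lam β - lam) (u - z) + inner ℝ lam (u - z) := by
    rw [← inner_sub_right, ← inner_add_left, sub_add_cancel]
  have e3 : inner ℝ (P.multiplier u lam β - lam) (u - z) =
      β * ‖P.multiplier u lam β - lam‖ ^ 2 := by
    rw [e1, inner_smul_right, real_inner_self_eq_norm_sq]
  have e4 : β⁻¹ / 2 * ‖u - z‖ ^ 2 = β / 2 * ‖P.multiplier u lam β - lam‖ ^ 2 := by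
    rw [e1, norm_smul, mul_pow, Real.norm_eq_abs, sq_abs]; field_simp
  linarith

theorem hReal_le_h₁ (hS : P.Standing c xs ls) (u lam : PairVec d₁ d₂) {β : ℝ} (hβ : 0 < β)
    (hu : u.snd ∈ P.K) : P.hReal u lam β ≤ P.h₁ u.fst := by
  simpa using hReal_le hS u lam hβ hu

/-- Smoothness of the approximation: quadratic upper bound. -/
theorem hReal_le_add_inner (hS : P.Standing c xs ls) (u u' lam : PairVec d₁ d₂) {β : ℝ}
    (hβ : 0 < β) :
    P.hReal u' lam β ≤ P.hReal u lam β + inner ℝ (P.multiplier u lam β) (u' - u) +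
      β⁻¹ / 2 * ‖u' - u‖ ^ 2 := by
  -- The envelope at `u'` is tested with the proximal point of `u`.
  have h1 := hReal_le hS u' lam hβ (multiplier_isSubgrad hS u lam hβ).1
  have h2 := hReal_eq_prox hS u lam hβ
  simp only at h2
  set v := P.multiplier u lam β
  set z := u - β • (v - lam) with hz
  have e1 : u - z = β • (v - lam) := by simp [z]
  have e2 : u' - z = (u' - u) + β • (v - lam) := by rw [← e1]; abel
  rw [e1, inner_smul_right] at h2
  rw [e2, norm_add_sq_real, inner_add_right, inner_smul_right, inner_smul_right] at h1
  have e3 : β⁻¹ / 2 * (2 * (β * inner ℝ (u' - u) (v - lam))) = inner ℝ (u' - u) (v - lam) := by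
    field_simp
  have e4 : inner ℝ (u' - u) (v - lam) = inner ℝ v (u' - u) - inner ℝ lam (u' - u) := by
    rw [real_inner_comm, inner_sub_left]
  linarith

/-- Convexity of the approximation: linear lower bound. -/
theorem add_inner_le_hReal (hS : P.Standing c xs ls) (u u' lam : PairVec d₁ d₂) {β : ℝ}
    (hβ : 0 < β) :
    P.hReal u lam β + inner ℝ (P.multiplier u lam β) (u' - u) ≤ P.hReal u' lam β := by
  have h1 := le_hReal hS u' lam hβ (multiplier_isSubgrad hS u lam hβ).mem_effDom
  rw [hReal_eq hS u lam hβ, inner_sub_right]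
  have : 0 ≤ β / 2 * ‖P.multiplier u lam β - P.multiplier u' lam β‖ ^ 2 := by positivity
  linarith

/-- The affine minorant and the quadratic majorant at `u` have the same slope, the multiplier, so
the remainder is `O(‖u' - u‖²)`. -/
theorem hReal_hasFDerivAt (hS : P.Standing c xs ls) (u lam : PairVec d₁ d₂) {β : ℝ}
    (hβ : 0 < β) :
    HasFDerivAt (fun u => P.hReal u lam β) (innerSL ℝ (P.multiplier u lam β)) u := by
  rw [hasFDerivAt_iff_isLittleO]
  refine Asymptotics.IsBigO.trans_isLittleO (g := fun u' => ‖u' - u‖ ^ 2) ?_ ?_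
  · refine Asymptotics.IsBigO.of_bound (β⁻¹ / 2) (Eventually.of_forall fun u' => ?_)
    have h1 := hReal_le_add_inner hS u u' lam hβ
    have h2 := add_inner_le_hReal hS u u' lam hβ
    rw [Real.norm_eq_abs, abs_of_nonneg, norm_pow, norm_norm]
    · simp only [innerSL_apply_apply]; linarith
    · simp only [innerSL_apply_apply]; linarith
  · exact Asymptotics.isLittleO_pow_sub_sub u one_lt_two

/-! ### Composition with `p` -/

/-- The composite convexity assumptions with shifts `p x - z` and `p y - w`. Both enter the proof
only in this form: `q` is feasible and its `h₁`-value is bounded by the average. -/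
theorem p_segment_mem (hS : P.Standing c xs ls) {x y : Vec n} {z w : PairVec d₁ d₂} {t : ℝ}
    (ht0 : 0 < t) (ht1 : t < 1) (hz : z.snd ∈ P.K) (hw : w.snd ∈ P.K) :
    let q := P.p (t • x + (1 - t) • y) - t • (P.p x - z) - (1 - t) • (P.p y - w)
    q.snd ∈ P.K ∧ P.h₁ q.fst ≤ t * P.h₁ z.fst + (1 - t) * P.h₁ w.fst := by
  intro q
  constructor
  · have := hS.K_comp x y (P.p₂ x - z.snd) (P.p₂ y - w.snd) t ht0 ht1
      (by simpa using hz) (by simpa using hw)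
    exact this
  · have := hS.h₁_comp x y (P.p₁ x - z.fst) (P.p₁ y - w.fst) t ht0 ht1
    rw [sub_sub_cancel, sub_sub_cancel] at this
    exact this

/-- The inner product of a subgradient of `h` with `p` is convex. -/
theorem IsSubgrad.inner_p_le (hS : P.Standing c xs ls) {v z : PairVec d₁ d₂}
    (h : P.IsSubgrad v z) (x y : Vec n) {t : ℝ} (ht0 : 0 < t) (ht1 : t < 1) :
    inner ℝ v (P.p (t • x + (1 - t) • y)) ≤
      t * inner ℝ v (P.p x) + (1 - t) * inner ℝ v (P.p y) := by
  -- With `z` at both ends, `q - z` is the convexity defect of `p` and `h₁` does not increase from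
  -- `z` to `q`, so the pairing of `v` with the defect is nonpositive.
  obtain ⟨h1, h2⟩ := p_segment_mem hS (x := x) (y := y) ht0 ht1 h.1 h.1
  have h3 := h.2 _ h1
  rw [show P.p (t • x + (1 - t) • y) - t • (P.p x - z) - (1 - t) • (P.p y - z) - z =
    P.p (t • x + (1 - t) • y) - t • P.p x - (1 - t) • P.p y by module, inner_sub_right,
    inner_sub_right, inner_smul_right, inner_smul_right] at h3
  linarith

/-- At the intermediate point, test the envelope with the `q` of `p_segment_mem` built from the
proximal points of `p x` and `p y`. Its residual is the average of the two residuals, and the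
squared norm is convex. -/
theorem hReal_p_convexOn (hS : P.Standing c xs ls) (lam : PairVec d₁ d₂) {β : ℝ} (hβ : 0 < β) :
    ConvexOn ℝ univ fun x => P.hReal (P.p x) lam β := by
  refine ⟨convex_univ, fun x _ y _ a b ha hb hab => ?_⟩
  rcases ha.eq_or_lt with rfl | ha0
  · obtain rfl : b = 1 := by linarith
    simp
  rcases hb.eq_or_lt with rfl | hb0
  · obtain rfl : a = 1 := by linarith
    simp
  obtain rfl : b = 1 - a := by linarith
  have hx := multiplier_isSubgrad hS (P.p x) lam hβ
  have hy := multiplier_isSubgrad hS (P.p y) lam hβ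
  obtain ⟨h1, h2⟩ := p_segment_mem hS (x := x) (y := y) ha0 (by linarith) hx.1 hy.1
  have ex := hReal_eq_prox hS (P.p x) lam hβ
  have ey := hReal_eq_prox hS (P.p y) lam hβ
  have h3 := hReal_le hS (P.p (a • x + (1 - a) • y)) lam hβ h1
  simp only at ex ey
  set z := P.p x - β • (P.multiplier (P.p x) lam β - lam)
  set w := P.p y - β • (P.multiplier (P.p y) lam β - lam)
  rw [show P.p (a • x + (1 - a) • y) - (P.p (a • x + (1 - a) • y) - a • (P.p x - z) -
    (1 - a) • (P.p y - w)) = (1 - (1 - a)) • (P.p x - z) + (1 - a) • (P.p y - w) - 0 by module,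
    norm_sq_segment, sub_zero, sub_zero, sub_zero, inner_add_right, inner_smul_right,
    inner_smul_right] at h3
  simp only [smul_eq_mul]
  have h4 : 0 ≤ β⁻¹ / 2 * ((1 - (1 - a)) * (1 - a) * ‖P.p x - z - (P.p y - w)‖ ^ 2) := by
    have : 0 ≤ 1 - (1 - a) := by linarith
    positivity
  rw [ex, ey]
  nlinarith

end CompositeProblem

/-! ### The inner problem -/

namespace CompositeProblem

variable {n d₁ d₂ : ℕ} {P : CompositeProblem n d₁ d₂} {c : ProblemConstants} {xs : Vec n}
  {ls : PairVec d₁ d₂}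

/-- The real value of `f`. -/
def fReal (P : CompositeProblem n d₁ d₂) (x : Vec n) : ℝ := (P.f x).toReal

/-- The real value of `g`. -/
def gReal (P : CompositeProblem n d₁ d₂) (x : Vec n) : ℝ := (P.g x).toReal

/-- The real value of the proximal augmented Lagrangian on the domain of `g`. -/
def alReal (P : CompositeProblem n d₁ d₂) (y : Vec n) (lam : PairVec d₁ d₂) (β : ℝ)
    (x : Vec n) : ℝ :=
  P.fReal x + P.gReal x + P.hReal (P.p x) lam β + β / 2 * ‖x - y‖ ^ 2

theorem Standing.convex_dom (hS : P.Standing c xs ls) : Convex ℝ (effDom P.g) := hS.g_convex.1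

theorem Standing.dom_subset (hS : P.Standing c xs ls) : effDom P.g ⊆ effDom P.f := by
  obtain ⟨U, _, h1, h2, _⟩ := hS.f_diff
  exact h1.trans h2

theorem Standing.eventually_mem (hS : P.Standing c xs ls) {x : Vec n} (hx : x ∈ effDom P.g) :
    ∀ᶠ y in 𝓝 x, y ∈ effDom P.f := by
  obtain ⟨U, hU, h1, h2, _⟩ := hS.f_diff
  filter_upwards [hU.mem_nhds (h1 hx)] with y hy using h2 hy

theorem Standing.fReal_differentiableAt (hS : P.Standing c xs ls) {x : Vec n}
    (hx : x ∈ effDom P.g) : DifferentiableAt ℝ P.fReal x := by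
  obtain ⟨U, hU, h1, _, h3⟩ := hS.f_diff
  exact h3.differentiableAt (hU.mem_nhds (h1 hx))

theorem Standing.fReal_convexOn (hS : P.Standing c xs ls) : ConvexOn ℝ (effDom P.g) P.fReal :=
  ConvexOn.subset hS.f_convex hS.dom_subset hS.convex_dom

theorem Standing.coe_fReal (hS : P.Standing c xs ls) {x : Vec n} (hx : x ∈ effDom P.f) :
    (P.fReal x : EReal) = P.f x :=
  EReal.coe_toReal hx (hS.f_ne_bot x)

theorem Standing.coe_gReal (hS : P.Standing c xs ls) {x : Vec n} (hx : x ∈ effDom P.g) :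
    (P.gReal x : EReal) = P.g x :=
  EReal.coe_toReal hx (hS.g_ne_bot x)

theorem Standing.p_differentiable (hS : P.Standing c xs ls) : Differentiable ℝ P.p :=
  (WithLp.prodContinuousLinearEquiv 2 ℝ (Vec d₁) (Vec d₂)).symm.differentiable.comp
    (hS.p₁_diff.prodMk hS.p₂_diff)

theorem Standing.smoothPart_eq (hS : P.Standing c xs ls) (lam : PairVec d₁ d₂) {β : ℝ}
    (hβ : 0 < β) {x : Vec n} (hx : x ∈ effDom P.f) :
    P.smoothPart lam β x = P.fReal x + P.hReal (P.p x) lam β := by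
  rw [smoothPart, ← coe_hReal hS _ _ hβ, EReal.toReal_add_coe' hx (hS.f_ne_bot x)]
  rfl

/-- The `toReal` of the extended-valued sum agrees with the real sum where `f` is finite, which
holds near every point of the domain of `g`. -/
theorem Standing.smoothPart_hasFDerivAt (hS : P.Standing c xs ls) (lam : PairVec d₁ d₂) {β : ℝ}
    (hβ : 0 < β) {x : Vec n} (hx : x ∈ effDom P.g) :
    HasFDerivAt (P.smoothPart lam β)
      (fderiv ℝ P.fReal x + (innerSL ℝ (P.multiplier (P.p x) lam β)).comp (fderiv ℝ P.p x)) x := by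
  have h1 := (hS.fReal_differentiableAt hx).hasFDerivAt.add
    ((hReal_hasFDerivAt hS (P.p x) lam hβ).comp x (hS.p_differentiable x).hasFDerivAt)
  refine h1.congr_of_eventuallyEq ?_
  filter_upwards [hS.eventually_mem hx] with y hy
  exact hS.smoothPart_eq lam hβ hy

theorem Standing.inner_gradient_smoothPart (hS : P.Standing c xs ls) (lam : PairVec d₁ d₂) {β : ℝ}
    (hβ : 0 < β) {x : Vec n} (hx : x ∈ effDom P.g) (v : Vec n) :
    inner ℝ (gradient (P.smoothPart lam β) x) v = inner ℝ (gradient P.fReal x) v +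
      inner ℝ (P.multiplier (P.p x) lam β) (fderiv ℝ P.p x v) := by
  rw [inner_gradient_left, inner_gradient_left, (hS.smoothPart_hasFDerivAt lam hβ hx).fderiv]
  simp

theorem Standing.smoothPart_convexOn (hS : P.Standing c xs ls) (lam : PairVec d₁ d₂) {β : ℝ}
    (hβ : 0 < β) : ConvexOn ℝ (effDom P.g) (P.smoothPart lam β) := by
  have := hS.fReal_convexOn.add
    ((hReal_p_convexOn hS lam hβ).subset (subset_univ _) hS.convex_dom)
  exact this.congr fun x hx => (hS.smoothPart_eq lam hβ (hS.dom_subset hx)).symm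

/-! ### Bounds on the multipliers -/

/-- Test the subgradient inequality at `z` shifted by `v.fst` in the first block, and compare with
the Lipschitz bound of `h₁`. -/
theorem IsSubgrad.norm_fst_le (hS : P.Standing c xs ls) {v z : PairVec d₁ d₂}
    (h : P.IsSubgrad v z) : ‖v.fst‖ ≤ c.Lh₁ := by
  have h1 := h.2 (z + WithLp.toLp 2 (v.fst, 0)) (by simpa using h.1)
  have h2 := (abs_le.1 (hS.h₁_lipschitz (z.fst + v.fst) z.fst)).2
  simp only [add_sub_cancel_left, WithLp.prod_inner_apply, WithLp.add_fst] at h1 h2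
  have h3 : ‖v.fst‖ * ‖v.fst‖ ≤ c.Lh₁ * ‖v.fst‖ := by
    have e : inner ℝ v.ofLp.1 v.fst = ‖v.fst‖ * ‖v.fst‖ := real_inner_self_eq_norm_mul_norm _
    simp only [inner_zero_right, add_zero] at h1
    change P.h₁ z.fst + inner ℝ v.ofLp.1 v.fst ≤ P.h₁ (z.fst + v.fst) at h1
    rw [e] at h1
    linarith
  rcases (norm_nonneg v.fst).eq_or_lt with h0 | h0
  · rw [← h0]; exact hS.Lh₁_nonneg
  · exact le_of_mul_le_mul_right h3 h0

/-- Testing with the first component frozen shows that `v.snd` is normal to `K` at `z.snd`. -/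
theorem IsSubgrad.inner_snd_le {v z : PairVec d₁ d₂} (h : P.IsSubgrad v z) {k : Vec d₂}
    (hk : k ∈ P.K) : inner ℝ v.snd (k - z.snd) ≤ 0 := by
  have h1 := h.2 (WithLp.toLp 2 (z.fst, k)) hk
  rw [WithLp.prod_inner_apply] at h1
  change P.h₁ z.fst + (inner ℝ v.fst (z.fst - z.fst) + inner ℝ v.snd (k - z.snd)) ≤
    P.h₁ z.fst at h1
  rw [sub_self, inner_zero_right] at h1
  linarith

/-- The second component of the multiplier is the scaled distance to `K`. -/
theorem norm_multiplier_snd_le (hS : P.Standing c xs ls) (u lam : PairVec d₁ d₂) {β : ℝ}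
    (hβ : 0 < β) {k : Vec d₂} (hk : k ∈ P.K) :
    β * ‖(P.multiplier u lam β).snd‖ ≤ ‖u.snd + β • lam.snd - k‖ := by
  have h := multiplier_isSubgrad hS u lam hβ
  set v := P.multiplier u lam β
  have h1 := h.inner_snd_le hk
  -- The vector `β • v.snd` is normal to `K` at the second component of the proximal point, so it
  -- makes an obtuse angle with directions into `K`, and subtracting such a direction can only
  -- lengthen it.
  have e : u.snd + β • lam.snd - k = β • v.snd - (k - (u - β • (v - lam)).snd) := by
    simp only [WithLp.sub_snd, WithLp.smul_snd, smul_sub]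
    abel
  have h2 : ‖β • v.snd‖ ^ 2 ≤ ‖u.snd + β • lam.snd - k‖ ^ 2 := by
    rw [e, norm_sub_sq_real, inner_smul_left]
    simp only [conj_trivial]
    nlinarith [sq_nonneg ‖k - (u - β • (v - lam)).snd‖, mul_nonneg hβ.le (neg_nonneg.2 h1)]
  have h3 := abs_le_of_sq_le_sq h2 (norm_nonneg _)
  rw [abs_of_nonneg (norm_nonneg _), norm_smul, Real.norm_of_nonneg hβ.le] at h3
  exact h3

theorem infDist_le_norm_add (y : Vec d₂) :
    Metric.infDist y P.K ≤ ‖y‖ + Metric.infDist 0 P.K := by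
  have := Metric.infDist_le_infDist_add_dist (s := P.K) (x := y) (y := 0)
  rw [dist_zero_right] at this
  linarith

theorem distConst_le (hN : P.NonlinearBounds c) (lam : PairVec d₁ d₂)
    {β : ℝ} (hβ : 0 < β) :
    P.distConst c lam β ≤ c.Mp₂ + β * ‖lam.snd‖ + Metric.infDist 0 P.K := by
  refine csSup_le ?_ ?_
  · refine ⟨_, 0, ?_, rfl⟩
    have := hN.Mp₂_nonneg
    simp only [mem_ofPred_eq, norm_zero]
    positivity
  · rintro _ ⟨y, hy, rfl⟩
    have := infDist_le_norm_add (P := P) y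
    simp only [mem_ofPred_eq] at hy
    simp only
    linarith

theorem le_distConst {lam : PairVec d₁ d₂} {β : ℝ} {y : Vec d₂}
    (hy : ‖y‖ ≤ c.Mp₂ + β * ‖lam.snd‖) : Metric.infDist y P.K ≤ P.distConst c lam β := by
  refine le_csSup ⟨c.Mp₂ + β * ‖lam.snd‖ + Metric.infDist 0 P.K, ?_⟩ ⟨y, hy, rfl⟩
  rintro _ ⟨y, hy, rfl⟩
  have := infDist_le_norm_add (P := P) y
  simp only [mem_ofPred_eq] at hy
  simp only
  linarith

theorem distConst_nonneg (lam : PairVec d₁ d₂) (β : ℝ) : 0 ≤ P.distConst c lam β :=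
  Real.sSup_nonneg (by rintro _ ⟨y, -, rfl⟩; exact Metric.infDist_nonneg)

theorem innerSmoothness_pos (hS : P.Standing c xs ls) (hT : P.SmoothTerm c)
    (hN : P.NonlinearBounds c) (lam : PairVec d₁ d₂) {β : ℝ} (hβ : 0 < β) :
    0 < P.innerSmoothness c lam β := by
  have h1 := hT.L_pos
  have h2 := hN.LDp_nonneg
  have h3 := hS.Lh₁_nonneg
  have h4 := distConst_nonneg (P := P) (c := c) lam β
  rw [innerSmoothness]
  positivity

theorem norm_le_fst_add_snd (v : PairVec d₁ d₂) : ‖v‖ ≤ ‖v.fst‖ + ‖v.snd‖ := by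
  refine abs_le_of_sq_le_sq' ?_ (by positivity) |>.2
  rw [WithLp.prod_norm_sq_eq_of_L2]
  nlinarith [norm_nonneg v.fst, norm_nonneg v.snd]

/-- The first component is controlled by the Lipschitz constant of `h₁`. The second, times `β`, is
at most the distance to `K` from `p₂ x + β λ₂`, a point of the ball that defines `d`. -/
theorem norm_multiplier_le (hS : P.Standing c xs ls) (hN : P.NonlinearBounds c)
    (lam : PairVec d₁ d₂) {β : ℝ} (hβ : 0 < β) {x : Vec n} (hx : x ∈ effDom P.g) :
    ‖P.multiplier (P.p x) lam β‖ ≤ c.Lh₁ + β⁻¹ * P.distConst c lam β := by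
  refine (norm_le_fst_add_snd _).trans
    (add_le_add ((multiplier_isSubgrad hS (P.p x) lam hβ).norm_fst_le hS) ?_)
  rw [le_inv_mul_iff₀ hβ]
  have h1 : ‖P.p₂ x + β • lam.snd‖ ≤ c.Mp₂ + β * ‖lam.snd‖ := by
    refine (norm_add_le _ _).trans (add_le_add (hN.p₂_le x hx) ?_)
    rw [norm_smul, Real.norm_of_nonneg hβ.le]
  refine le_trans ?_ (le_distConst h1)
  refine (Metric.le_infDist ⟨_, hS.xs_feasible⟩).2 fun k hk => ?_
  rw [dist_eq_norm]
  exact norm_multiplier_snd_le hS (P.p x) lam hβ hk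

theorem p_lipschitz (hS : P.Standing c xs ls) (hN : P.NonlinearBounds c) {x y : Vec n}
    (hx : x ∈ effDom P.g) (hy : y ∈ effDom P.g) : ‖P.p y - P.p x‖ ≤ c.MDp * ‖y - x‖ :=
  Convex.norm_image_sub_le_of_norm_fderiv_le (𝕜 := ℝ) (fun z _ => hS.p_differentiable z)
    hN.fderiv_le hS.convex_dom hx hy

/-! ### The inner objective as a composite function -/

theorem effDom_simplePart (y : Vec n) (β : ℝ) : effDom (P.simplePart y β) = effDom P.g :=
  effDom_add_coe P.g _

theorem Standing.simplePart_toReal (hS : P.Standing c xs ls) (y : Vec n) (β : ℝ) {x : Vec n}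
    (hx : x ∈ effDom P.g) : (P.simplePart y β x).toReal = P.gReal x + β / 2 * ‖x - y‖ ^ 2 :=
  EReal.toReal_add_coe' hx (hS.g_ne_bot x) _

theorem Standing.simplePart_strongConvexOn (hS : P.Standing c xs ls) (y : Vec n) (β : ℝ) :
    StrongConvexOn (effDom (P.simplePart y β)) (c.μg + β)
      fun x => (P.simplePart y β x).toReal := by
  rw [effDom_simplePart]
  have h := hS.g_convex.add_sq y β
  refine ⟨h.1, fun u hu v hv s t hs ht hst => ?_⟩
  have := h.2 hu hv hs ht hst
  simp only
  rw [hS.simplePart_toReal y β hu, hS.simplePart_toReal y β hv,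
    hS.simplePart_toReal y β (h.1 hu hv hs ht hst)]
  exact this

/-- The inner problem fits the accelerated proximal gradient method. -/
theorem isComposite_inner (hS : P.Standing c xs ls) (hT : P.SmoothTerm c)
    (hN : P.NonlinearBounds c) (y : Vec n) (lam : PairVec d₁ d₂) {β : ℝ} (hβ : 0 < β) :
    IsComposite (P.smoothPart lam β) (P.simplePart y β) (P.innerSmoothness c lam β)
      (c.μg + β) where
  ne_bot x := by
    simp only [simplePart, ne_eq, EReal.add_eq_bot_iff, hS.g_ne_bot x, EReal.coe_ne_bot, or_self,
      not_false_eq_true]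
  proper := by rw [effDom_simplePart]; exact hS.g_proper
  closed := hS.g_closed.add_coe_continuous (q := fun x => β / 2 * ‖x - y‖ ^ 2) (by fun_prop)
  m_nonneg := add_nonneg hS.μg_nonneg hβ.le
  convex := hS.simplePart_strongConvexOn y β
  L_pos := innerSmoothness_pos hS hT hN lam hβ
  minorant x hx z hz := by
    rw [effDom_simplePart] at hx hz
    have := (hS.smoothPart_convexOn lam hβ).add_fderiv_le hx hz
      (hS.smoothPart_hasFDerivAt lam hβ hx).differentiableAt.hasFDerivAt
    rwa [inner_gradient_left]
  majorant x hx z hz := by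
    rw [effDom_simplePart] at hx hz
    rw [hS.inner_gradient_smoothPart lam hβ hx, hS.smoothPart_eq lam hβ (hS.dom_subset hx),
      hS.smoothPart_eq lam hβ (hS.dom_subset hz)]
    -- Three sources of curvature: `f` gives `L`; the second-order error of `p`, weighted by the
    -- multiplier, gives the `LDp` term; the `β⁻¹`-smoothness of the approximation along the
    -- Lipschitz map `p` gives `MDp ^ 2 * β⁻¹`.
    have h1 := hT.bregman_le x hx z hz
    change P.fReal z - P.fReal x - inner ℝ (gradient P.fReal x) (z - x) ≤ _ at h1
    rw [norm_sub_rev x z] at h1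
    have h2 := hReal_le_add_inner hS (P.p x) (P.p z) lam hβ
    have h3 := norm_image_sub_sub_fderiv_le hS.convex_dom hS.p_differentiable
      hN.fderiv_lipschitz hx hz
    have h4 := real_inner_le_norm (P.multiplier (P.p x) lam β)
      (P.p z - P.p x - fderiv ℝ P.p x (z - x))
    rw [inner_sub_right] at h4
    have h5 := mul_le_mul (norm_multiplier_le hS hN lam hβ hx) h3 (norm_nonneg _)
      ((norm_nonneg _).trans (norm_multiplier_le hS hN lam hβ hx))
    have h6 : β⁻¹ / 2 * ‖P.p z - P.p x‖ ^ 2 ≤ β⁻¹ / 2 * (c.MDp * ‖z - x‖) ^ 2 := by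
      have := p_lipschitz hS hN hx hz
      gcongr
    rw [innerSmoothness]
    linear_combination h1 + h2 + h4 + h5 + h6

theorem Standing.alReal_eq (hS : P.Standing c xs ls) (y : Vec n) (lam : PairVec d₁ d₂)
    {β : ℝ} (hβ : 0 < β) {x : Vec n} (hx : x ∈ effDom P.g) :
    P.smoothPart lam β x + (P.simplePart y β x).toReal = P.alReal y lam β x := by
  rw [hS.smoothPart_eq lam hβ (hS.dom_subset hx), hS.simplePart_toReal y β hx, alReal]
  ring

theorem Standing.proxAL_eq (hS : P.Standing c xs ls) (y : Vec n) (lam : PairVec d₁ d₂)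
    {β : ℝ} (hβ : 0 < β) {x : Vec n} (hx : x ∈ effDom P.g) :
    P.proxAL y lam β x = (P.alReal y lam β x : EReal) := by
  rw [proxAL, ← hS.coe_fReal (hS.dom_subset hx), ← hS.coe_gReal hx, ← coe_hReal hS _ _ hβ, alReal]
  norm_cast

theorem Standing.alReal_strongConvexOn (hS : P.Standing c xs ls) (y : Vec n)
    (lam : PairVec d₁ d₂) {β : ℝ} (hβ : 0 < β) :
    StrongConvexOn (effDom P.g) (c.μg + β) (P.alReal y lam β) := by
  have h := hS.simplePart_strongConvexOn y β
  rw [effDom_simplePart] at h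
  have h' := h.add_convexOn (hS.smoothPart_convexOn lam hβ)
  refine ⟨h'.1, fun u hu v hv s t hs ht hst => ?_⟩
  have := h'.2 hu hv hs ht hst
  rw [← hS.alReal_eq y lam hβ hu, ← hS.alReal_eq y lam hβ hv,
    ← hS.alReal_eq y lam hβ (h'.1 hu hv hs ht hst)]
  simp only [smul_eq_mul] at this ⊢
  linarith

/-- `smoothPart` is controlled only on the domain of `g`. Its tangent at `xs` is a continuous
minorant there, which yields lower semicontinuity of the whole sum; strong convexity does the rest.
-/
theorem exists_alReal_minimizer (hS : P.Standing c xs ls) (hT : P.SmoothTerm c)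
    (hN : P.NonlinearBounds c) (y : Vec n) (lam : PairVec d₁ d₂) {β : ℝ} (hβ : 0 < β) :
    ∃ z ∈ effDom P.g, ∀ x ∈ effDom P.g, P.alReal y lam β z ≤ P.alReal y lam β x := by
  have hC := isComposite_inner hS hT hN y lam hβ
  have hdom : effDom (fun x => P.simplePart y β x + (P.smoothPart lam β x : EReal)) =
      effDom P.g := by rw [effDom_add_coe, effDom_simplePart]
  have hbot : ∀ x, P.simplePart y β x + (P.smoothPart lam β x : EReal) ≠ ⊥ := fun x => by
    simp only [ne_eq, EReal.add_eq_bot_iff, hC.ne_bot x, EReal.coe_ne_bot, or_self,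
      not_false_eq_true]
  have hreal : ∀ x ∈ effDom P.g,
      (P.simplePart y β x + (P.smoothPart lam β x : EReal)).toReal = P.alReal y lam β x :=
    fun x hx => by
      rw [EReal.toReal_add_coe' (by rw [← effDom_simplePart y β] at hx; exact hx) (hC.ne_bot x),
        ← hS.alReal_eq y lam hβ hx, add_comm]
  have hsc := hS.alReal_strongConvexOn y lam hβ
  have hμ := hS.μg_nonneg
  obtain ⟨z, hz, hmin⟩ := exists_minimizer_of_strongConvexOn hbot
    (hC.closed.add_coe_of_minorant (φ := P.smoothPart lam β)
      (q := fun x => P.smoothPart lam β xs +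
        inner ℝ (gradient (P.smoothPart lam β) xs) (x - xs))
      (fun x hx => by
        rw [effDom_simplePart] at hx
        exact (hS.smoothPart_hasFDerivAt lam hβ hx).continuousAt)
      (by fun_prop)
      (fun x hx => hC.minorant xs (by rw [effDom_simplePart]; exact hS.xs_dom) x hx))
    (by rw [hdom]; exact hS.g_proper) (m := c.μg + β) (by linarith)
    (by
      rw [hdom]
      refine ⟨hsc.1, fun u hu v hv s t hs ht hst => ?_⟩
      simp only
      rw [hreal u hu, hreal v hv, hreal _ (hsc.1 hu hv hs ht hst)]
      exact hsc.2 hu hv hs ht hst)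
  rw [hdom] at hz
  refine ⟨z, hz, fun x hx => ?_⟩
  rw [← hreal z hz, ← hreal x hx]
  refine EReal.toReal_le_toReal (hmin x) (hbot z) ?_
  rw [← hdom] at hx
  exact hx

theorem halvingPeriod_pos (hS : P.Standing c xs ls) (hT : P.SmoothTerm c)
    (hN : P.NonlinearBounds c) (lam : PairVec d₁ d₂) {β : ℝ} (hβ : 0 < β) :
    0 < P.halvingPeriod c lam β := by
  have h1 := innerSmoothness_pos hS hT hN lam hβ
  have h2 := hS.μg_nonneg
  rw [halvingPeriod, Nat.ceil_pos]
  positivity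

theorem innerSolver_mem (hS : P.Standing c xs ls) (hT : P.SmoothTerm c)
    (hN : P.NonlinearBounds c) {θ : ℕ → ℝ} (hθ : IsAPGWeights θ) (y : Vec n)
    (lam : PairVec d₁ d₂) {β : ℝ} (hβ : 0 < β) {x₀ : Vec n} (hx₀ : x₀ ∈ effDom P.g) (k : ℕ) :
    P.innerSolver c θ y lam β x₀ k ∈ effDom P.g := by
  have := (isComposite_inner hS hT hN y lam hβ).apg_mem hθ (P.halvingPeriod c lam β)
    (by rwa [effDom_simplePart]) k
  rwa [effDom_simplePart] at this

/-- The inner solver halves the gap within each period. -/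
theorem innerSolver_gap (hS : P.Standing c xs ls) (hT : P.SmoothTerm c)
    (hN : P.NonlinearBounds c) {θ : ℕ → ℝ} (hθ : IsAPGWeights θ) (y : Vec n)
    (lam : PairVec d₁ d₂) {β : ℝ} (hβ : 0 < β) {x₀ z : Vec n} (hx₀ : x₀ ∈ effDom P.g)
    (hz : z ∈ effDom P.g) (hmin : ∀ x ∈ effDom P.g, P.alReal y lam β z ≤ P.alReal y lam β x)
    (j : ℕ) :
    2 ^ j * (P.alReal y lam β (P.innerSolver c θ y lam β x₀ (j * P.halvingPeriod c lam β)) -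
      P.alReal y lam β z) ≤ P.alReal y lam β x₀ - P.alReal y lam β z := by
  have hC := isComposite_inner hS hT hN y lam hβ
  have hμ := hS.μg_nonneg
  have hmem := innerSolver_mem hS hT hN hθ y lam hβ hx₀ (j * P.halvingPeriod c lam β)
  have hg : ∀ x ∈ effDom P.g, P.alReal y lam β z + (c.μg + β) / 2 * ‖x - z‖ ^ 2 ≤
      P.alReal y lam β x := fun x hx =>
    (hS.alReal_strongConvexOn y lam hβ).growth hz hmin hx
  have := hC.apg_gap hθ (K := P.halvingPeriod c lam β) (by linarith) (Nat.le_ceil _) (x₀ := x₀)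
    (by rwa [effDom_simplePart]) (x := z) (by rwa [effDom_simplePart])
    (fun x hx => by
      rw [effDom_simplePart] at hx
      rw [hS.alReal_eq y lam hβ hz, hS.alReal_eq y lam hβ hx]
      exact hmin x hx)
    (fun x hx => by
      rw [effDom_simplePart] at hx
      rw [hS.alReal_eq y lam hβ hz, hS.alReal_eq y lam hβ hx]
      exact hg x hx) j
  rw [hS.alReal_eq y lam hβ hz, hS.alReal_eq y lam hβ hx₀] at this
  rw [← hS.alReal_eq y lam hβ hmem]
  exact this

end CompositeProblem

/-! ### One outer iteration -/

namespace CompositeProblem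

variable {n d₁ d₂ : ℕ} {P : CompositeProblem n d₁ d₂} {c : ProblemConstants} {xs : Vec n}
  {ls : PairVec d₁ d₂}

/-- The minimizer of the proximal augmented Lagrangian and its multiplier form a saddle point. -/
theorem alReal_saddle (hS : P.Standing c xs ls) (hN : P.NonlinearBounds c) (y : Vec n)
    (lam : PairVec d₁ d₂) {β : ℝ} (hβ : 0 < β) {z : Vec n} (hz : z ∈ effDom P.g)
    (hmin : ∀ x ∈ effDom P.g, P.alReal y lam β z ≤ P.alReal y lam β x) {x : Vec n}
    (hx : x ∈ effDom P.g) :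
    P.alReal y lam β z + β / 2 * ‖x - z‖ ^ 2 ≤
      P.fReal x + P.gReal x + inner ℝ (P.multiplier (P.p z) lam β) (P.p x)
        - P.conj (P.multiplier (P.p z) lam β)
        - β / 2 * ‖P.multiplier (P.p z) lam β - lam‖ ^ 2 + β / 2 * ‖x - y‖ ^ 2 := by
  have hsub := multiplier_isSubgrad hS (P.p z) lam hβ
  have hz_eq : P.alReal y lam β z = P.fReal z + P.gReal z + (inner ℝ (P.multiplier (P.p z) lam β)
      (P.p z) - P.conj (P.multiplier (P.p z) lam β)
      - β / 2 * ‖P.multiplier (P.p z) lam β - lam‖ ^ 2) + β / 2 * ‖z - y‖ ^ 2 := by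
    rw [alReal, hReal_eq hS (P.p z) lam hβ]
  have hup := fun x' => hReal_le_add_inner hS (P.p z) (P.p x') lam hβ
  set v := P.multiplier (P.p z) lam β
  have hsc : StrongConvexOn (effDom P.g) (c.μg + β)
      fun x => P.gReal x + P.fReal x + β / 2 * ‖x - y‖ ^ 2 :=
    (StrongConvexOn.add_convexOn hS.g_convex hS.fReal_convexOn).add_sq y β
  -- Optimality of `z` in the direction of `x`: the approximation is replaced by its quadratic
  -- majorant at `p z`, whose linear part `⟨v, p(·)⟩` is convex along the segment since `v` is a
  -- subgradient. All quadratic remainders go into `B`.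
  have key : 0 ≤ (P.gReal x + P.fReal x + β / 2 * ‖x - y‖ ^ 2)
      - (P.gReal z + P.fReal z + β / 2 * ‖z - y‖ ^ 2) - (c.μg + β) / 2 * ‖z - x‖ ^ 2
      + (inner ℝ v (P.p x) - inner ℝ v (P.p z)) := by
    refine nonneg_of_forall_linear_add_quadratic
      (B := (c.μg + β) / 2 * ‖z - x‖ ^ 2 + β⁻¹ / 2 * (c.MDp * ‖x - z‖) ^ 2) fun t ht0 ht1 => ?_
    have hmem := hsc.1 hz hx (sub_nonneg.2 ht1.le) ht0.le (by ring)
    have h1 := hsc.segment_le hz hx ht0.le ht1.le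
    have h2 := hmin _ hmem
    have h3 := hup ((1 - t) • z + t • x)
    have h4 := hsub.inner_p_le hS x z ht0 ht1
    rw [add_comm (t • x)] at h4
    have h5 := p_lipschitz hS hN hz hmem
    rw [show (1 - t) • z + t • x - z = t • (x - z) by module, norm_smul,
      Real.norm_of_nonneg ht0.le] at h5
    have h6 : β⁻¹ / 2 * ‖P.p ((1 - t) • z + t • x) - P.p z‖ ^ 2 ≤
        β⁻¹ / 2 * (c.MDp * (t * ‖x - z‖)) ^ 2 := by gcongr
    rw [inner_sub_right] at h3
    simp only [alReal] at h2
    linear_combination h1 + h2 + h3 + h4 + h6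
  have hμ : 0 ≤ c.μg / 2 * ‖x - z‖ ^ 2 := by
    have := hS.μg_nonneg
    positivity
  rw [norm_sub_rev z x] at key
  linarith

/-- Quadratic growth in the primal and dual variables. -/
theorem alReal_growth (hS : P.Standing c xs ls) (hN : P.NonlinearBounds c) (y : Vec n)
    (lam : PairVec d₁ d₂) {β : ℝ} (hβ : 0 < β) {z : Vec n} (hz : z ∈ effDom P.g)
    (hmin : ∀ x ∈ effDom P.g, P.alReal y lam β z ≤ P.alReal y lam β x) {x : Vec n}
    (hx : x ∈ effDom P.g) :
    P.alReal y lam β z + β / 2 * (‖x - z‖ ^ 2 +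
      ‖P.multiplier (P.p x) lam β - P.multiplier (P.p z) lam β‖ ^ 2) ≤ P.alReal y lam β x := by
  have h1 := alReal_saddle hS hN y lam hβ hz hmin hx
  -- The multiplier of `z` competes in the dual maximization at `x`; strong concavity supplies the
  -- second square.
  have h2 := le_hReal hS (P.p x) lam hβ (multiplier_isSubgrad hS (P.p z) lam hβ).mem_effDom
  rw [norm_sub_rev (P.multiplier (P.p z) lam β) (P.multiplier (P.p x) lam β)] at h2
  rw [alReal.eq_1 P y lam β x]
  linarith

theorem Standing.F_eq (hS : P.Standing c xs ls) {x : Vec n} (hx : x ∈ effDom P.g) :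
    P.F x = ((P.fReal x + P.gReal x + P.h₁ (P.p₁ x) : ℝ) : EReal) := by
  rw [F, ← hS.coe_fReal (hS.dom_subset hx), ← hS.coe_gReal hx]
  norm_cast

theorem Standing.lagrangian_eq (hS : P.Standing c xs ls) {x : Vec n} (hx : x ∈ effDom P.g)
    {v : PairVec d₁ d₂} (hv : v ∈ effDom (fenchelConj P.h)) :
    P.lagrangian x v = ((P.fReal x + P.gReal x + inner ℝ v (P.p x) - P.conj v : ℝ) : EReal) := by
  rw [lagrangian, ← hS.coe_fReal (hS.dom_subset hx), ← hS.coe_gReal hx, ← coe_conj hS hv]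
  norm_cast

/-- Optimality of the dual solution. -/
theorem Standing.F_le_lagrangian (hS : P.Standing c xs ls) {x : Vec n} (hx : x ∈ effDom P.g) :
    P.fReal xs + P.gReal xs + P.h₁ (P.p₁ xs) ≤
      P.fReal x + P.gReal x + inner ℝ ls (P.p x) - P.conj ls := by
  rw [← EReal.coe_le_coe_iff, ← hS.F_eq hS.xs_dom, ← hS.lagrangian_eq hx hS.ls_dom, hS.saddle,
    hS.strong_duality]
  exact iInf_le _ x

/-- The exact proximal step is firmly nonexpansive towards the primal-dual solution. -/
theorem alReal_fejer (hS : P.Standing c xs ls) (hN : P.NonlinearBounds c) (y : Vec n)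
    (lam : PairVec d₁ d₂) {β : ℝ} (hβ : 0 < β) {z : Vec n} (hz : z ∈ effDom P.g)
    (hmin : ∀ x ∈ effDom P.g, P.alReal y lam β z ≤ P.alReal y lam β x) :
    ‖z - xs‖ ^ 2 + ‖P.multiplier (P.p z) lam β - ls‖ ^ 2 +
      (‖z - y‖ ^ 2 + ‖P.multiplier (P.p z) lam β - lam‖ ^ 2) ≤
      ‖y - xs‖ ^ 2 + ‖lam - ls‖ ^ 2 := by
  have h1 := alReal_saddle hS hN y lam hβ hz hmin hS.xs_dom
  have h2 := le_hReal hS (P.p z) lam hβ hS.ls_dom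
  have h3 := hS.F_le_lagrangian hz
  have h4 : inner ℝ (P.multiplier (P.p z) lam β) (P.p xs) - P.h₁ (P.p₁ xs) ≤
      P.conj (P.multiplier (P.p z) lam β) :=
    inner_sub_le_conj hS (multiplier_isSubgrad hS (P.p z) lam hβ).mem_effDom hS.xs_feasible
  rw [norm_sub_rev ls, norm_sub_rev ls] at h2
  rw [norm_sub_rev xs, norm_sub_rev xs] at h1
  rw [alReal.eq_1] at h1
  -- With `v` the multiplier of `z`, add the saddle inequality at `xs`, dual growth at `ls`, and
  -- `L(xs; v) ≤ F(xs) ≤ L(z; ls)`: all function values cancel and only squares remain.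
  have h5 : β / 2 * (‖z - xs‖ ^ 2 + ‖P.multiplier (P.p z) lam β - ls‖ ^ 2 +
      (‖z - y‖ ^ 2 + ‖P.multiplier (P.p z) lam β - lam‖ ^ 2)) ≤
      β / 2 * (‖y - xs‖ ^ 2 + ‖lam - ls‖ ^ 2) := by
    linarith
  exact le_of_mul_le_mul_left h5 (by positivity)

theorem norm_sub_sq_le_two {V : Type*} [NormedAddCommGroup V] [InnerProductSpace ℝ V]
    (u v w : V) : ‖u - w‖ ^ 2 ≤ 2 * ‖u - v‖ ^ 2 + 2 * ‖v - w‖ ^ 2 := by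
  have h := norm_sub_le_norm_sub_add_norm_sub u v w
  nlinarith [sq_nonneg (‖u - v‖ - ‖v - w‖), norm_nonneg (u - w), norm_nonneg (u - v),
    norm_nonneg (v - w)]

theorem errorTerm_nonneg {Lh₁ : ℝ} {y x : Vec n} {lam lam' : PairVec d₁ d₂} {β β' : ℝ}
    (hβ : 0 < β) (h1 : β' ≤ β) (h2 : β < 2 * β') :
    0 ≤ errorTerm P Lh₁ y x lam lam' β β' := by
  have := sub_nonneg.2 h1
  have := sub_pos.2 h2
  rw [errorTerm]
  positivity

/-- The gap at the start of the next inner problem. -/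
theorem alReal_warm_start (hS : P.Standing c xs ls) (hN : P.NonlinearBounds c) (y : Vec n)
    (lam : PairVec d₁ d₂) {β β' ε : ℝ} (hβ : 0 < β) (hβ' : 0 < β') (hle : β' ≤ β)
    (hlt : β < 2 * β') {z : Vec n} (hz : z ∈ effDom P.g)
    (hmin : ∀ x ∈ effDom P.g, P.alReal y lam β z ≤ P.alReal y lam β x) {x₁ : Vec n}
    (hx₁ : x₁ ∈ effDom P.g) (hε : P.alReal y lam β x₁ ≤ P.alReal y lam β z + ε)
    {lam' : PairVec d₁ d₂} (hlam' : lam' = P.multiplier (P.p x₁) lam β) {x : Vec n}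
    (hx : x ∈ effDom P.g) :
    P.alReal x₁ lam' β' x₁ - P.alReal x₁ lam' β' x ≤
      2 * ε + errorTerm P c.Lh₁ y x₁ lam lam' β β' := by
  have hv := (multiplier_isSubgrad hS (P.p z) lam hβ).mem_effDom
  -- The multiplier `v` of `z` links the two problems: `h1` bounds the old optimum through the
  -- Lagrangian at `(x, v)`, and `h3` compares that with the new objective at `x`. Through `w`, `h4`
  -- and `h5` compare the objectives at `x₁`. One `ε` is the inexactness of `x₁`; the other comes
  -- from `h2` and pays for `‖x₁ - z‖ ^ 2` and `‖lam' - v‖ ^ 2`.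
  have h1 := alReal_saddle hS hN y lam hβ hz hmin hx
  have h2 := alReal_growth hS hN y lam hβ hz hmin hx₁
  have h3 := le_hReal hS (P.p x) lam' hβ' hv
  have h4 := le_hReal hS (P.p x₁) lam hβ
    (multiplier_isSubgrad hS (P.p x₁) lam' hβ').mem_effDom
  have h5 := hReal_eq hS (P.p x₁) lam' hβ'
  rw [← hlam'] at h2 h4
  set v := P.multiplier (P.p z) lam β
  set w := P.multiplier (P.p x₁) lam' β'
  have h6 := norm_sub_sq_le_two w lam' lam
  have h7 := norm_sub_sq_le_two x z x₁
  have h8 : ‖x - y‖ ^ 2 = ‖x - x₁‖ ^ 2 + 2 * inner ℝ (x - x₁) (x₁ - y) + ‖x₁ - y‖ ^ 2 := by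
    rw [← norm_add_sq_real, sub_add_sub_cancel]
  -- Once `h7` has been used with weight `β / 4`, the new proximal term leaves `(2 * β' - β) / 4` to
  -- absorb the cross term. For `β' = ρ β` its positivity is the condition `ρ > 1/2`.
  have h9 : β * ‖x - x₁‖ * ‖x₁ - y‖ ≤
      (2 * β' - β) / 4 * ‖x - x₁‖ ^ 2 + β ^ 2 / (2 * β' - β) * ‖x₁ - y‖ ^ 2 := by
    have hpos : 0 < 2 * β' - β := by linarith
    have : 0 ≤ (2 * β' - β) / 4 * (‖x - x₁‖ - 2 * β / (2 * β' - β) * ‖x₁ - y‖) ^ 2 := by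
      positivity
    have e : (2 * β' - β) / 4 * (‖x - x₁‖ - 2 * β / (2 * β' - β) * ‖x₁ - y‖) ^ 2 =
        (2 * β' - β) / 4 * ‖x - x₁‖ ^ 2 + β ^ 2 / (2 * β' - β) * ‖x₁ - y‖ ^ 2
          - β * ‖x - x₁‖ * ‖x₁ - y‖ := by
      field_simp
      ring
    linarith
  have h10 := real_inner_le_norm (x - x₁) (x₁ - y)
  -- The last summand of `M_s` enters only through its sign.
  have h11 : 0 ≤ ‖lam' - lam‖ * √(((β + β') * c.Lh₁ + ‖β • lam.fst - β' • lam'.fst‖) ^ 2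
        + ‖β • lam.snd - β' • lam'.snd‖ ^ 2) := by positivity
  have h13 : 0 ≤ β / 2 * ‖v - lam‖ ^ 2 := by positivity
  have h14 : β' / 2 * ‖v - lam'‖ ^ 2 ≤ β / 2 * ‖lam' - v‖ ^ 2 := by
    rw [norm_sub_rev lam' v]; gcongr
  have h15 := mul_le_mul_of_nonneg_left h6 (by positivity : 0 ≤ β / 2)
  have h16 := mul_le_mul_of_nonneg_left h7 (by positivity : 0 ≤ β / 4)
  have h17 := mul_le_mul_of_nonneg_left h10 hβ.le
  have h18 : 0 ≤ β' / 2 * ‖v - P.multiplier (P.p x) lam' β'‖ ^ 2 := by positivity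
  rw [norm_sub_rev z x₁] at h16
  rw [errorTerm, norm_sub_rev y x₁, show P.multiplier (P.p x₁) lam' β' = w from rfl]
  rw [h8] at h1
  simp only [alReal, sub_self, norm_zero] at *
  linarith

end CompositeProblem

/-! ### The outer iteration -/

namespace IPALMParams

variable {a : IPALMParams}

theorem Valid.ρ_pos (ha : a.Valid) : 0 < a.ρ := by linarith [ha.ρ_gt]

theorem Valid.η_lt_one (ha : a.Valid) : a.η < 1 := ha.η_lt.trans ha.ρ_lt

theorem Valid.β_pos (ha : a.Valid) (s : ℕ) : 0 < a.β s := by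
  have := ha.β₀_pos
  have := ha.ρ_pos
  rw [β]; positivity

theorem Valid.ε_pos (ha : a.Valid) (s : ℕ) : 0 < a.ε s := by
  have := ha.ε₀_pos
  have := ha.η_pos
  rw [ε]; positivity

theorem β_succ (s : ℕ) : a.β (s + 1) = a.ρ * a.β s := by rw [β, β, pow_succ]; ring

theorem ε_succ (s : ℕ) : a.ε (s + 1) = a.η * a.ε s := by rw [ε, ε, pow_succ]; ring

theorem Valid.β_succ_le (ha : a.Valid) (s : ℕ) : a.β (s + 1) ≤ a.β s := by
  rw [β_succ]
  nlinarith [ha.β_pos s, ha.ρ_lt]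

theorem Valid.β_lt_two_mul (ha : a.Valid) (s : ℕ) : a.β s < 2 * a.β (s + 1) := by
  rw [β_succ]
  nlinarith [ha.β_pos s, ha.ρ_gt]

theorem Valid.β_le (ha : a.Valid) (s : ℕ) : a.β s ≤ a.β₀ := by
  have := pow_le_one₀ (n := s) ha.ρ_pos.le ha.ρ_lt.le
  rw [β]
  nlinarith [ha.β₀_pos]

/-- The square root of `η / ρ`, the decay rate of the error of the proximal steps. -/
def rate (a : IPALMParams) : ℝ := √(a.η / a.ρ)

theorem Valid.rate_nonneg (_ : a.Valid) : 0 ≤ a.rate := Real.sqrt_nonneg _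

theorem Valid.rate_lt_one (ha : a.Valid) : a.rate < 1 := by
  rw [rate, Real.sqrt_lt' one_pos, one_pow, div_lt_one ha.ρ_pos]
  exact ha.η_lt

/-- A bound for the distance of the `s`-th iterate to the exact proximal point. -/
def stepError (a : IPALMParams) (s : ℕ) : ℝ := 2 * √(a.ε₀ / a.β₀) * a.rate ^ s

theorem Valid.stepError_nonneg (ha : a.Valid) (s : ℕ) : 0 ≤ a.stepError s := by
  have := ha.rate_nonneg
  rw [stepError]; positivity

/-- Quadratic growth bounds the squared distance to the exact step by `2 ε_s / β_s`, which the
factor `4` dominates. -/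
theorem Valid.stepError_sq (ha : a.Valid) (s : ℕ) : a.stepError s ^ 2 = 4 * (a.ε s / a.β s) := by
  have h1 := ha.ε₀_pos
  have h2 := ha.β₀_pos
  have h3 := ha.ρ_pos
  have h4 := ha.η_pos
  rw [stepError, mul_pow, mul_pow, Real.sq_sqrt (by positivity), ← pow_mul, mul_comm s 2, pow_mul,
    rate, Real.sq_sqrt (by positivity), div_pow, ε, β]
  field_simp
  norm_num

end IPALMParams

/-- The stopping rule of the inner loop stops at the end of a period. -/
theorem exists_eq_mul_of_isLeast {A B : ℝ} {K k : ℕ} (hK : 0 < K) (hAB : B < A)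
    (h : IsLeast {k : ℕ | 0 < k ∧ A ≤ 2 ^ (k / K) * B} k) :
    ∃ j, k = (j + 1) * K ∧ A ≤ 2 ^ (j + 1) * B ∧ 2 ^ j * B < A := by
  obtain ⟨⟨hk, hA⟩, hmin⟩ := h
  obtain ⟨j, hj⟩ : ∃ j, k / K = j + 1 := by
    refine Nat.exists_eq_succ_of_ne_zero fun h0 => ?_
    rw [h0, pow_zero, one_mul] at hA
    linarith
  rw [hj] at hA
  have hkj : k = (j + 1) * K := by
    refine le_antisymm (hmin ⟨by positivity, ?_⟩) ?_
    · rwa [Nat.mul_div_cancel _ hK]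
    · rw [← hj]; exact Nat.div_mul_le_self k K
  -- By minimality `j` periods do not suffice. For `j = 0` the competitor `0` is not admissible, and
  -- `hAB` takes its place.
  refine ⟨j, hkj, hA, ?_⟩
  rcases Nat.eq_zero_or_pos j with rfl | hj0
  · simpa using hAB
  · by_contra hcon
    have := hmin (a := j * K) ⟨by positivity, by rw [Nat.mul_div_cancel _ hK]; linarith⟩
    rw [hkj] at this
    nlinarith

theorem WithLp.norm_fst_le_norm {V W : Type*} [NormedAddCommGroup V] [NormedAddCommGroup W]
    (v : WithLp 2 (V × W)) : ‖v.fst‖ ≤ ‖v‖ := by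
  refine abs_le_of_sq_le_sq' ?_ (norm_nonneg _) |>.2
  rw [WithLp.prod_norm_sq_eq_of_L2]
  linarith [sq_nonneg ‖v.snd‖]

theorem WithLp.norm_snd_le_norm {V W : Type*} [NormedAddCommGroup V] [NormedAddCommGroup W]
    (v : WithLp 2 (V × W)) : ‖v.snd‖ ≤ ‖v‖ := by
  refine abs_le_of_sq_le_sq' ?_ (norm_nonneg _) |>.2
  rw [WithLp.prod_norm_sq_eq_of_L2]
  linarith [sq_nonneg ‖v.fst‖]

theorem WithLp.norm_toLp_sub_sq {V W : Type*} [NormedAddCommGroup V] [NormedAddCommGroup W]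
    (x y : V) (u w : W) :
    ‖WithLp.toLp 2 (x, u) - WithLp.toLp 2 (y, w)‖ ^ 2 = ‖x - y‖ ^ 2 + ‖u - w‖ ^ 2 := by
  rw [WithLp.prod_norm_sq_eq_of_L2]
  rfl

section Run

open CompositeProblem

variable {n d₁ d₂ : ℕ} {P : CompositeProblem n d₁ d₂} {c : ProblemConstants} {xs : Vec n}
  {ls : PairVec d₁ d₂} {θ : ℕ → ℝ} {a : IPALMParams} {X : ℕ → Vec n} {lam : ℕ → PairVec d₁ d₂}
  {m : ℕ → ℕ}

namespace IsIPALMRun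

/-- Since `M_s ≥ 0` and `η < 1`, the required reduction exceeds one, so at least one full period is
run. Minimality supplies the reverse inequality from which the periods are counted. -/
theorem m_succ (hR : IsIPALMRun P c θ a X lam m) (hS : P.Standing c xs ls) (hT : P.SmoothTerm c)
    (hN : P.NonlinearBounds c) (ha : a.Valid) (s : ℕ) :
    ∃ j, m (s + 1) = (j + 1) * P.halvingPeriod c (lam (s + 1)) (a.β (s + 1)) ∧
      2 * a.ε s + errorTerm P c.Lh₁ (X s) (X (s + 1)) (lam s) (lam (s + 1)) (a.β s) (a.β (s + 1)) ≤
        2 ^ (j + 1) * (a.ε (s + 1) / 2) ∧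
      2 ^ j * (a.ε (s + 1) / 2) < 2 * a.ε s +
        errorTerm P c.Lh₁ (X s) (X (s + 1)) (lam s) (lam (s + 1)) (a.β s) (a.β (s + 1)) := by
  refine exists_eq_mul_of_isLeast (halvingPeriod_pos hS hT hN _ (ha.β_pos _)) ?_ (hR.m_step s)
  have h1 := errorTerm_nonneg (P := P) (Lh₁ := c.Lh₁) (y := X s) (x := X (s + 1)) (lam := lam s)
    (lam' := lam (s + 1)) (ha.β_pos s) (ha.β_succ_le s) (ha.β_lt_two_mul s)
  rw [a.ε_succ]
  nlinarith [ha.ε_pos s, ha.η_lt_one]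

theorem x_mem (hR : IsIPALMRun P c θ a X lam m) (hS : P.Standing c xs ls) (hT : P.SmoothTerm c)
    (hN : P.NonlinearBounds c) (hθ : IsAPGWeights θ) (ha : a.Valid) (s : ℕ) :
    X s ∈ effDom P.g := by
  induction s with
  | zero => exact hR.x_init
  | succ s ih =>
    rw [hR.x_step s]
    exact innerSolver_mem hS hT hN hθ _ _ (ha.β_pos s) ih _

/-- Each inner problem is solved to the prescribed accuracy. -/
theorem gap_le (hR : IsIPALMRun P c θ a X lam m) (hS : P.Standing c xs ls) (hT : P.SmoothTerm c)
    (hN : P.NonlinearBounds c) (hθ : IsAPGWeights θ) (ha : a.Valid) (s : ℕ) :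
    ∀ x ∈ effDom P.g, P.alReal (X s) (lam s) (a.β s) (X (s + 1)) ≤
      P.alReal (X s) (lam s) (a.β s) x + a.ε s := by
  induction s with
  | zero =>
    intro x hx
    have h1 := hR.ε_init.trans (add_le_add_left (iInf_le _ x) _)
    have hX1 := hR.x_mem hS hT hN hθ ha 1
    rw [hS.proxAL_eq _ _ (ha.β_pos 0) hx, hS.proxAL_eq _ _ (ha.β_pos 0) hX1, ← EReal.coe_add,
      EReal.coe_le_coe_iff] at h1
    simpa [IPALMParams.ε] using h1
  | succ s ih =>
    intro x hx
    have hXs := hR.x_mem hS hT hN hθ ha (s + 1)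
    obtain ⟨z, hz, hmin⟩ := exists_alReal_minimizer hS hT hN (X s) (lam s) (ha.β_pos s)
    obtain ⟨z', hz', hmin'⟩ :=
      exists_alReal_minimizer hS hT hN (X (s + 1)) (lam (s + 1)) (ha.β_pos (s + 1))
    -- The initial gap is at most `2 ε_s + M_s`, and the `j + 1` halvings bring it down to `ε_{s+1}
    -- / 2`.
    have h1 := alReal_warm_start hS hN (X s) (lam s) (ha.β_pos s) (ha.β_pos (s + 1))
      (ha.β_succ_le s) (ha.β_lt_two_mul s) hz hmin hXs (ih z hz) (hR.lam_step s) hz'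
    obtain ⟨j, hj, hA, -⟩ := hR.m_succ hS hT hN ha s
    have h2 := innerSolver_gap hS hT hN hθ (X (s + 1)) (lam (s + 1)) (ha.β_pos (s + 1)) hXs hz'
      hmin' (j + 1)
    rw [← hj, ← hR.x_step (s + 1)] at h2
    have h3 := le_of_mul_le_mul_left ((h2.trans h1).trans hA) (by positivity)
    have h4 := hmin' x hx
    linarith [ha.ε_pos (s + 1)]

/-- The step is an inexact step of a firmly nonexpansive map fixing the primal-dual solution. -/
theorem exists_proximal_point (hR : IsIPALMRun P c θ a X lam m) (hS : P.Standing c xs ls)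
    (hT : P.SmoothTerm c) (hN : P.NonlinearBounds c) (hθ : IsAPGWeights θ) (ha : a.Valid)
    (s : ℕ) : ∃ v : WithLp 2 (Vec n × PairVec d₁ d₂),
      ‖v - WithLp.toLp 2 (xs, ls)‖ ≤ ‖WithLp.toLp 2 (X s, lam s) - WithLp.toLp 2 (xs, ls)‖ ∧
      ‖v - WithLp.toLp 2 (X s, lam s)‖ ≤
        ‖WithLp.toLp 2 (X s, lam s) - WithLp.toLp 2 (xs, ls)‖ ∧
      ‖WithLp.toLp 2 (X (s + 1), lam (s + 1)) - v‖ ≤ a.stepError s := by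
  obtain ⟨z, hz, hmin⟩ := exists_alReal_minimizer hS hT hN (X s) (lam s) (ha.β_pos s)
  have hXs := hR.x_mem hS hT hN hθ ha (s + 1)
  have h1 := alReal_fejer hS hN (X s) (lam s) (ha.β_pos s) hz hmin
  have h2 := alReal_growth hS hN (X s) (lam s) (ha.β_pos s) hz hmin hXs
  have h3 := hR.gap_le hS hT hN hθ ha s z hz
  rw [← hR.lam_step s] at h2
  refine ⟨WithLp.toLp 2 (z, P.multiplier (P.p z) (lam s) (a.β s)), ?_, ?_, ?_⟩
  · refine abs_le_of_sq_le_sq' ?_ (norm_nonneg _) |>.2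
    rw [WithLp.norm_toLp_sub_sq z xs _ ls, WithLp.norm_toLp_sub_sq (X s) xs (lam s) ls]
    nlinarith [sq_nonneg ‖z - X s‖, sq_nonneg ‖P.multiplier (P.p z) (lam s) (a.β s) - lam s‖]
  · refine abs_le_of_sq_le_sq' ?_ (norm_nonneg _) |>.2
    rw [WithLp.norm_toLp_sub_sq z (X s) _ (lam s), WithLp.norm_toLp_sub_sq (X s) xs (lam s) ls]
    nlinarith [sq_nonneg ‖z - xs‖, sq_nonneg ‖P.multiplier (P.p z) (lam s) (a.β s) - ls‖]
  · refine abs_le_of_sq_le_sq' ?_ (ha.stepError_nonneg s) |>.2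
    rw [WithLp.norm_toLp_sub_sq, ha.stepError_sq]
    have h4 : a.β s / 2 * (‖X (s + 1) - z‖ ^ 2 +
        ‖lam (s + 1) - P.multiplier (P.p z) (lam s) (a.β s)‖ ^ 2) ≤ a.ε s := by linarith
    have hβ := ha.β_pos s
    have hε := ha.ε_pos s
    rw [← mul_div_assoc, le_div_iff₀ hβ]
    linarith

/-- The radius of a ball around the primal-dual solution that contains all iterates. -/
def _root_.runRadius (a : IPALMParams) (x₀ xs : Vec n) (lam₀ ls : PairVec d₁ d₂) : ℝ :=
  √(‖x₀ - xs‖ ^ 2 + ‖lam₀ - ls‖ ^ 2) + 2 * √(a.ε₀ / a.β₀) / (1 - √(a.η / a.ρ))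

/-- The distance to the solution plus the geometric sum of all errors still to come is
nonincreasing: the exact step does not move away, and the inexact one spends one term of the tail.
-/
theorem norm_sub_add_tail_le (hR : IsIPALMRun P c θ a X lam m) (hS : P.Standing c xs ls)
    (hT : P.SmoothTerm c) (hN : P.NonlinearBounds c) (hθ : IsAPGWeights θ) (ha : a.Valid)
    (s : ℕ) :
    ‖WithLp.toLp 2 (X s, lam s) - WithLp.toLp 2 (xs, ls)‖ + a.stepError s / (1 - a.rate) ≤
      runRadius a (X 0) xs (lam 0) ls := by
  induction s with
  | zero =>
    rw [runRadius, IPALMParams.stepError, pow_zero, mul_one]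
    refine add_le_add (Real.le_sqrt_of_sq_le ?_) le_rfl
    rw [WithLp.norm_toLp_sub_sq]
  | succ s ih =>
    refine le_trans ?_ ih
    obtain ⟨v, h1, -, h3⟩ := hR.exists_proximal_point hS hT hN hθ ha s
    have h4 := norm_sub_le_norm_sub_add_norm_sub (WithLp.toLp 2 (X (s + 1), lam (s + 1))) v
      (WithLp.toLp 2 (xs, ls))
    have h5 : a.stepError s / (1 - a.rate) =
        a.stepError s + a.stepError (s + 1) / (1 - a.rate) := by
      have := sub_pos.2 ha.rate_lt_one
      rw [IPALMParams.stepError, IPALMParams.stepError, pow_succ]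
      field_simp
      ring
    linarith

theorem norm_sub_le (hR : IsIPALMRun P c θ a X lam m) (hS : P.Standing c xs ls)
    (hT : P.SmoothTerm c) (hN : P.NonlinearBounds c) (hθ : IsAPGWeights θ) (ha : a.Valid)
    (s : ℕ) :
    ‖WithLp.toLp 2 (X s, lam s) - WithLp.toLp 2 (xs, ls)‖ ≤ runRadius a (X 0) xs (lam 0) ls := by
  have h1 := hR.norm_sub_add_tail_le hS hT hN hθ ha s
  have h2 := div_nonneg (ha.stepError_nonneg s) (sub_pos.2 ha.rate_lt_one).le
  linarith

/-- An exact step is no longer than the distance to the solution, and its error is part of the tail,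
so the same radius suffices. -/
theorem norm_succ_sub_le (hR : IsIPALMRun P c θ a X lam m) (hS : P.Standing c xs ls)
    (hT : P.SmoothTerm c) (hN : P.NonlinearBounds c) (hθ : IsAPGWeights θ) (ha : a.Valid)
    (s : ℕ) :
    ‖WithLp.toLp 2 (X (s + 1), lam (s + 1)) - WithLp.toLp 2 (X s, lam s)‖ ≤
      runRadius a (X 0) xs (lam 0) ls := by
  have h1 := hR.norm_sub_add_tail_le hS hT hN hθ ha s
  obtain ⟨v, -, h2, h3⟩ := hR.exists_proximal_point hS hT hN hθ ha s
  have h4 := norm_sub_le_norm_sub_add_norm_sub (WithLp.toLp 2 (X (s + 1), lam (s + 1))) v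
    (WithLp.toLp 2 (X s, lam s))
  have h5 : a.stepError s ≤ a.stepError s / (1 - a.rate) := by
    rw [le_div_iff₀ (sub_pos.2 ha.rate_lt_one)]
    nlinarith [ha.stepError_nonneg s, ha.rate_nonneg]
  linarith

end IsIPALMRun

theorem boundC₀_eq (x₀ : Vec n) (lam₀ : PairVec d₁ d₂) : boundC₀ a x₀ xs lam₀ ls =
    2 * runRadius a x₀ xs lam₀ ls ^ 2 + 2 * ‖ls‖ ^ 2 + 2 * ‖xs‖ ^ 2 := rfl

theorem boundC₀_nonneg (x₀ : Vec n) (lam₀ : PairVec d₁ d₂) : 0 ≤ boundC₀ a x₀ xs lam₀ ls := by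
  rw [boundC₀]; positivity

namespace IsIPALMRun

/-- The iterates are bounded in terms of `c₀`. -/
theorem bounds (hR : IsIPALMRun P c θ a X lam m) (hS : P.Standing c xs ls)
    (hT : P.SmoothTerm c) (hN : P.NonlinearBounds c) (hθ : IsAPGWeights θ) (ha : a.Valid)
    (s : ℕ) :
    ‖lam s‖ ≤ √(boundC₀ a (X 0) xs (lam 0) ls) ∧
    ‖lam (s + 1) - lam s‖ ≤ √(boundC₀ a (X 0) xs (lam 0) ls) ∧
    ‖X (s + 1) - X s‖ ≤ √(boundC₀ a (X 0) xs (lam 0) ls) ∧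
    ‖X s - xs‖ ≤ √(boundC₀ a (X 0) xs (lam 0) ls) := by
  have h1 := hR.norm_sub_le hS hT hN hθ ha s
  have h2 := hR.norm_succ_sub_le hS hT hN hθ ha s
  have h0 := boundC₀_eq (a := a) (xs := xs) (ls := ls) (X 0) (lam 0)
  set R := runRadius a (X 0) xs (lam 0) ls
  have hRle : R ≤ √(boundC₀ a (X 0) xs (lam 0) ls) := by
    refine Real.le_sqrt_of_sq_le ?_
    nlinarith [sq_nonneg R, sq_nonneg ‖ls‖, sq_nonneg ‖xs‖]
  refine ⟨?_, ?_, ?_, ?_⟩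
  · have h3 : ‖lam s - ls‖ ≤ R := (WithLp.norm_snd_le_norm _).trans h1
    refine Real.le_sqrt_of_sq_le ?_
    have h4 := norm_sub_sq_le_two (lam s) ls 0
    rw [sub_zero, sub_zero] at h4
    have h5 : ‖lam s - ls‖ ^ 2 ≤ R ^ 2 := by gcongr
    nlinarith [sq_nonneg ‖xs‖]
  · exact ((WithLp.norm_snd_le_norm _).trans h2).trans hRle
  · exact ((WithLp.norm_fst_le_norm _).trans h2).trans hRle
  · exact ((WithLp.norm_fst_le_norm _).trans h1).trans hRle

end IsIPALMRun

/-! ### Accuracy of the iterates -/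

namespace CompositeProblem

/-- Weak duality with `ls` bounds feasible values below by the value at `xs`; at other points the
objective is `⊤`. -/
theorem optVal_eq (hS : P.Standing c xs ls) :
    P.optVal = ((P.fReal xs + P.gReal xs + P.h₁ (P.p₁ xs) : ℝ) : EReal) := by
  refine le_antisymm ?_ (le_iInf fun x => ?_)
  · refine (iInf_le _ xs).trans_eq ?_
    rw [h_of_mem (u := P.p xs) hS.xs_feasible, ← hS.F_eq hS.xs_dom]
    rfl
  · by_cases hx : x ∈ effDom P.g
    · by_cases hK : P.p₂ x ∈ P.K
      · rw [h_of_mem (u := P.p x) hK, ← hS.coe_fReal (hS.dom_subset hx), ← hS.coe_gReal hx,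
          ← EReal.coe_add, ← EReal.coe_add, EReal.coe_le_coe_iff]
        have h1 := hS.F_le_lagrangian hx
        have h2 : inner ℝ ls (P.p x) - P.h₁ (P.p x).fst ≤ P.conj ls :=
          inner_sub_le_conj hS hS.ls_dom hK
        linarith
      · rw [h_of_notMem (u := P.p x) hK, ← hS.coe_fReal (hS.dom_subset hx), ← hS.coe_gReal hx,
          ← EReal.coe_add, EReal.coe_add_top]
        exact le_top
    · have hg : P.g x = ⊤ := not_not.1 hx
      have hh : P.h (P.p x) ≠ ⊥ := by
        by_cases hK : P.p₂ x ∈ P.K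
        · rw [h_of_mem (u := P.p x) hK]; exact EReal.coe_ne_bot _
        · rw [h_of_notMem (u := P.p x) hK]; exact top_ne_bot
      rw [hg, EReal.add_top_of_ne_bot (hS.f_ne_bot x), EReal.top_add_of_ne_bot hh]
      exact le_top

/-- The smooth approximation is close to `h₁` from below. -/
theorem h₁_le_hReal_add (hS : P.Standing c xs ls) (u v : PairVec d₁ d₂) {β : ℝ} (hβ : 0 < β)
    (hv : ‖v.fst‖ ≤ c.Lh₁) :
    P.h₁ u.fst ≤ P.hReal u v β + β * (2 * c.Lh₁ ^ 2 + ‖v.snd‖ ^ 2 / 2) := by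
  have h1 := hReal_eq_prox hS u v hβ
  simp only at h1
  set z := u - β • (P.multiplier u v β - v)
  have h2 := (abs_le.1 (hS.h₁_lipschitz u.fst z.fst)).2
  rw [WithLp.prod_inner_apply, WithLp.prod_norm_sq_eq_of_L2] at h1
  change _ = P.h₁ z.fst + (inner ℝ v.fst (u.fst - z.fst) + inner ℝ v.snd (u.snd - z.snd)) +
    β⁻¹ / 2 * (‖u.fst - z.fst‖ ^ 2 + ‖u.snd - z.snd‖ ^ 2) at h1
  have h3 := (abs_le.1 (abs_real_inner_le_norm v.fst (u.fst - z.fst))).1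
  have h4 := (abs_le.1 (abs_real_inner_le_norm v.snd (u.snd - z.snd))).1
  set r := ‖u.fst - z.fst‖
  set t := ‖u.snd - z.snd‖
  have h5 : ‖v.fst‖ * r ≤ c.Lh₁ * r := by gcongr
  -- Squares completed against the linear terms: the variation of `h₁` and `‖v.fst‖` each cost
  -- `c.Lh₁ * r`, and the second block costs `‖v.snd‖ * t`.
  have h6 : 0 ≤ β⁻¹ / 2 * (r - 2 * β * c.Lh₁) ^ 2 := by positivity
  have h7 : 0 ≤ β⁻¹ / 2 * (t - β * ‖v.snd‖) ^ 2 := by positivity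
  have e6 : β⁻¹ / 2 * (r - 2 * β * c.Lh₁) ^ 2 =
      β⁻¹ / 2 * r ^ 2 - 2 * c.Lh₁ * r + 2 * β * c.Lh₁ ^ 2 := by
    field_simp; ring
  have e7 : β⁻¹ / 2 * (t - β * ‖v.snd‖) ^ 2 =
      β⁻¹ / 2 * t ^ 2 - ‖v.snd‖ * t + β / 2 * ‖v.snd‖ ^ 2 := by
    field_simp; ring
  linarith

end CompositeProblem

namespace IsIPALMRun

/-- Suboptimality and infeasibility decay like `ρ ^ s`. -/
theorem isEpsOptimal (hR : IsIPALMRun P c θ a X lam m) (hS : P.Standing c xs ls)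
    (hT : P.SmoothTerm c) (hN : P.NonlinearBounds c) (hθ : IsAPGWeights θ) (ha : a.Valid)
    (s : ℕ) :
    P.IsEpsOptimal (boundC₁ a c.Lh₁ (boundC₀ a (X 0) xs (lam 0) ls) ls * a.ρ ^ (s + 1))
      (X (s + 1 + 1)) := by
  set r := s + 1 with hr
  have hβ := ha.β_pos r
  have hβ₀ := ha.β₀_pos
  have hXr := hR.x_mem hS hT hN hθ ha (r + 1)
  obtain ⟨b1, b2, -, b4⟩ := hR.bounds hS hT hN hθ ha r
  have hgap := hR.gap_le hS hT hN hθ ha r xs hS.xs_dom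
  have hC0 : 0 ≤ boundC₀ a (X 0) xs (lam 0) ls := boundC₀_nonneg _ _
  have hρ : 0 ≤ a.ρ ^ r := pow_nonneg ha.ρ_pos.le _
  have hβeq : a.β r = a.β₀ * a.ρ ^ r := rfl
  have hεle : a.ε r ≤ a.ε₀ * a.ρ ^ r := by
    have h1 := ha.η_pos.le
    have h2 := ha.ε₀_pos
    have h3 := ha.η_lt.le
    rw [IPALMParams.ε]
    gcongr
  set c₀ := boundC₀ a (X 0) xs (lam 0) ls
  have hC1a : a.ε₀ + 2 * c.Lh₁ ^ 2 * a.β₀ + c₀ * a.β₀ ≤ boundC₁ a c.Lh₁ c₀ ls := le_max_left _ _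
  have hC1b : a.β₀ * ‖ls.snd‖ * √c₀ ≤ boundC₁ a c.Lh₁ c₀ ls :=
    (le_max_left _ _).trans (le_max_right _ _)
  have hC1c : a.β₀ * √c₀ ≤ boundC₁ a c.Lh₁ c₀ ls := (le_max_right _ _).trans (le_max_right _ _)
  set C1 := boundC₁ a c.Lh₁ c₀ ls
  have hsub := multiplier_isSubgrad hS (P.p (X (r + 1))) (lam r) hβ
  rw [← hR.lam_step r] at hsub
  -- Its second component lies in `K`, within `β_r √c₀` of `p₂(x^r)`. This gives feasibility at
  -- once, and the lower bound on `F` by testing Fenchel–Young for `ls` at the pair of `p₁(x^r)` and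
  -- that component.
  set z := P.p (X (r + 1)) - a.β r • (lam (r + 1) - lam r) with hz
  have hzn : ‖P.p₂ (X (r + 1)) - z.snd‖ ≤ a.β r * √c₀ := by
    have e : P.p₂ (X (r + 1)) - z.snd = a.β r • (lam (r + 1) - lam r).snd := by
      change P.p₂ (X (r + 1)) - (P.p₂ (X (r + 1)) - a.β r • (lam (r + 1) - lam r).snd) = _
      abel
    rw [e, norm_smul, Real.norm_of_nonneg hβ.le]
    have := (WithLp.norm_snd_le_norm (lam (r + 1) - lam r)).trans b2
    gcongr
  refine ⟨hXr, ?_, ?_⟩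
  · rw [hS.F_eq hXr, optVal_eq hS, EReal.toReal_coe, EReal.toReal_coe, abs_le]
    constructor
    · have h1 := hS.F_le_lagrangian hXr
      have h2 := inner_sub_le_conj hS hS.ls_dom
        (z := WithLp.toLp 2 (P.p₁ (X (r + 1)), z.snd)) hsub.1
      have h3 : inner ℝ ls (P.p (X (r + 1))) -
          inner ℝ ls (WithLp.toLp 2 (P.p₁ (X (r + 1)), z.snd)) =
            inner ℝ ls.snd (P.p₂ (X (r + 1)) - z.snd) := by
        rw [← inner_sub_right, WithLp.prod_inner_apply]
        change inner ℝ ls.fst (P.p₁ (X (r + 1)) - P.p₁ (X (r + 1))) +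
          inner ℝ ls.snd (P.p₂ (X (r + 1)) - z.snd) = _
        rw [sub_self, inner_zero_right, zero_add]
      have h4 := real_inner_le_norm ls.snd (P.p₂ (X (r + 1)) - z.snd)
      have h5 : ‖ls.snd‖ * ‖P.p₂ (X (r + 1)) - z.snd‖ ≤ ‖ls.snd‖ * (a.β r * √c₀) := by gcongr
      have h6 := mul_le_mul_of_nonneg_right hC1b hρ
      rw [hβeq] at h5
      change inner ℝ ls (WithLp.toLp 2 (P.p₁ (X (r + 1)), z.snd)) - P.h₁ (P.p₁ (X (r + 1))) ≤ _
        at h2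
      linarith
    -- As `r = s + 1` is positive, `lam r` is the output of a multiplier step and hence a
    -- subgradient of `h`.
    · have h1 : ‖(lam r).fst‖ ≤ c.Lh₁ := by
        have := multiplier_isSubgrad hS (P.p (X (s + 1))) (lam s) (ha.β_pos s)
        rw [← hR.lam_step s] at this
        exact this.norm_fst_le hS
      have h2 : P.h₁ (P.p₁ (X (r + 1))) ≤ _ := h₁_le_hReal_add hS (P.p (X (r + 1))) (lam r) hβ h1
      have h3 : P.hReal (P.p xs) (lam r) (a.β r) ≤ P.h₁ (P.p₁ xs) :=
        hReal_le_h₁ hS (P.p xs) (lam r) hβ hS.xs_feasible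
      have h4 : ‖(lam r).snd‖ ^ 2 ≤ c₀ := by
        rw [← Real.sq_sqrt hC0]
        have := (WithLp.norm_snd_le_norm (lam r)).trans b1
        gcongr
      have h5 : ‖xs - X r‖ ^ 2 ≤ c₀ := by
        rw [← Real.sq_sqrt hC0, norm_sub_rev]
        gcongr
      have h6 := mul_le_mul_of_nonneg_right hC1a hρ
      have h7 : 0 ≤ a.β r / 2 * ‖X (r + 1) - X r‖ ^ 2 := by positivity
      have h8 := mul_le_mul_of_nonneg_left h4 hβ.le
      have h9 := mul_le_mul_of_nonneg_left h5 hβ.le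
      simp only [alReal] at hgap
      have h10 : a.ε r + a.β r * (2 * c.Lh₁ ^ 2) + a.β r * c₀ ≤
          (a.ε₀ + 2 * c.Lh₁ ^ 2 * a.β₀ + c₀ * a.β₀) * a.ρ ^ r := by
        rw [hβeq]; linarith
      linarith
  · refine (Metric.infDist_le_dist_of_mem hsub.1).trans ?_
    rw [dist_eq_norm]
    refine hzn.trans ?_
    have h6 := mul_le_mul_of_nonneg_right hC1c hρ
    rw [hβeq]
    linarith

end IsIPALMRun

end Run

/-! ### Counting the inner iterations -/

section Counting

open CompositeProblem

variable {n d₁ d₂ : ℕ} {P : CompositeProblem n d₁ d₂} {c : ProblemConstants} {xs : Vec n}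
  {ls : PairVec d₁ d₂} {θ : ℕ → ℝ} {a : IPALMParams} {X : ℕ → Vec n} {lam : ℕ → PairVec d₁ d₂}
  {m : ℕ → ℕ}

namespace IsIPALMRun

/-- The point of `K` produced by the multiplier step is within `β_s √c₀` of `p₂(x^s)`. Testing
`norm_multiplier_snd_le` with it bounds the second component of the next multiplier; the first
components are bounded by `Lh₁`. -/
theorem norm_multiplier_succ_le (hR : IsIPALMRun P c θ a X lam m) (hS : P.Standing c xs ls)
    (hT : P.SmoothTerm c) (hN : P.NonlinearBounds c) (hθ : IsAPGWeights θ) (ha : a.Valid)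
    (s : ℕ) :
    ‖P.multiplier (P.p (X (s + 1))) (lam (s + 1)) (a.β (s + 1)) - lam (s + 1)‖ ^ 2 ≤
      4 * c.Lh₁ ^ 2 + 9 * boundC₀ a (X 0) xs (lam 0) ls / a.ρ ^ 2 := by
  obtain ⟨-, b2, -, -⟩ := hR.bounds hS hT hN hθ ha s
  obtain ⟨b1, -, -, -⟩ := hR.bounds hS hT hN hθ ha (s + 1)
  have hβ := ha.β_pos s
  have hβ' := ha.β_pos (s + 1)
  have hρ := ha.ρ_pos
  have hC0 : 0 ≤ boundC₀ a (X 0) xs (lam 0) ls := boundC₀_nonneg _ _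
  have hsub := multiplier_isSubgrad hS (P.p (X (s + 1))) (lam s) hβ
  rw [← hR.lam_step s] at hsub
  have hsub' := multiplier_isSubgrad hS (P.p (X (s + 1))) (lam (s + 1)) hβ'
  have h1 := norm_multiplier_snd_le hS (P.p (X (s + 1))) (lam (s + 1)) hβ' hsub.1
  set w := P.multiplier (P.p (X (s + 1))) (lam (s + 1)) (a.β (s + 1))
  set q := √(boundC₀ a (X 0) xs (lam 0) ls) with hq
  have hq0 : 0 ≤ q := Real.sqrt_nonneg _
  have hq2 : q ^ 2 = boundC₀ a (X 0) xs (lam 0) ls := Real.sq_sqrt hC0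
  have h2 : ‖(P.p (X (s + 1))).snd + a.β (s + 1) • (lam (s + 1)).snd -
      (P.p (X (s + 1)) - a.β s • (lam (s + 1) - lam s)).snd‖ ≤ a.β (s + 1) * q + a.β s * q := by
    have e : (P.p (X (s + 1))).snd + a.β (s + 1) • (lam (s + 1)).snd -
        (P.p (X (s + 1)) - a.β s • (lam (s + 1) - lam s)).snd =
        a.β (s + 1) • (lam (s + 1)).snd + a.β s • (lam (s + 1) - lam s).snd := by
      change (P.p (X (s + 1))).snd + a.β (s + 1) • (lam (s + 1)).snd -
        ((P.p (X (s + 1))).snd - a.β s • (lam (s + 1) - lam s).snd) = _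
      abel
    rw [e]
    refine (norm_add_le _ _).trans ?_
    rw [norm_smul, norm_smul, Real.norm_of_nonneg hβ.le, Real.norm_of_nonneg hβ'.le]
    have := (WithLp.norm_snd_le_norm (lam (s + 1))).trans b1
    have := (WithLp.norm_snd_le_norm (lam (s + 1) - lam s)).trans b2
    gcongr
  have h3 : a.ρ * ‖w.snd‖ ≤ a.ρ * q + q := by
    have := h1.trans h2
    rw [a.β_succ] at this
    refine le_of_mul_le_mul_left ?_ hβ
    linarith
  have h4 : a.ρ * ‖w.snd - (lam (s + 1)).snd‖ ≤ 3 * q := by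
    have h5 := _root_.norm_sub_le w.snd (lam (s + 1)).snd
    have h6 := (WithLp.norm_snd_le_norm (lam (s + 1))).trans b1
    have h7 := mul_le_mul_of_nonneg_left (h5.trans (add_le_add le_rfl h6)) hρ.le
    have h8 : a.ρ * q ≤ q := mul_le_of_le_one_left hq0 ha.ρ_lt.le
    linarith
  have h9 : ‖w.fst - (lam (s + 1)).fst‖ ≤ 2 * c.Lh₁ := by
    have := _root_.norm_sub_le w.fst (lam (s + 1)).fst
    have := hsub.norm_fst_le hS
    have := hsub'.norm_fst_le hS
    linarith
  rw [WithLp.prod_norm_sq_eq_of_L2]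
  change ‖w.fst - (lam (s + 1)).fst‖ ^ 2 + ‖w.snd - (lam (s + 1)).snd‖ ^ 2 ≤ _
  refine add_le_add ?_ ?_
  · calc _ ≤ (2 * c.Lh₁) ^ 2 := by gcongr
      _ = _ := by ring
  · rw [le_div_iff₀ (by positivity), ← hq2]
    calc ‖w.snd - (lam (s + 1)).snd‖ ^ 2 * a.ρ ^ 2 = (a.ρ * ‖w.snd - (lam (s + 1)).snd‖) ^ 2 := by
          ring
      _ ≤ (3 * q) ^ 2 := by gcongr
      _ = _ := by ring

/-- The quantity `M_s` is of the order of `β_s`. -/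
theorem errorTerm_le (hR : IsIPALMRun P c θ a X lam m) (hS : P.Standing c xs ls)
    (hT : P.SmoothTerm c) (hN : P.NonlinearBounds c) (hθ : IsAPGWeights θ) (ha : a.Valid)
    (s : ℕ) :
    errorTerm P c.Lh₁ (X s) (X (s + 1)) (lam s) (lam (s + 1)) (a.β s) (a.β (s + 1)) ≤
      a.β s * ((11 + 2 / a.ρ ^ 2) * (c.Lh₁ ^ 2 + 4 * boundC₀ a (X 0) xs (lam 0) ls) +
        4 * boundC₀ a (X 0) xs (lam 0) ls / (2 * a.ρ - 1)) := by
  have h0 := hR.norm_multiplier_succ_le hS hT hN hθ ha s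
  obtain ⟨b1, b2, b3, -⟩ := hR.bounds hS hT hN hθ ha s
  obtain ⟨b1', -, -, -⟩ := hR.bounds hS hT hN hθ ha (s + 1)
  have hβ := ha.β_pos s
  have hβ' := ha.β_pos (s + 1)
  have hρ := ha.ρ_pos
  have hρ1 := ha.ρ_gt
  have hL := hS.Lh₁_nonneg
  have hC0 : 0 ≤ boundC₀ a (X 0) xs (lam 0) ls := boundC₀_nonneg _ _
  have hle := ha.β_succ_le s
  set w := P.multiplier (P.p (X (s + 1))) (lam (s + 1)) (a.β (s + 1)) with hw
  set c₀ := boundC₀ a (X 0) xs (lam 0) ls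
  set q := √c₀ with hq
  have hq0 : 0 ≤ q := Real.sqrt_nonneg _
  have hq2 : q ^ 2 = c₀ := Real.sq_sqrt hC0
  have h2ρ : 0 < 2 * a.ρ - 1 := by linarith
  have t1 : a.β s * ‖lam (s + 1) - lam s‖ ^ 2 ≤ a.β s * c₀ := by
    rw [← hq2]; gcongr
  have t2 : (a.β s - a.β (s + 1)) / 2 * ‖w - lam (s + 1)‖ ^ 2 ≤
      a.β s * (c.Lh₁ ^ 2 + 9 / 4 * (c₀ / a.ρ ^ 2)) := by
    have e : (a.β s - a.β (s + 1)) / 2 ≤ a.β s / 4 := by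
      rw [a.β_succ]; nlinarith
    calc _ ≤ a.β s / 4 * (4 * c.Lh₁ ^ 2 + 9 * c₀ / a.ρ ^ 2) :=
          mul_le_mul e h0 (by positivity) (by positivity)
      _ = _ := by ring
  have t3 : a.β s ^ 2 / (2 * a.β (s + 1) - a.β s) * ‖X s - X (s + 1)‖ ^ 2 ≤
      a.β s * (c₀ / (2 * a.ρ - 1)) := by
    have e : a.β s ^ 2 / (2 * a.β (s + 1) - a.β s) = a.β s / (2 * a.ρ - 1) := by
      rw [a.β_succ, show 2 * (a.ρ * a.β s) - a.β s = (2 * a.ρ - 1) * a.β s by ring]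
      field_simp
    rw [e, norm_sub_rev]
    calc _ ≤ a.β s / (2 * a.ρ - 1) * q ^ 2 := by gcongr
      _ = _ := by rw [hq2]; ring
  have t4 : ‖lam (s + 1) - lam s‖ * √(((a.β s + a.β (s + 1)) * c.Lh₁ +
      ‖a.β s • (lam s).fst - a.β (s + 1) • (lam (s + 1)).fst‖) ^ 2
        + ‖a.β s • (lam s).snd - a.β (s + 1) • (lam (s + 1)).snd‖ ^ 2) ≤
      a.β s * (c.Lh₁ ^ 2 + 5 * c₀) := by
    have hdiff : ∀ {V : Type} [NormedAddCommGroup V] [NormedSpace ℝ V] (u v : V), ‖u‖ ≤ q →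
        ‖v‖ ≤ q → ‖a.β s • u - a.β (s + 1) • v‖ ≤ 2 * (a.β s * q) := by
      intro V _ _ u v hu hv
      refine (_root_.norm_sub_le _ _).trans ?_
      rw [norm_smul, norm_smul, Real.norm_of_nonneg hβ.le, Real.norm_of_nonneg hβ'.le]
      have e1 : a.β s * ‖u‖ ≤ a.β s * q := by gcongr
      have e2 : a.β (s + 1) * ‖v‖ ≤ a.β s * q := by gcongr
      linarith
    have e1 := hdiff (lam s).fst (lam (s + 1)).fst ((WithLp.norm_fst_le_norm _).trans b1)
      ((WithLp.norm_fst_le_norm _).trans b1')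
    have e2 := hdiff (lam s).snd (lam (s + 1)).snd ((WithLp.norm_snd_le_norm _).trans b1)
      ((WithLp.norm_snd_le_norm _).trans b1')
    have e3 : √(((a.β s + a.β (s + 1)) * c.Lh₁ +
        ‖a.β s • (lam s).fst - a.β (s + 1) • (lam (s + 1)).fst‖) ^ 2
          + ‖a.β s • (lam s).snd - a.β (s + 1) • (lam (s + 1)).snd‖ ^ 2) ≤
        a.β s * (2 * c.Lh₁ + 4 * q) := by
      set r₁ := ‖a.β s • (lam s).fst - a.β (s + 1) • (lam (s + 1)).fst‖
      set r₂ := ‖a.β s • (lam s).snd - a.β (s + 1) • (lam (s + 1)).snd‖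
      have hr₁ : 0 ≤ r₁ := norm_nonneg _
      have hr₂ : 0 ≤ r₂ := norm_nonneg _
      have e4 : (a.β s + a.β (s + 1)) * c.Lh₁ ≤ 2 * a.β s * c.Lh₁ := by
        gcongr; linarith
      have e5 : 0 ≤ (a.β s + a.β (s + 1)) * c.Lh₁ := by positivity
      calc _ ≤ (a.β s + a.β (s + 1)) * c.Lh₁ + r₁ + r₂ := by
            refine (Real.sqrt_le_left (by positivity)).2 ?_
            nlinarith [mul_nonneg (add_nonneg e5 hr₁) hr₂]
        _ ≤ _ := by linarith
    calc _ ≤ q * (a.β s * (2 * c.Lh₁ + 4 * q)) := by gcongr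
      _ = a.β s * (2 * c.Lh₁ * q + 4 * q ^ 2) := by ring
      _ ≤ a.β s * (c.Lh₁ ^ 2 + 5 * c₀) := by
        rw [← hq2]
        refine mul_le_mul_of_nonneg_left ?_ hβ.le
        nlinarith [sq_nonneg (c.Lh₁ - q)]
  rw [errorTerm]
  have h1 : 0 ≤ c₀ / a.ρ ^ 2 := by positivity
  have h2 : 0 ≤ c₀ / (2 * a.ρ - 1) := by positivity
  have h3 : 0 ≤ c.Lh₁ ^ 2 / a.ρ ^ 2 := by positivity
  have h4 : 0 ≤ c.Lh₁ ^ 2 := by positivity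
  refine (add_le_add (add_le_add (add_le_add t1 t2) t3) t4).trans ?_
  rw [← mul_add, ← mul_add, ← mul_add]
  refine mul_le_mul_of_nonneg_left ?_ hβ.le
  have e : (11 + 2 / a.ρ ^ 2) * (c.Lh₁ ^ 2 + 4 * c₀) + 4 * c₀ / (2 * a.ρ - 1) =
      11 * c.Lh₁ ^ 2 + 44 * c₀ + 2 * (c.Lh₁ ^ 2 / a.ρ ^ 2) + 8 * (c₀ / a.ρ ^ 2) +
        4 * (c₀ / (2 * a.ρ - 1)) := by ring
  rw [e]
  linarith

/-- The number of inner iterations grows at most linearly in units of the halving period. -/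
theorem m_succ_le (hR : IsIPALMRun P c θ a X lam m) (hS : P.Standing c xs ls)
    (hT : P.SmoothTerm c) (hN : P.NonlinearBounds c) (hθ : IsAPGWeights θ) (ha : a.Valid)
    (s : ℕ) :
    (m (s + 1) : ℝ) ≤ P.halvingPeriod c (lam (s + 1)) (a.β (s + 1)) *
      (boundC₂ a c.Lh₁ (boundC₀ a (X 0) xs (lam 0) ls) + s * Real.logb 2 (a.ρ / a.η)) := by
  obtain ⟨j, hj, -, hlt⟩ := hR.m_succ hS hT hN ha s
  have h0 := hR.errorTerm_le hS hT hN hθ ha s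
  have hC0 : 0 ≤ boundC₀ a (X 0) xs (lam 0) ls := boundC₀_nonneg _ _
  rw [boundC₂]
  set c₀ := boundC₀ a (X 0) xs (lam 0) ls
  set Q := (11 + 2 / a.ρ ^ 2) * (c.Lh₁ ^ 2 + 4 * c₀) + 4 * c₀ / (2 * a.ρ - 1) with hQ
  have hρ := ha.ρ_pos
  have hη := ha.η_pos
  have hβ₀ := ha.β₀_pos
  have hε₀ := ha.ε₀_pos
  have h2ρ : 0 < 2 * a.ρ - 1 := by linarith [ha.ρ_gt]
  have hQ0 : 0 ≤ Q := by positivity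
  set B := 4 / a.η + 2 * a.β₀ * Q / (a.ε₀ * a.η) with hB
  have hB0 : 0 < B := by positivity
  -- Both `ε_s` and `M_s` are at most a constant times `ρ ^ s`, while the target is `ε₀ η ^ (s +
  -- 1)`. Taking logarithms bounds `j`; the final period of `j + 1` is the `+ 1` in `c₂`.
  have h1 : (2 : ℝ) ^ j ≤ B * (a.ρ / a.η) ^ s := by
    have e1 : a.ε s ≤ a.ε₀ * a.ρ ^ s := by
      have := ha.η_lt.le
      rw [IPALMParams.ε]
      gcongr
    have e2 : B * (a.ρ / a.η) ^ s * a.ε (s + 1) = 4 * (a.ε₀ * a.ρ ^ s) + 2 * (a.β s * Q) := by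
      rw [hB, IPALMParams.ε, IPALMParams.β, div_pow, pow_succ]
      field_simp
    refine le_of_mul_le_mul_right ?_ (ha.ε_pos (s + 1))
    rw [e2]
    linarith
  have h2 : (j : ℝ) ≤ Real.logb 2 B + s * Real.logb 2 (a.ρ / a.η) := by
    have := Real.logb_le_logb_of_le (b := 2) one_lt_two (by positivity) h1
    rw [Real.logb_pow, Real.logb_self_eq_one one_lt_two, mul_one,
      Real.logb_mul hB0.ne' (by positivity), Real.logb_pow] at this
    exact this
  rw [hj]
  push_cast
  rw [mul_comm]
  refine mul_le_mul_of_nonneg_left ?_ (Nat.cast_nonneg _)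
  linarith

end IsIPALMRun

/-! ### Length of the halving periods and their summation -/

theorem innerSmoothness_le (hS : P.Standing c xs ls) (hT : P.SmoothTerm c)
    (hN : P.NonlinearBounds c) (v : PairVec d₁ d₂) {β β₀ D : ℝ} (hβ : 0 < β) (hle : β ≤ β₀)
    (hD : P.distConst c v β ≤ D) :
    P.innerSmoothness c v β ≤ complexityFactor c β₀ D / β := by
  have h1 := hT.L_pos
  have h2 := hN.LDp_nonneg
  have h3 := hS.Lh₁_nonneg
  rw [le_div_iff₀ hβ, innerSmoothness, complexityFactor]
  have e : (c.L + c.LDp * (c.Lh₁ + β⁻¹ * P.distConst c v β) + c.MDp ^ 2 * β⁻¹) * β =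
      c.L * β + c.LDp * (c.Lh₁ * β + P.distConst c v β) + c.MDp ^ 2 := by
    field_simp
  rw [e]
  gcongr

theorem halvingPeriod_le {v : PairVec d₁ d₂} {β r : ℝ} (hr : 0 ≤ r)
    (h : 2 * P.innerSmoothness c v β / (c.μg + β) ≤ r ^ 2) :
    (P.halvingPeriod c v β : ℝ) ≤ 2 * r + 1 := by
  have h1 := (Nat.ceil_lt_add_one
    (by positivity : 0 ≤ 2 * √(2 * P.innerSmoothness c v β / (c.μg + β)))).le
  have h2 := (Real.sqrt_le_left hr).2 h
  rw [halvingPeriod]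
  linarith

/-- A growing geometric sum is comparable to its last term. -/
theorem sum_inv_pow_le {r : ℝ} (h0 : 0 < r) (h1 : r < 1) (s : ℕ) :
    ∑ t ∈ Finset.range s, (r⁻¹) ^ (t + 1) ≤ (r⁻¹) ^ s / (1 - r) := by
  have h2 := sub_pos.2 h1
  induction s with
  | zero => simp; linarith
  | succ s ih =>
    rw [Finset.sum_range_succ]
    refine (add_le_add ih le_rfl).trans_eq ?_
    rw [pow_succ]
    field_simp
    ring

/-- Here `r` will be `ρ` or `√ρ`, and `k` carries the conditioning. The roundings in the period
lengths add up to the isolated `s`. -/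
theorem sum_iterations_le {m : ℕ → ℕ} {K : ℕ → ℝ} {c₂ l r k T : ℝ} {s : ℕ}
    (h0 : 0 < r) (h1 : r < 1) (hk : 0 ≤ k) (hT : 0 ≤ T) (hKnn : ∀ t, 0 ≤ K t)
    (hm : ∀ t, (m (t + 1) : ℝ) ≤ K t * (c₂ + t * l))
    (hK : ∀ t < s, K t ≤ k * (r⁻¹) ^ (t + 1) + 1) (hle : ∀ t < s, c₂ + t * l ≤ T) :
    ∑ t ∈ Finset.range (s + 1), (m t : ℝ) ≤ m 0 + T * (k * (r⁻¹) ^ s / (1 - r) + s) := by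
  rw [Finset.sum_range_succ', add_comm]
  gcongr
  calc ∑ t ∈ Finset.range s, (m (t + 1) : ℝ)
      ≤ ∑ t ∈ Finset.range s, T * (k * (r⁻¹) ^ (t + 1) + 1) := by
        refine Finset.sum_le_sum fun t ht => ?_
        have ht := Finset.mem_range.1 ht
        calc (m (t + 1) : ℝ) ≤ K t * (c₂ + t * l) := hm t
          _ ≤ K t * T := mul_le_mul_of_nonneg_left (hle t ht) (hKnn t)
          _ ≤ (k * (r⁻¹) ^ (t + 1) + 1) * T := mul_le_mul_of_nonneg_right (hK t ht) hT
          _ = _ := mul_comm _ _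
    _ = T * (k * ∑ t ∈ Finset.range s, (r⁻¹) ^ (t + 1) + s) := by
        rw [← Finset.mul_sum, Finset.sum_add_distrib, ← Finset.mul_sum]
        simp
    _ ≤ _ := by
        rw [mul_div_assoc]
        gcongr
        exact sum_inv_pow_le h0 h1 s

/-- The number of outer iterations that makes `c₁ ρ ^ s` smaller than `ε`. -/
theorem exists_outer_iterations {ρ ε c₁ : ℝ} (h0 : 0 < ρ) (h1 : ρ < 1) (hε : 0 < ε)
    (hle : ε ≤ c₁) :
    ∃ s : ℕ, 1 ≤ s ∧ c₁ * ρ ^ s ≤ ε ∧ (ρ⁻¹) ^ s ≤ c₁ / (ρ * ε) ∧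
      s * (-Real.log ρ) ≤ Real.log (c₁ / (ρ * ε)) := by
  have hc : 0 < c₁ := hε.trans_le hle
  -- Searching over `s + 1` makes the answer positive. Minimality gives `ε ≤ c₁ * ρ ^ s`, which for
  -- `s = 0` is `hle`, and this bounds `(ρ⁻¹) ^ (s + 1)` from above.
  have hex : ∃ s : ℕ, c₁ * ρ ^ (s + 1) ≤ ε := by
    obtain ⟨k, hk⟩ := exists_pow_lt_of_lt_one (div_pos hε hc) h1
    refine ⟨k, ?_⟩
    rw [lt_div_iff₀ hc] at hk
    have : ρ ^ (k + 1) ≤ ρ ^ k := pow_le_pow_of_le_one h0.le h1.le (Nat.le_succ k)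
    linarith [mul_le_mul_of_nonneg_left this hc.le]
  classical
  have hspec := Nat.find_spec hex
  set s := Nat.find hex with hs
  have hinv : (ρ⁻¹) ^ (s + 1) ≤ c₁ / (ρ * ε) := by
    have hlow : ε ≤ c₁ * ρ ^ s := by
      rcases Nat.eq_zero_or_pos s with hz | hp
      · rw [hz]; simpa using hle
      · obtain ⟨k, hk⟩ : ∃ k, s = k + 1 := ⟨s - 1, by omega⟩
        rw [hk]
        exact (not_le.1 (Nat.find_min hex (m := k) (by omega))).le
    rw [le_div_iff₀ (by positivity), inv_pow, inv_mul_le_iff₀ (by positivity), pow_succ]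
    nlinarith
  refine ⟨s + 1, by omega, hspec, hinv, ?_⟩
  have := Real.log_le_log (by positivity) hinv
  rw [Real.log_pow, Real.log_inv] at this
  exact this

/-- From `log √x ≤ √x - 1`; it trades a logarithm for a factor of order `1/√ε`. -/
theorem log_le_two_mul_sqrt {x : ℝ} (hx : 0 < x) : Real.log x ≤ 2 * √x := by
  have h := Real.log_le_sub_one_of_pos (Real.sqrt_pos.2 hx)
  rw [Real.log_sqrt hx.le] at h
  linarith

end Counting

/-! ### The complexity bound -/

section Complexity

open CompositeProblem

variable {n d₁ d₂ : ℕ} {P : CompositeProblem n d₁ d₂} {c : ProblemConstants} {xs : Vec n}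
  {ls : PairVec d₁ d₂} {a : IPALMParams}

/-- The lower bound does not depend on `D`, hence not on the number of outer iterations; it makes
`√S / ε` dominate the logarithm for small `ε`. -/
theorem complexityFactor_pos (hS : P.Standing c xs ls) (hT : P.SmoothTerm c)
    (hN : P.NonlinearBounds c) {β₀ D : ℝ} (hβ₀ : 0 < β₀) (hD : 0 ≤ D) :
    c.L * β₀ ≤ complexityFactor c β₀ D := by
  have h1 := hT.L_pos
  have h2 := hN.LDp_nonneg
  have h3 := hS.Lh₁_nonneg
  rw [complexityFactor]
  have : 0 ≤ c.LDp * (c.Lh₁ * β₀ + D) + c.MDp ^ 2 := by positivity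
  linarith

/-- The conditioning is at most `2 S / β_t²`, whose root grows like `ρ^{-t}`. -/
theorem halvingPeriod_le_of_eq_zero (hS : P.Standing c xs ls) (hT : P.SmoothTerm c)
    (hN : P.NonlinearBounds c) (ha : a.Valid) (hμ : c.μg = 0) {v : PairVec d₁ d₂} {D : ℝ} {t : ℕ}
    (hD : P.distConst c v (a.β t) ≤ D) :
    (P.halvingPeriod c v (a.β t) : ℝ) ≤
      2 * √2 * √(complexityFactor c a.β₀ D) / a.β₀ * (a.ρ⁻¹) ^ t + 1 := by
  have hβ := ha.β_pos t
  have hβ₀ := ha.β₀_pos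
  have hρ := ha.ρ_pos
  have hS0 : 0 ≤ complexityFactor c a.β₀ D := (mul_pos hT.L_pos hβ₀).le.trans
    (complexityFactor_pos hS hT hN hβ₀ ((distConst_nonneg _ _).trans hD))
  have h1 := innerSmoothness_le hS hT hN v hβ (ha.β_le t) hD
  refine (halvingPeriod_le (r := √2 * √(complexityFactor c a.β₀ D) / a.β t) (by positivity)
    ?_).trans_eq ?_
  · rw [hμ, zero_add, div_pow, mul_pow, Real.sq_sqrt hS0, Real.sq_sqrt zero_le_two,
      div_le_div_iff₀ hβ (by positivity)]
    rw [le_div_iff₀ hβ] at h1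
    nlinarith [mul_le_mul_of_nonneg_right h1 hβ.le]
  · rw [IPALMParams.β, inv_pow]
    field_simp

/-- Dropping `β_t` beside `μ_g` leaves `2 S / (μ_g β_t)`, whose root grows only like `ρ^{-t/2}`;
hence the rate `1/√ε` instead of `1/ε`. -/
theorem halvingPeriod_le_of_pos (hS : P.Standing c xs ls) (hT : P.SmoothTerm c)
    (hN : P.NonlinearBounds c) (ha : a.Valid) (hμ : 0 < c.μg) {v : PairVec d₁ d₂} {D : ℝ} {t : ℕ}
    (hD : P.distConst c v (a.β t) ≤ D) :
    (P.halvingPeriod c v (a.β t) : ℝ) ≤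
      2 * √2 * √(complexityFactor c a.β₀ D) / (√a.β₀ * √c.μg) * ((√a.ρ)⁻¹) ^ t + 1 := by
  have hβ := ha.β_pos t
  have hβ₀ := ha.β₀_pos
  have hρ := ha.ρ_pos
  have hS0 : 0 ≤ complexityFactor c a.β₀ D := (mul_pos hT.L_pos hβ₀).le.trans
    (complexityFactor_pos hS hT hN hβ₀ ((distConst_nonneg _ _).trans hD))
  have h1 := innerSmoothness_le hS hT hN v hβ (ha.β_le t) hD
  refine (halvingPeriod_le (r := √2 * √(complexityFactor c a.β₀ D) /
    (√a.β₀ * √c.μg * √a.ρ ^ t)) (by positivity) ?_).trans_eq ?_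
  · rw [div_pow, mul_pow, Real.sq_sqrt hS0, Real.sq_sqrt zero_le_two, mul_pow, mul_pow,
      Real.sq_sqrt hβ₀.le, Real.sq_sqrt hμ.le, ← pow_mul, mul_comm t 2, pow_mul,
      Real.sq_sqrt hρ.le, show a.β₀ * c.μg * a.ρ ^ t = a.β t * c.μg by rw [IPALMParams.β]; ring]
    have hL := innerSmoothness_pos hS hT hN v hβ
    calc 2 * P.innerSmoothness c v (a.β t) / (c.μg + a.β t)
        ≤ 2 * P.innerSmoothness c v (a.β t) / c.μg := by
          gcongr
          linarith
      _ ≤ 2 * (complexityFactor c a.β₀ D / a.β t) / c.μg := by gcongr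
      _ = _ := by field_simp
  · rw [inv_pow]
    field_simp

/-- The rate at which the logarithmic factor grows. -/
def logSlope (c₂ : ℝ) (a : IPALMParams) : ℝ :=
  (|c₂| + Real.logb 2 (a.ρ / a.η)) / (-Real.log a.ρ)

/-- Coefficient of the leading term when `μ_g = 0`. -/
def coeffConvex (c₁ c₂ : ℝ) (a : IPALMParams) : ℝ :=
  logSlope c₂ a * (2 * √2 / a.β₀ * (c₁ / a.ρ) / (1 - a.ρ))

/-- Coefficient of the squared logarithm when `μ_g = 0`. -/
def coeffLogSq (c₂ : ℝ) (a : IPALMParams) : ℝ :=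
  logSlope c₂ a / (-Real.log a.ρ) + a.m₀ / (-Real.log a.ρ) ^ 2

/-- Coefficient of the leading term when `μ_g > 0`. -/
def coeffStrong (c₁ c₂ : ℝ) (a : IPALMParams) : ℝ :=
  logSlope c₂ a * (2 * √2 / √a.β₀ * √(c₁ / a.ρ) / (1 - √a.ρ))

/-- Coefficient of the remaining term when `μ_g > 0`. -/
def coeffStrongRest (c₁ c₂ : ℝ) (a : IPALMParams) : ℝ :=
  logSlope c₂ a * (2 * √(c₁ / a.ρ) / (-Real.log a.ρ)) + a.m₀ * √a.ε₀ / (-Real.log a.ρ)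

/-- The constant of the complexity bounds. -/
def complexityConst (c₁ c₂ : ℝ) (a : IPALMParams) : ℝ :=
  (coeffConvex c₁ c₂ a + coeffLogSq c₂ a) + (coeffStrong c₁ c₂ a + coeffStrongRest c₁ c₂ a)

theorem IPALMParams.Valid.neg_log_pos (ha : a.Valid) : 0 < -Real.log a.ρ :=
  neg_pos.2 (Real.log_neg ha.ρ_pos ha.ρ_lt)

theorem IPALMParams.Valid.logb_pos (ha : a.Valid) : 0 < Real.logb 2 (a.ρ / a.η) :=
  Real.logb_pos one_lt_two (by rw [lt_div_iff₀ ha.η_pos, one_mul]; exact ha.η_lt)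

theorem IPALMParams.Valid.sqrt_ρ_lt_one (ha : a.Valid) : √a.ρ < 1 := by
  rw [Real.sqrt_lt' one_pos, one_pow]; exact ha.ρ_lt

theorem logSlope_nonneg (ha : a.Valid) (c₂ : ℝ) : 0 ≤ logSlope c₂ a := by
  have := ha.neg_log_pos
  have := ha.logb_pos
  rw [logSlope]; positivity

theorem coeffConvex_nonneg (ha : a.Valid) {c₁ : ℝ} (h : 0 ≤ c₁) (c₂ : ℝ) :
    0 ≤ coeffConvex c₁ c₂ a := by
  have := logSlope_nonneg ha c₂
  have := sub_pos.2 ha.ρ_lt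
  have := ha.ρ_pos
  have := ha.β₀_pos
  rw [coeffConvex]; positivity

theorem coeffLogSq_nonneg (ha : a.Valid) (c₂ : ℝ) : 0 ≤ coeffLogSq c₂ a := by
  have := logSlope_nonneg ha c₂
  have := ha.neg_log_pos
  rw [coeffLogSq]; positivity

theorem coeffStrong_nonneg (ha : a.Valid) (c₁ c₂ : ℝ) : 0 ≤ coeffStrong c₁ c₂ a := by
  have := logSlope_nonneg ha c₂
  have := sub_pos.2 ha.sqrt_ρ_lt_one
  rw [coeffStrong]; positivity

theorem coeffStrongRest_nonneg (ha : a.Valid) (c₁ c₂ : ℝ) : 0 ≤ coeffStrongRest c₁ c₂ a := by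
  have := logSlope_nonneg ha c₂
  have := ha.neg_log_pos
  rw [coeffStrongRest]; positivity

/-- `T ≥ -log ρ` absorbs the constant `c₂` into a multiple of `T`, and `t ≤ s ≤ T / (-log ρ)`
handles the linear part. -/
theorem add_mul_logb_le (ha : a.Valid) {c₂ T : ℝ} {s t : ℕ} (ht : t ≤ s)
    (h1 : -Real.log a.ρ ≤ T) (hs : s * (-Real.log a.ρ) ≤ T) :
    c₂ + t * Real.logb 2 (a.ρ / a.η) ≤ logSlope c₂ a * T := by
  have hκ := ha.neg_log_pos
  have hl := ha.logb_pos
  rw [logSlope, div_mul_eq_mul_div, le_div_iff₀ hκ]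
  have e1 : c₂ * (-Real.log a.ρ) ≤ |c₂| * T :=
    (mul_le_mul_of_nonneg_right (le_abs_self c₂) hκ.le).trans
      (mul_le_mul_of_nonneg_left h1 (abs_nonneg _))
  have e2 : (t : ℝ) * (-Real.log a.ρ) ≤ T := by
    refine le_trans ?_ hs
    gcongr
  have e3 := mul_le_mul_of_nonneg_left e2 hl.le
  linarith

/-- The last geometric term is of order `1/ε`. The isolated `s`, itself at most a multiple of `T`,
produces `T ^ 2`, which also absorbs `m₀` because `T` is bounded below. -/
theorem convex_total_le (ha : a.Valid) {c₁ c₂ T σ ε total : ℝ} {s : ℕ}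
    (hε : 0 < ε) (hσ : 0 ≤ σ) (h1 : -Real.log a.ρ ≤ T) (hs : s * (-Real.log a.ρ) ≤ T)
    (hinv : (a.ρ⁻¹) ^ s ≤ c₁ / (a.ρ * ε))
    (htot : total ≤ a.m₀ + logSlope c₂ a * T *
      (2 * √2 * σ / a.β₀ * (a.ρ⁻¹) ^ s / (1 - a.ρ) + s)) :
    total ≤ coeffConvex c₁ c₂ a * (σ / ε * T) + coeffLogSq c₂ a * T ^ 2 := by
  have hκ := ha.neg_log_pos
  have hT : 0 < T := hκ.trans_le h1
  have hA := logSlope_nonneg ha c₂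
  have h1ρ := sub_pos.2 ha.ρ_lt
  have hρ := ha.ρ_pos
  have hβ₀ := ha.β₀_pos
  have e1 : (s : ℝ) ≤ T / (-Real.log a.ρ) := by rwa [le_div_iff₀ hκ]
  have e2 : (a.m₀ : ℝ) ≤ a.m₀ / (-Real.log a.ρ) ^ 2 * T ^ 2 := by
    rw [div_mul_eq_mul_div, le_div_iff₀ (by positivity)]
    gcongr
  refine htot.trans ?_
  calc a.m₀ + logSlope c₂ a * T * (2 * √2 * σ / a.β₀ * (a.ρ⁻¹) ^ s / (1 - a.ρ) + s)
      ≤ a.m₀ / (-Real.log a.ρ) ^ 2 * T ^ 2 + logSlope c₂ a * T *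
        (2 * √2 * σ / a.β₀ * (c₁ / (a.ρ * ε)) / (1 - a.ρ) + T / (-Real.log a.ρ)) := by
        gcongr
    _ = _ := by
        rw [coeffConvex, coeffLogSq]
        generalize -Real.log a.ρ = κ at hκ ⊢
        field_simp
        ring

/-- The isolated `s` is of order `1/√ε` by `hTle`, and `m₀` is at most of that order since `ε ≤ ε₀`.
Both become the `√μ / √(μ * ε)` part, and no squared logarithm survives. -/
theorem strong_total_le (ha : a.Valid) {c₁ c₂ T σ μ ε total : ℝ} {s : ℕ} (hc₁ : 0 ≤ c₁)
    (hε : 0 < ε) (hεle : ε ≤ a.ε₀) (hμ : 0 < μ) (hσ : 0 ≤ σ) (h1 : -Real.log a.ρ ≤ T)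
    (hs : s * (-Real.log a.ρ) ≤ T) (hTle : T ≤ 2 * √(c₁ / (a.ρ * ε)))
    (hinv : (a.ρ⁻¹) ^ s ≤ c₁ / (a.ρ * ε))
    (htot : total ≤ a.m₀ + logSlope c₂ a * T *
      (2 * √2 * σ / (√a.β₀ * √μ) * ((√a.ρ)⁻¹) ^ s / (1 - √a.ρ) + s)) :
    total ≤ (coeffStrong c₁ c₂ a + coeffStrongRest c₁ c₂ a) * ((σ + √μ) / √(μ * ε)) * T := by
  have hκ := ha.neg_log_pos
  have hT : 0 < T := hκ.trans_le h1
  have hA := logSlope_nonneg ha c₂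
  have h1ρ := sub_pos.2 ha.sqrt_ρ_lt_one
  have hρ := ha.ρ_pos
  have hβ₀ := Real.sqrt_pos.2 ha.β₀_pos
  have hμ' := Real.sqrt_pos.2 hμ
  have hε' := Real.sqrt_pos.2 hε
  have hsq : √(c₁ / (a.ρ * ε)) = √(c₁ / a.ρ) / √ε := by
    rw [← Real.sqrt_div (by positivity), div_div]
  have e0 : ((√a.ρ)⁻¹) ^ s ≤ √(c₁ / a.ρ) / √ε := by
    rw [← hsq, ← Real.sqrt_inv]
    refine Real.le_sqrt_of_sq_le ?_
    rw [← pow_mul, mul_comm, pow_mul, Real.sq_sqrt (by positivity)]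
    exact hinv
  have e1 : (s : ℝ) ≤ 2 * (√(c₁ / a.ρ) / √ε) / (-Real.log a.ρ) := by
    rw [le_div_iff₀ hκ, ← hsq]
    exact hs.trans hTle
  have e2 : (a.m₀ : ℝ) ≤ a.m₀ * √a.ε₀ / (-Real.log a.ρ) * (T / √ε) := by
    have h2 : √ε ≤ √a.ε₀ := Real.sqrt_le_sqrt hεle
    rw [div_mul_div_comm, le_div_iff₀ (by positivity), mul_comm (-Real.log a.ρ), ← mul_assoc]
    gcongr
  have hC3 := coeffStrong_nonneg ha c₁ c₂
  have hC4 := coeffStrongRest_nonneg ha c₁ c₂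
  refine htot.trans ?_
  calc a.m₀ + logSlope c₂ a * T *
        (2 * √2 * σ / (√a.β₀ * √μ) * ((√a.ρ)⁻¹) ^ s / (1 - √a.ρ) + s)
      ≤ a.m₀ * √a.ε₀ / (-Real.log a.ρ) * (T / √ε) + logSlope c₂ a * T *
        (2 * √2 * σ / (√a.β₀ * √μ) * (√(c₁ / a.ρ) / √ε) / (1 - √a.ρ) +
          2 * (√(c₁ / a.ρ) / √ε) / (-Real.log a.ρ)) := by
        gcongr
    _ = coeffStrong c₁ c₂ a * (σ / (√μ * √ε)) * T +
        coeffStrongRest c₁ c₂ a * (√μ / (√μ * √ε)) * T := by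
        rw [coeffStrong, coeffStrongRest]
        field_simp
        ring
    _ ≤ (coeffStrong c₁ c₂ a + coeffStrongRest c₁ c₂ a) * (σ / (√μ * √ε)) * T +
        (coeffStrong c₁ c₂ a + coeffStrongRest c₁ c₂ a) * (√μ / (√μ * √ε)) * T := by
        gcongr <;> linarith
    _ = _ := by
        rw [Real.sqrt_mul hμ.le]
        ring

end Complexity

theorem CompositeProblem.IsEpsOptimal.mono {n d₁ d₂ : ℕ} {P : CompositeProblem n d₁ d₂}
    {ε ε' : ℝ} {x : Vec n} (h : P.IsEpsOptimal ε x) (hle : ε ≤ ε') : P.IsEpsOptimal ε' x :=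
  ⟨h.1, h.2.1.trans hle, h.2.2.trans hle⟩

end

/-! ### The complexity theorem -/

theorem corollary4p4 :
    -- the constant hidden in the complexity bounds, a function of `(c₁, c₂)` and of the
    -- parameters of the outer method only
    ∃ C : ℝ → ℝ → IPALMParams → ℝ,
    ∀ (n d₁ d₂ : ℕ) (P : CompositeProblem n d₁ d₂) (c : ProblemConstants)
      (xs : Vec n) (ls : PairVec d₁ d₂) (θ : ℕ → ℝ) (a : IPALMParams)
      (X : ℕ → Vec n) (lam : ℕ → PairVec d₁ d₂) (m : ℕ → ℕ),
      P.Standing c xs ls → P.SmoothTerm c → P.NonlinearBounds c →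
      IsAPGWeights θ → a.Valid → IsIPALMRun P c θ a X lam m →
      let c₀ : ℝ := boundC₀ a (X 0) xs (lam 0) ls
      let c₁ : ℝ := boundC₁ a c.Lh₁ c₀ ls
      let c₂ : ℝ := boundC₂ a c.Lh₁ c₀
      let d : ℕ → ℝ := fun t => P.distConst c (lam t) (a.β t)
      -- `S s` involves the largest of `d 1, …, d s`
      let S : ℕ → ℝ := fun s => complexityFactor c a.β₀ (⨆ t : Fin s, d (t + 1))
      let total : ℕ → ℝ := fun s => ∑ t ∈ Finset.range (s + 1), (m t : ℝ)
      let logTerm : ℝ → ℝ := fun ε => Real.log (c₁ / (a.ρ * ε))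
      (∀ t, d t ≤ c.Mp₂ + a.β t * √c₀ + Metric.infDist 0 P.K) ∧
      (0 < c.μg → ∀ ε : ℝ, 0 < ε → ε ≤ a.ε₀ →
        ∃ s : ℕ, 1 ≤ s ∧ (∀ r, s ≤ r → P.IsEpsOptimal ε (X (r + 1))) ∧
          total s ≤ C c₁ c₂ a * ((√(S s) + √c.μg) / √(c.μg * ε)) * logTerm ε) ∧
      (c.μg = 0 → ∃ ε' : ℝ, 0 < ε' ∧ ∀ ε : ℝ, 0 < ε → ε ≤ a.ε₀ →
        ∃ s : ℕ, 1 ≤ s ∧ (∀ r, s ≤ r → P.IsEpsOptimal ε (X (r + 1))) ∧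
          total s ≤ C c₁ c₂ a * (√(S s) / ε * logTerm ε + logTerm ε ^ 2) ∧
          (ε ≤ ε' → total s ≤ C c₁ c₂ a * (√(S s) / ε) * logTerm ε)) := by
  refine ⟨complexityConst, fun n d₁ d₂ P c xs ls θ a X lam m hS hT hN hθ ha hR => ?_⟩
  intro c₀ c₁ c₂ d S total logTerm
  have hc₀ : 0 ≤ c₀ := boundC₀_nonneg _ _
  have hβ₀ := ha.β₀_pos
  have hρ := ha.ρ_pos
  have hL := hT.L_pos
  have hκ := ha.neg_log_pos
  have hc₁ : a.ε₀ ≤ c₁ := by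
    refine le_trans ?_ (le_max_left _ _)
    have : 0 ≤ 2 * c.Lh₁ ^ 2 * a.β₀ + c₀ * a.β₀ := by positivity
    linarith
  have hc₁0 : 0 < c₁ := ha.ε₀_pos.trans_le hc₁
  have hD0 : ∀ s, 0 ≤ ⨆ t : Fin s, d (t + 1) := fun s =>
    Real.iSup_nonneg fun t => CompositeProblem.distConst_nonneg _ _
  have hdle : ∀ s t, t < s → d (t + 1) ≤ ⨆ t : Fin s, d (t + 1) := fun s t ht =>
    le_ciSup (f := fun t : Fin s => d (t + 1)) (Set.finite_range _).bddAbove ⟨t, ht⟩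
  -- `X (r + 1)` is `x^r`, and the accuracy estimate is available from `r = 1` on; this is why `1 ≤
  -- s` is required.
  have hopt : ∀ (ε : ℝ) (s : ℕ), 1 ≤ s → c₁ * a.ρ ^ s ≤ ε → ∀ r, s ≤ r →
      P.IsEpsOptimal ε (X (r + 1)) := by
    intro ε s hs hle r hr
    obtain ⟨k, rfl⟩ : ∃ k, r = k + 1 := ⟨r - 1, by omega⟩
    refine (hR.isEpsOptimal hS hT hN hθ ha k).mono (le_trans ?_ hle)
    exact mul_le_mul_of_nonneg_left (pow_le_pow_of_le_one hρ.le ha.ρ_lt.le hr) hc₁0.le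
  have hlog : ∀ ε : ℝ, 0 < ε → ε ≤ a.ε₀ → -Real.log a.ρ ≤ logTerm ε := by
    intro ε hε hle
    rw [← Real.log_inv]
    refine Real.log_le_log (by positivity) ?_
    rw [le_div_iff₀ (by positivity), inv_mul_cancel_left₀ hρ.ne']
    exact hle.trans hc₁
  have hsum : ∀ (r k T : ℝ) (s : ℕ), 0 < r → r < 1 → 0 ≤ k → -Real.log a.ρ ≤ T →
      s * (-Real.log a.ρ) ≤ T →
      (∀ t < s, (P.halvingPeriod c (lam (t + 1)) (a.β (t + 1)) : ℝ) ≤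
        k * (r⁻¹) ^ (t + 1) + 1) →
      total s ≤ a.m₀ + logSlope c₂ a * T * (k * (r⁻¹) ^ s / (1 - r) + s) := by
    intro r k T s hr0 hr1 hk hT1 hTs hK
    rw [← hR.m_init]
    exact sum_iterations_le hr0 hr1 hk
      (mul_nonneg (logSlope_nonneg ha _) (hκ.le.trans hT1)) (fun t => Nat.cast_nonneg _)
      (hR.m_succ_le hS hT hN hθ ha) hK
      (fun t ht => add_mul_logb_le ha ht.le hT1 hTs)
  have hC1 := coeffConvex_nonneg ha hc₁0.le c₂
  have hC2 := coeffLogSq_nonneg ha c₂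
  have hC3 := coeffStrong_nonneg ha c₁ c₂
  have hC4 := coeffStrongRest_nonneg ha c₁ c₂
  refine ⟨fun t => ?_, fun hμ ε hε hle => ?_, fun hμ => ?_⟩
  · refine (CompositeProblem.distConst_le hN (lam t) (ha.β_pos t)).trans ?_
    have h1 := (WithLp.norm_snd_le_norm (lam t)).trans (hR.bounds hS hT hN hθ ha t).1
    have h2 := mul_le_mul_of_nonneg_left h1 (ha.β_pos t).le
    linarith
  · obtain ⟨s, hs1, hacc, hinv, hslog⟩ := exists_outer_iterations hρ ha.ρ_lt hε (hle.trans hc₁)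
    refine ⟨s, hs1, hopt ε s hs1 hacc, ?_⟩
    have hT1 := hlog ε hε hle
    have htot := hsum (√a.ρ) (2 * √2 * √(S s) / (√a.β₀ * √c.μg)) (logTerm ε) s
      (Real.sqrt_pos.2 hρ) ha.sqrt_ρ_lt_one (by positivity) hT1 hslog
      (fun t ht => halvingPeriod_le_of_pos hS hT hN ha hμ (hdle s t ht))
    refine (strong_total_le ha hc₁0.le hε hle hμ (Real.sqrt_nonneg _) hT1 hslog
      (log_le_two_mul_sqrt (by positivity)) hinv htot).trans ?_
    have hT0 : 0 ≤ logTerm ε := hκ.le.trans hT1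
    rw [complexityConst]
    exact mul_le_mul_of_nonneg_right
      (mul_le_mul_of_nonneg_right (by linarith) (by positivity)) hT0
  -- This threshold ensures `4 c₁ ε / ρ ≤ L β₀ ≤ S`, so that the logarithm is at most `2 √(c₁ / (ρ
  -- ε)) ≤ √S / ε` and its square is absorbed into the leading term.
  · refine ⟨c.L * a.β₀ * a.ρ / (4 * c₁), by positivity, fun ε hε hle => ?_⟩
    obtain ⟨s, hs1, hacc, hinv, hslog⟩ := exists_outer_iterations hρ ha.ρ_lt hε (hle.trans hc₁)
    have hT1 := hlog ε hε hle
    have hT0 : 0 ≤ logTerm ε := hκ.le.trans hT1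
    have htot := hsum a.ρ (2 * √2 * √(S s) / a.β₀) (logTerm ε) s hρ ha.ρ_lt (by positivity) hT1
      hslog (fun t ht => halvingPeriod_le_of_eq_zero hS hT hN ha hμ (hdle s t ht))
    have hbound := convex_total_le ha hε (Real.sqrt_nonneg _) hT1 hslog hinv htot
    have hσ : 0 ≤ √(S s) / ε * logTerm ε := by positivity
    refine ⟨s, hs1, hopt ε s hs1 hacc, hbound.trans ?_, fun hε' => hbound.trans ?_⟩
    · rw [complexityConst]
      nlinarith [mul_nonneg hC1 (sq_nonneg (logTerm ε)), mul_nonneg hC2 hσ,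
        mul_nonneg (add_nonneg hC3 hC4) (add_nonneg hσ (sq_nonneg (logTerm ε)))]
    · have h1 : logTerm ε ≤ √(S s) / ε := by
        refine (log_le_two_mul_sqrt (by positivity)).trans ?_
        have h2 : 2 * √(c₁ / (a.ρ * ε)) = √(4 * (c₁ / (a.ρ * ε))) := by
          rw [Real.sqrt_mul (by norm_num), show (4 : ℝ) = 2 ^ 2 by norm_num,
            Real.sqrt_sq zero_le_two]
        rw [h2, le_div_iff₀ hε]
        refine Real.le_sqrt_of_sq_le ?_
        rw [mul_pow, Real.sq_sqrt (by positivity)]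
        refine le_trans ?_ (complexityFactor_pos hS hT hN hβ₀ (hD0 s))
        rw [le_div_iff₀ (by positivity)] at hε'
        have e : 4 * (c₁ / (a.ρ * ε)) * ε ^ 2 = ε * (4 * c₁) / a.ρ := by
          field_simp
        rw [e, div_le_iff₀ hρ]
        exact hε'
      have h3 : logTerm ε ^ 2 ≤ √(S s) / ε * logTerm ε := by
        rw [sq]; gcongr
      have h4 := mul_le_mul_of_nonneg_left h3 hC2
      rw [complexityConst]
      nlinarith [mul_nonneg (add_nonneg hC3 hC4) hσ]
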